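/- Let $n\ge 1$, $Q=2n+2$, and let $S^{2n+1}\subset\mathbb C^{n+1}$ be the unit sphere with its standard volume element $d\zeta$, Hermitian product $\zeta\cdot\bar\eta=\sum_j\zeta_j\bar\eta_j$ and distance function $d(\zeta,\eta)=(2|1-\zeta\cdot\bar\eta|)^{1/2}$. For $w\in\mathbb C$, $|w|\le1$, $w\ne\pm1$, put $\theta(w)=\arg\frac{1-w}{1+w}\in[-\frac\pi2,\frac\pi2]$ (the value at the exceptional points is immaterial). On the Heisenberg group $\mathbb H^n=\mathbb C^n\times\mathbb R$ let $|(z,t)|=(|z|^4+t^2)^{1/4}$, let $\Sigma=\{u\in\mathbb H^n:|u|=1\}$, and let $du^*$ be the measure on $\Sigma$ for which Lebesgue measure is $du=r^{Q-1}\,dr\,du^*$ in the polar coordinates $r=|u|$, $u^*=(z/r,t/r^2)$. A function of $\theta\in[-\frac\pi2,\frac\pi2]$ is regarded as a function on $\Sigma$ by $\theta=\arcsin t^*$, $u^*=(z^*,t^*)\in\Sigma$. Let $0<d<Q$, $p=Q/d$, $\frac1p+\frac1{p'}=1$. Let $g_0:[-\frac\pi2,\frac\pi2]\to\mathbb R$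 be bounded and measurable with $\int_\Sigma|g_0|^{p'}du^*\neq0$, and let $G$ be a real-valued function on $S^{2n+1}\times S^{2n+1}$, measurable off the diagonal, such that for some $\epsilon>0$ and some constant $C$ $$\big|G(\zeta,\eta)-g_0(\theta(\zeta\cdot\bar\eta))\,d(\zeta,\eta)^{d-Q}\big|\le C\,d(\zeta,\eta)^{d-Q+\epsilon}\qquad\text{for all }\zeta\ne\eta .$$ Then $TF(\zeta)=\int_{S^{2n+1}}G(\zeta,\eta)F(\eta)\,d\eta$ is defined (as an absolutely convergent integral, for almost every $\zeta$) and measurable for every real- or complex-valued $F\in L^p(S^{2n+1})$, and there is $C_0>0$ such that for all $F\in L^p(S^{2n+1})$ $$\int_{S^{2n+1}}\exp\Big[A_d\Big(\frac{|TF|}{\|F\|_p}\Big)^{p'}\Big]d\zeta\le C_0,\qquad A_d=\frac{2Q}{\int_\Sigma|g_0|^{p'}du^*}$$ (the quotient $|TF|/\|F\|_p$ is read as $0$ when $\|F\|_p=0$). Moreover, if $g_0$ is Hölder continuous of some order $\sigma\in(0,1]$ on $[-\frac\pi2,\frac\pi2]$, then the constant $A_d$ is sharp: for every $a>A_d$ there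 is a sequence of nonzero functions $F_m\in L^p(S^{2n+1})$ such that $$\int_{S^{2n+1}}\exp\Big[a\Big(\frac{|TF_m|}{\|F_m\|_p}\Big)^{p'}\Big]d\zeta\longrightarrow+\infty\qquad(m\to\infty).$$ -/

import Mathlib

open MeasureTheory Filter Topology
open scoped ENNReal NNReal

noncomputable section

namespace CR

/-- The ambient space `ℂⁿ⁺¹` of the CR sphere. -/
abbrev Ambient (n : ℕ) : Type := EuclideanSpace ℂ (Fin (n + 1))

/-- The unit sphere `S²ⁿ⁺¹ ⊆ ℂⁿ⁺¹`. -/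
abbrev Sphere (n : ℕ) : Type := Metric.sphere (0 : Ambient n) 1

/-- Lebesgue measure on `ℂⁿ⁺¹`, i.e. the product of the area measures of the factors. -/
def ambientVolume (n : ℕ) : Measure (Ambient n) :=
  (volume : Measure (Fin (n + 1) → ℂ)).map (WithLp.toLp 2)

/-- The standard volume element `dζ` on `S²ⁿ⁺¹` (total mass `2 π ^ (n + 1) / n!`). -/
def surface (n : ℕ) : Measure (Sphere n) := (ambientVolume n).toSphere

/-- The Hermitian product `ζ · η̄ = ∑ j, ζ j * conj (η j)`. -/
def herm {n : ℕ} (ζ η : Sphere n) : ℂ :=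
  ∑ j, (ζ : Ambient n) j * (starRingEnd ℂ) ((η : Ambient n) j)

/-- The distance function `d(ζ, η) = (2 |1 - ζ · η̄|) ^ (1 / 2)`. -/
def dist {n : ℕ} (ζ η : Sphere n) : ℝ := Real.sqrt (2 * ‖1 - herm ζ η‖)

/-- `θ(w) = arg ((1 - w) / (1 + w))`, an element of `[-π/2, π/2]` when `|w| ≤ 1`. -/
def theta (w : ℂ) : ℝ := Complex.arg ((1 - w) / (1 + w))

/-- The homogeneous dimension `Q = 2 n + 2`. -/
def homDim (n : ℕ) : ℝ := 2 * n + 2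

/-- The set underlying the Heisenberg group `ℍⁿ`, with its points `u = (z, t)`; its `volume` is
Lebesgue measure. -/
abbrev Heis (n : ℕ) : Type := (Fin n → ℂ) × ℝ

/-- The homogeneous norm `|(z, t)| = (|z| ^ 4 + t ^ 2) ^ (1 / 4)`. -/
def heisNorm {n : ℕ} (u : Heis n) : ℝ :=
  ((∑ j, ‖u.1 j‖ ^ 2) ^ 2 + u.2 ^ 2) ^ (1 / 4 : ℝ)

/-- The projection `u* = u / |u|` of `u ≠ 0` onto the Heisenberg sphere `Σ = {|u| = 1}`, where the
division is by the group dilation: `(z, t) / r = (z / r, t / r ^ 2)`. -/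
def heisProj {n : ℕ} (u : Heis n) : Heis n :=
  (fun j => u.1 j / (heisNorm u : ℂ), u.2 / heisNorm u ^ 2)

/-- The measure `du*` on the Heisenberg sphere `Σ` (regarded as a measure on `ℍⁿ` carried by `Σ`)
that appears in polar coordinates `du = r ^ (Q - 1) dr du*`: the measure of `E ⊆ Σ` is
`Q` times the volume of the cone `{u : 0 < |u| < 1, u* ∈ E}`. -/
def heisSphereMeasure (n : ℕ) : Measure (Heis n) :=
  ENNReal.ofReal (homDim n) •
    ((volume : Measure (Heis n)).restrict {u | 0 < heisNorm u ∧ heisNorm u < 1}).map heisProj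

/-- `∫_Σ |g₀| ^ q du*`, where the function `g₀` of `θ` is regarded as a function on `Σ` through
`θ = arcsin t*`. -/
def sigmaIntegral (n : ℕ) (g₀ : ℝ → ℝ) (q : ℝ) : ℝ :=
  ∫ u, |g₀ (Real.arcsin u.2)| ^ q ∂(heisSphereMeasure n)

variable {𝕜 : Type*} [RCLike 𝕜]

/-- The integral operator `TF(ζ) = ∫ G(ζ, η) F(η) dη`. -/
def T {n : ℕ} (G : Sphere n → Sphere n → ℝ) (F : Sphere n → 𝕜) (ζ : Sphere n) : 𝕜 :=
  ∫ η, (G ζ η : 𝕜) * F η ∂(surface n)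

/-- The norm `‖F‖_p` in `L^p(S²ⁿ⁺¹)`. -/
def lpNorm {n : ℕ} (p : ℝ) (F : Sphere n → 𝕜) : ℝ :=
  (eLpNorm F (ENNReal.ofReal p) (surface n)).toReal

/-- The exponential integral `∫ exp [a (|TF| / ‖F‖_p) ^ q] dζ`, with values in `[0, ∞]`. -/
def expIntegral {n : ℕ} (G : Sphere n → Sphere n → ℝ) (p q a : ℝ) (F : Sphere n → 𝕜) : ℝ≥0∞ :=
  ∫⁻ ζ, ENNReal.ofReal (Real.exp (a * (‖T G F ζ‖ / lpNorm p F) ^ q)) ∂(surface n)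

end CR

end

/-! ### The one-dimensional estimate of Adams and Garsia -/

namespace AdamsGarsia

/-! Write q for p'. Both halves of the theorem rest on one computation. Seen from a fixed ζ, the
variable w = ζ·η̄ has a density proportional to (1 - |w|²)^(n-1) on the unit disc
(`lintegral_herm`). The Cayley transform v = (1 - w)/(1 + w) carries the disc to the half plane Re v
> 0; there arg v is the angle θ, and |v| is comparable to d² near the diagonal. In the polar
coordinates of v the radius and the angle separate: integrating a function of sin θ and of ρ = |v|
against d^(-Q) dη gives 1/4 of the integral over Σ times the integral against dρ/ρ, up to a factor
tending to 1 as ρ → 0 (`lintegral_dist_separated`). So the integral of |g₀|^q d^(-Q) over a shell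
grows like (1/4) ∫_Σ |g₀|^q du* times the logarithm of the ratio of the radii. Measured by V =
|v|^(n+1), which is of the order of the volume of a ball, the coefficient of the logarithm is A =
∫_Σ |g₀|^q du* / (2Q), the inverse of A_d.

For the inequality, |G| is dominated by a majorant whose q-th power obeys this shell estimate with a
bounded error, because the remainder adds only a multiple of the integrable function d^(ε-Q)
(`exists_adamsKernel`). The rest is abstract: `AdamsKernel.exists_lintegral_exp_le`. Let u be the
potential of f, with ‖f‖_p ≤ 1, let E_k = {u > (Ak)^(1/q)} and s_k = log (R/μ(E_k)). Split μ at the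
quantile of f of mass μ(E_k) (`exists_bathtub`), and let H_k be the share of ∫ f^p carried by the
part where f is large. Averaging u over a smaller level set E_l and applying Hölder's inequality on
shells bounds l^(1/q) by two terms, weighted by (1 - H_k)^(1/p) and H_k^(1/p) (`exists_mass`). From
these inequalities alone `AdamsGarsia.tsum_exp_le` bounds ∑ e^(k - s_k), which controls the
exponential integral: s_k - k is bounded below, and only O(1 + j) indices have s_k - k ≤ j.

For sharpness, `testFun` is the Hölder extremal of the homogeneous kernel seen from ζ₀, cut off to a
shell with inner radius ρ. With N the mass of |g|^q d^(-Q) on the shell, its norm is N^(1/p) and its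
potential at ζ₀ is about N. The potential stays above τN, with τ < 1 as close to 1 as desired, on a
ball of radius comparable to ρ (`exists_potential_ge`). Since N is about (1/4) ∫_Σ |g₀|^q du* · log
(1/ρ) and the ball has measure at least a multiple of ρ^(n+1), the exponential integral diverges as
ρ → 0 once a > A_d. -/

/-- Hölder's inequality for sums of two terms. -/
lemma holder_two {p q : ℝ} (h : p.HolderConjugate q) {a b x y : ℝ} (ha : 0 ≤ a) (hb : 0 ≤ b)
    (hx : 0 ≤ x) (hy : 0 ≤ y) :
    a ^ (1 / q) * x ^ (1 / p) + b ^ (1 / q) * y ^ (1 / p)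
      ≤ (a + b) ^ (1 / q) * (x + y) ^ (1 / p) := by
  have hp := h.pos
  have hq := h.symm.pos
  have key := Real.inner_le_Lp_mul_Lq_of_nonneg (Finset.univ : Finset (Fin 2)) h.symm
    (f := ![a ^ (1 / q), b ^ (1 / q)]) (g := ![x ^ (1 / p), y ^ (1 / p)])
    (by intro i _; fin_cases i <;> simp <;> positivity)
    (by intro i _; fin_cases i <;> simp <;> positivity)
  have e : ∀ z r : ℝ, 0 ≤ z → 0 < r → (z ^ (1 / r)) ^ r = z := by
    intro z r hz hr
    rw [← Real.rpow_mul hz, one_div, inv_mul_cancel₀ hr.ne', Real.rpow_one]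
  simp only [Fin.sum_univ_two, Matrix.cons_val_zero, Matrix.cons_val_one] at key
  rwa [e a q ha hq, e b q hb hq, e x p hx hp, e y p hy hp] at key

/-- If `s` and `k` are within `m` of each other from above, the mass `H` at scale `s` is at most
a multiple of `(1 + m) / s`. -/
lemma mass_bound {p q B : ℝ} (h : p.HolderConjugate q) (hB : 1 ≤ B) :
    ∃ C, 1 ≤ C ∧ ∀ k s H m : ℝ, 0 ≤ k → 0 ≤ s → 0 ≤ H → H ≤ 1 → 0 ≤ m → s - k ≤ m →
      k ^ (1 / q) ≤ (s + B) ^ (1 / q) * (1 - H) ^ (1 / p) + (B ^ (1 / q) + B) * H ^ (1 / p) →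
      (s + B) * H ≤ C * (1 + m) := by
  have hp := h.pos
  have hq := h.symm.pos
  have hp1 := h.lt
  set D := B ^ (1 / q) + B with hD
  have hD0 : 0 ≤ D := by positivity
  set E : ℝ := (D * 2 ^ (1 / p)) ^ q / q with hE
  have hE0 : 0 ≤ E := by positivity
  refine ⟨2 * p * (1 + B + E), ?_, ?_⟩
  · nlinarith
  intro k s H m hk hs hH hH1 hm hsk hineq
  set S := s + B with hS
  have hS0 : 0 < S := by linarith
  have hX0 : 0 ≤ S * H := by positivity
  suffices hX : S * H / (2 * p) ≤ (m + B) + E by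
    rw [div_le_iff₀ (by positivity)] at hX
    nlinarith [mul_nonneg hm (by positivity : 0 ≤ p * (B + E))]
  rcases lt_or_ge S (m + B) with hlt | hge
  · have : S * H / (2 * p) ≤ S := by
      rw [div_le_iff₀ (by positivity)]
      nlinarith
    linarith
  · have h1 : S ^ (1 / q) * (1 - (m + B) / S) ≤ k ^ (1 / q) := by
      have h0 : 0 ≤ 1 - (m + B) / S := by
        rw [sub_nonneg, div_le_one hS0]; exact hge
      have h2 : 1 - (m + B) / S ≤ (1 - (m + B) / S) ^ (1 / q) := by
        have := Real.rpow_le_rpow_of_exponent_ge' h0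
          (by have : 0 ≤ (m + B) / S := by positivity
              linarith) (by positivity : 0 ≤ 1 / q)
          (by rw [div_le_one hq]; exact h.symm.lt.le : 1 / q ≤ 1)
        simpa using this
      calc S ^ (1 / q) * (1 - (m + B) / S) ≤ S ^ (1 / q) * (1 - (m + B) / S) ^ (1 / q) := by gcongr
        _ = (S * (1 - (m + B) / S)) ^ (1 / q) := (Real.mul_rpow hS0.le h0).symm
        _ ≤ k ^ (1 / q) := by
          apply Real.rpow_le_rpow (by positivity) _ (by positivity)
          rw [mul_sub, mul_div_cancel₀ _ hS0.ne']
          linarith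
    have h2 : (1 - H) ^ (1 / p) ≤ 1 - H / p := by
      have := rpow_one_add_le_one_add_mul_self (s := -H) (by linarith) (p := 1 / p)
        (by positivity) (by rw [div_le_one hp]; exact hp1.le)
      rw [← sub_eq_add_neg] at this
      refine this.trans (le_of_eq ?_); ring
    have h3 : S ^ (1 / q) * (1 - (m + B) / S) ≤ S ^ (1 / q) * (1 - H / p) + D * H ^ (1 / p) := by
      refine h1.trans (hineq.trans ?_)
      gcongr
    have hpq : 1 / p + 1 / q = 1 := by
      have := h.inv_add_inv_eq_one; simpa using this
    have hSS : S ^ (1 / p) * S ^ (1 / q) = S := by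
      rw [← Real.rpow_add hS0, hpq, Real.rpow_one]
    -- Multiplying by S^(1/p) leaves an inequality for the single quantity SH: the leading S
    -- cancels, and the gain SH/p faces a loss of order (SH)^(1/p), half of the gain absorbing it by
    -- Young's inequality.
    have h4 : S * (1 - (m + B) / S) ≤ S * (1 - H / p) + D * (S * H) ^ (1 / p) := by
      have := mul_le_mul_of_nonneg_left h3 (by positivity : 0 ≤ S ^ (1 / p))
      rw [Real.mul_rpow hS0.le hH]
      calc _ = S ^ (1 / p) * (S ^ (1 / q) * (1 - (m + B) / S)) := by rw [← mul_assoc, hSS]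
        _ ≤ _ := this
        _ = (S ^ (1 / p) * S ^ (1 / q)) * (1 - H / p) + D * (S ^ (1 / p) * H ^ (1 / p)) := by ring
        _ = _ := by rw [hSS]
    have h5 : D * (S * H) ^ (1 / p) ≤ S * H / (2 * p) + E := by
      have := Real.young_inequality_of_nonneg (a := (S * H / 2) ^ (1 / p)) (b := D * 2 ^ (1 / p))
        (by positivity) (by positivity) h
      rw [← Real.rpow_mul (by positivity), one_div_mul_cancel hp.ne', Real.rpow_one] at this
      have e : (S * H / 2) ^ (1 / p) * (D * 2 ^ (1 / p)) = D * (S * H) ^ (1 / p) := by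
        rw [Real.div_rpow hX0 (by norm_num)]
        field_simp
      rw [e] at this
      refine this.trans (le_of_eq ?_)
      rw [hE]; field_simp
    have h6 : S * (1 - (m + B) / S) = S - (m + B) := by field_simp
    have h7 : S * (1 - H / p) = S - S * H / p := by ring
    have h8 : S * H / p = S * H / (2 * p) + S * H / (2 * p) := by field_simp; ring
    linarith

/-- The levels `k` for which the superlevel sets are as large as the exponential bound allows
cannot be far apart. -/
lemma level_gap {p q B C₁ : ℝ} (h : p.HolderConjugate q) (hB : 1 ≤ B) (hC₁ : 0 ≤ C₁) :
    ∃ C, 1 ≤ C ∧ ∀ k l s r H m : ℝ, 0 ≤ k → k ≤ l → 0 ≤ s → s ≤ r → 0 ≤ H → H ≤ 1 → 0 ≤ m →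
      s - k ≤ m → r - l ≤ m → l ≤ r + C₁ →
      k ^ (1 / q) ≤ (s + B) ^ (1 / q) * (1 - H) ^ (1 / p) + (B ^ (1 / q) + B) * H ^ (1 / p) →
      l ^ (1 / q) ≤ (s + B) ^ (1 / q) * (1 - H) ^ (1 / p)
        + ((r - s + B) ^ (1 / q) + B) * H ^ (1 / p) →
      k ≤ s + C₁ → 2 * C * (1 + m) ≤ k → l - k ≤ 100 * C * (1 + m) := by
  have hp := h.pos
  have hq := h.symm.pos
  obtain ⟨C₂, hC₂, hmass⟩ := mass_bound h hB
  -- Chosen so that (D/2)^(1/q) (κH)^(1/p) = (1 + B) D^(1/q) H^(1/p), where D = r - s + B. Hölder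
  -- then produces S + D/2 rather than S + D, and r - s can be absorbed at the end.
  set κ : ℝ := 2 ^ (p / q) * (1 + B) ^ p with hκ
  have hκ0 : 0 ≤ κ := by positivity
  set a : ℝ := κ * (q / p) with ha
  have ha0 : 0 ≤ a := by positivity
  refine ⟨C₁ + B + 8 * a * C₂, by nlinarith [mul_nonneg ha0 (by linarith : 0 ≤ C₂)], ?_⟩
  intro k l s r H m hk hkl hs hsr hH hH1 hm hsk hrl hlr hineq hineq2 hks hbig
  have hX := hmass k s H m hk hs hH hH1 hm hsk hineq
  set S := s + B with hS
  have hS0 : 0 < S := by linarith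
  have haC : 0 ≤ a * C₂ := by positivity
  -- The threshold 2C(1 + m) ≤ k makes S large compared with the bound C₂(1 + m) for SH, so H is
  -- small.
  have haH : a * H ≤ 1 / 8 := by
    have h0 : 0 ≤ a * C₂ * m := mul_nonneg haC hm
    have hBm : 0 ≤ B * m := by positivity
    have h1 : 8 * (a * C₂) + 8 * (a * C₂ * m) ≤ S := by
      have hCm : 0 ≤ C₁ * m := by positivity
      have e : 2 * (C₁ + B + 8 * a * C₂) * (1 + m) = 2 * C₁ + 2 * (C₁ * m)
        + 2 * B + 2 * (B * m) + 16 * (a * C₂) + 16 * (a * C₂ * m) := by ring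
      linarith
    have h2 : S * (a * H) ≤ S * (1 / 8) := by
      have := mul_le_mul_of_nonneg_left hX ha0
      have e : a * (C₂ * (1 + m)) = a * C₂ + a * C₂ * m := by ring
      have e' : S * (a * H) = a * (S * H) := by ring
      linarith
    exact le_of_mul_le_mul_left h2 hS0
  set D := r - s + B with hD
  have hD1 : 1 ≤ D := by linarith
  have h1 : l ^ (1 / q) ≤ (S + D / 2) ^ (1 / q) * (1 + κ * H) ^ (1 / p) := by
    refine hineq2.trans (le_trans ?_ (holder_two h hS0.le (by positivity) zero_le_one
      (by positivity)))
    have e1 : (1 - H) ^ (1 / p) ≤ 1 ^ (1 / p) :=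
      Real.rpow_le_rpow (by linarith) (by linarith) (by positivity)
    have e2 : D ^ (1 / q) + B ≤ (1 + B) * D ^ (1 / q) := by
      have : 1 ≤ D ^ (1 / q) := Real.one_le_rpow hD1 (by positivity)
      nlinarith
    have e3 : (D / 2) ^ (1 / q) * (κ * H) ^ (1 / p) = (1 + B) * D ^ (1 / q) * H ^ (1 / p) := by
      rw [Real.mul_rpow hκ0 hH, hκ, Real.mul_rpow (by positivity) (by positivity),
        ← Real.rpow_mul (by norm_num), ← Real.rpow_mul (by positivity),
        Real.div_rpow (by positivity) (by norm_num), mul_one_div_cancel hp.ne', Real.rpow_one,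
        show p / q * (1 / p) = 1 / q by field_simp]
      field_simp
    rw [e3]
    gcongr
  have hl0 : 0 ≤ l := hk.trans hkl
  have h2 : l ≤ (S + D / 2) * (1 + κ * H) ^ (q / p) := by
    have := Real.rpow_le_rpow (by positivity) h1 hq.le
    rw [Real.mul_rpow (by positivity) (by positivity), ← Real.rpow_mul hl0,
      ← Real.rpow_mul (by positivity), ← Real.rpow_mul (by positivity),
      one_div_mul_cancel hq.ne', Real.rpow_one, Real.rpow_one, one_div_mul_eq_div] at this
    exact this
  have h3 : (1 + κ * H) ^ (q / p) ≤ 1 + 2 * (a * H) := by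
    calc (1 + κ * H) ^ (q / p) ≤ (Real.exp (κ * H)) ^ (q / p) := by
          apply Real.rpow_le_rpow (by positivity) _ (by positivity)
          linarith [Real.add_one_le_exp (κ * H)]
      _ = Real.exp (a * H) := by rw [← Real.exp_mul, ha]; ring_nf
      _ ≤ 1 + 2 * (a * H) := by
          have h0 : 0 ≤ a * H := by positivity
          have := Real.abs_exp_sub_one_le (x := a * H) (by rw [abs_of_nonneg h0]; linarith)
          rw [abs_of_nonneg h0] at this
          linarith [le_abs_self (Real.exp (a * H) - 1)]
  have h4 : l ≤ (S + D / 2) * (1 + 2 * (a * H)) :=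
    h2.trans (mul_le_mul_of_nonneg_left h3 (by positivity))
  have h5 : a * (S * H) ≤ a * (C₂ * (1 + m)) := mul_le_mul_of_nonneg_left hX ha0
  have h6 : D * (a * H) ≤ D * (1 / 8) := mul_le_mul_of_nonneg_left haH (by linarith)
  have h7 : l ≤ S + 5 / 8 * D + 2 * (a * C₂ * (1 + m)) := by
    have e : (S + D / 2) * (1 + 2 * (a * H))
      = S + D / 2 + 2 * (a * (S * H)) + D * (a * H) := by ring
    have e' : a * (C₂ * (1 + m)) = a * C₂ * (1 + m) := by ring
    linarith
  -- Since r - m ≤ l, the coefficient 5/8 = 1/2 + 1/8 of D being less than 1 is what bounds r - s.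
  have h8 : 3 / 8 * (r - s) ≤ m + 13 / 8 * B + 2 * (a * C₂ * (1 + m)) := by linarith
  have h9 : 0 ≤ B * m := by positivity
  have h10 : 0 ≤ a * C₂ * m := by positivity
  have h11 : m ≤ B * m := le_mul_of_one_le_left hm hB
  have hCm : 0 ≤ C₁ * m := by positivity
  have e : 100 * (C₁ + B + 8 * a * C₂) * (1 + m)
    = 100 * C₁ + 100 * (C₁ * m) + 100 * B + 100 * (B * m) + 800 * (a * C₂) + 800 * (a * C₂ * m) := by ring
  have e' : a * C₂ * (1 + m) = a * C₂ + a * C₂ * m := by ring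
  linarith

/-- The weights 1 - H and H add up to 1, so `holder_two` merges the two terms into one q-th root.
This is the crude lower bound for s - k that starts the counting in `tsum_exp_le`. -/
lemma level_le {p q B : ℝ} (h : p.HolderConjugate q) (hB : 1 ≤ B) {k s H : ℝ} (hk : 0 ≤ k)
    (hs : 0 ≤ s) (hH : 0 ≤ H) (hH1 : H ≤ 1)
    (hineq : k ^ (1 / q) ≤ (s + B) ^ (1 / q) * (1 - H) ^ (1 / p)
      + (B ^ (1 / q) + B) * H ^ (1 / p)) :
    k ≤ s + (B + (B ^ (1 / q) + B) ^ q) := by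
  have hp := h.pos
  have hq := h.symm.pos
  set D := B ^ (1 / q) + B with hD
  have hD0 : 0 ≤ D := by positivity
  have h1 := holder_two h (a := s + B) (b := D ^ q) (x := 1 - H) (y := H) (by linarith)
    (by positivity) (by linarith) hH
  rw [← Real.rpow_mul hD0, mul_one_div_cancel hq.ne', Real.rpow_one, sub_add_cancel,
    Real.one_rpow, mul_one] at h1
  have h2 := (Real.rpow_le_rpow_iff hk (by positivity) (by positivity : 0 < 1 / q)).1
    (hineq.trans h1)
  linarith

/-- A set of natural numbers whose elements above `a` are at distance at most `b` from each other
has at most `a + b + 3` elements. -/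
lemma encard_le_of_gap {D : Set ℕ} {a b : ℝ} (ha : 0 ≤ a) (hb : 0 ≤ b)
    (h : ∀ k ∈ D, ∀ l ∈ D, a ≤ k → k ≤ l → (l : ℝ) - k ≤ b) :
    (D.encard : ℝ≥0∞) ≤ ENNReal.ofReal (a + b + 3) := by
  have hsub : ∃ T : Finset ℕ, D ⊆ T ∧ (T.card : ℝ) ≤ a + b + 3 := by
    by_cases hne : ∃ k, k ∈ D ∧ a ≤ (k : ℝ)
    · classical
      let m := Nat.find hne
      have hm : m ∈ D ∧ a ≤ (m : ℝ) := Nat.find_spec hne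
      refine ⟨Finset.range ⌈a⌉₊ ∪ Finset.Icc m (m + ⌊b⌋₊), ?_, ?_⟩
      · intro k hk
        simp only [Finset.coe_union, Set.mem_union, Finset.mem_coe, Finset.mem_range,
          Finset.mem_Icc]
        by_cases hak : a ≤ (k : ℝ)
        · right
          have hmk : m ≤ k := Nat.find_min' hne ⟨hk, hak⟩
          refine ⟨hmk, ?_⟩
          have h1 := h m hm.1 k hk hm.2 hmk
          have h2 : k - m ≤ ⌊b⌋₊ := Nat.le_floor (by rwa [Nat.cast_sub hmk])
          omega
        · left
          exact Nat.lt_ceil.2 (not_le.1 hak)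
      · have h1 := Finset.card_union_le (Finset.range ⌈a⌉₊) (Finset.Icc m (m + ⌊b⌋₊))
        simp only [Finset.card_range, Nat.card_Icc] at h1
        have h2 : ((Finset.range ⌈a⌉₊ ∪ Finset.Icc m (m + ⌊b⌋₊)).card : ℝ) ≤ ⌈a⌉₊ + (⌊b⌋₊ + 1) := by
          exact_mod_cast h1.trans (by omega)
        have h3 := (Nat.ceil_lt_add_one ha).le
        have h4 := Nat.floor_le hb
        linarith
    · push Not at hne
      refine ⟨Finset.range ⌈a⌉₊, ?_, ?_⟩
      · intro k hk
        simpa using Nat.lt_ceil.2 (hne k hk)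
      · have h3 := (Nat.ceil_lt_add_one ha).le
        simp only [Finset.card_range]
        linarith
  obtain ⟨T, hT, hcard⟩ := hsub
  calc (D.encard : ℝ≥0∞) ≤ ((T : Set ℕ).encard : ℝ≥0∞) := by
        exact_mod_cast Set.encard_le_encard hT
    _ = ENNReal.ofReal T.card := by simp
    _ ≤ _ := ENNReal.ofReal_le_ofReal hcard

/-- The summed form of the lemma of Adams and Garsia. -/
lemma tsum_exp_le {p q B : ℝ} (h : p.HolderConjugate q) (hB : 1 ≤ B) :
    ∃ C : ℝ≥0∞, C ≠ ∞ ∧ ∀ (P : Set ℕ) (s H : ℕ → ℝ), (∀ k ∈ P, 0 ≤ s k) →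
      (∀ k ∈ P, 0 ≤ H k ∧ H k ≤ 1) → (∀ k ∈ P, ∀ l ∈ P, k ≤ l → s k ≤ s l) →
      (∀ k ∈ P, ∀ l ∈ P, k ≤ l → (l : ℝ) ^ (1 / q) ≤ (s k + B) ^ (1 / q) * (1 - H k) ^ (1 / p)
        + ((s l - s k + B) ^ (1 / q) + B) * H k ^ (1 / p)) →
      ∑' k, P.indicator (fun k => ENNReal.ofReal (Real.exp (k - s k))) k ≤ C := by
  set C₁ := B + (B ^ (1 / q) + B) ^ q with hC₁
  have hC₁0 : 0 ≤ C₁ := by positivity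
  obtain ⟨C₂, hC₂, hgap⟩ := level_gap h hB hC₁0
  -- At most 2C₂(1 + j) + 100C₂(1 + j) + 3 indices k satisfy s k - k ≤ j. An index is charged to j =
  -- ⌈s k - k⌉₊, where its term is at most e^(1 + C₁ - j): the 1 pays for rounding up, and C₁ for
  -- negative s k - k.
  refine ⟨∑' j : ℕ, ENNReal.ofReal (Real.exp (1 + C₁) * Real.exp (-j) *
    (102 * C₂ * (1 + j) + 3)), ?_, ?_⟩
  · rw [← ENNReal.ofReal_tsum_of_nonneg]
    · exact ENNReal.ofReal_ne_top
    · intro j; positivity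
    · have s0 : Summable fun j : ℕ => Real.exp (-(j : ℝ)) := Real.summable_exp_neg_nat
      have s1 : Summable fun j : ℕ => (j : ℝ) ^ 1 * Real.exp (-1 * (j : ℝ)) :=
        Real.summable_pow_mul_exp_neg_nat_mul 1 one_pos
      refine ((s0.mul_left (Real.exp (1 + C₁) * (102 * C₂ + 3))).add
        (s1.mul_left (Real.exp (1 + C₁) * (102 * C₂)))).congr fun j => ?_
      rw [neg_one_mul]; ring
  intro P s H hs hH hmono hineq
  have hle : ∀ k ∈ P, (k : ℝ) ≤ s k + C₁ := fun k hk =>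
    level_le h hB (Nat.cast_nonneg k) (hs k hk) (hH k hk).1 (hH k hk).2
      (by simpa using hineq k hk k hk le_rfl)
  let D : ℕ → Set ℕ := fun j => {k | k ∈ P ∧ s k - k ≤ j}
  have hcard : ∀ j : ℕ, ((D j).encard : ℝ≥0∞) ≤ ENNReal.ofReal (102 * C₂ * (1 + j) + 3) := by
    intro j
    have := encard_le_of_gap (D := D j) (a := 2 * C₂ * (1 + j)) (b := 100 * C₂ * (1 + j))
      (by positivity) (by positivity) ?_
    · refine this.trans (ENNReal.ofReal_le_ofReal ?_)
      linarith
    · intro k hk l hl hak hkl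
      have hkl' : (k : ℝ) ≤ l := by exact_mod_cast hkl
      have hj : (0 : ℝ) ≤ j := Nat.cast_nonneg j
      exact hgap k l (s k) (s l) (H k) j (Nat.cast_nonneg k) hkl' (hs k hk.1)
          (hmono k hk.1 l hl.1 hkl) (hH k hk.1).1 (hH k hk.1).2 hj hk.2 hl.2
          (hle l hl.1) (by simpa using hineq k hk.1 k hk.1 le_rfl)
          (hineq k hk.1 l hl.1 hkl) (hle k hk.1) hak
  have hpt : ∀ k, P.indicator (fun k => ENNReal.ofReal (Real.exp (k - s k))) k ≤
      ∑' j : ℕ, (D j).indicator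
        (fun _ => ENNReal.ofReal (Real.exp (1 + C₁) * Real.exp (-j))) k := by
    intro k
    by_cases hk : k ∈ P
    · rw [Set.indicator_of_mem hk]
      refine le_trans ?_ (ENNReal.le_tsum ⌈s k - k⌉₊)
      rw [Set.indicator_of_mem (show k ∈ D _ from ⟨hk, Nat.le_ceil _⟩), ← Real.exp_add]
      apply ENNReal.ofReal_le_ofReal
      apply Real.exp_le_exp.2
      rcases le_total 0 (s k - k) with h0 | h0
      · have := (Nat.ceil_lt_add_one h0).le
        linarith
      · rw [Nat.ceil_eq_zero.2 h0]
        have := hle k hk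
        push_cast
        linarith
    · rw [Set.indicator_of_notMem hk]; exact zero_le
  calc _ ≤ ∑' k, ∑' j : ℕ, (D j).indicator
        (fun _ => ENNReal.ofReal (Real.exp (1 + C₁) * Real.exp (-j))) k := ENNReal.tsum_le_tsum hpt
    _ = ∑' j : ℕ, ∑' k, (D j).indicator
        (fun _ => ENNReal.ofReal (Real.exp (1 + C₁) * Real.exp (-j))) k := ENNReal.tsum_comm
    _ ≤ _ := by
      refine ENNReal.tsum_le_tsum fun j => ?_
      rw [← tsum_subtype (D j), ENNReal.tsum_set_const, mul_comm,
        ENNReal.ofReal_mul (q := _ + 3) (by positivity)]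
      exact mul_le_mul_right (hcard j) _

end AdamsGarsia

/-! ### Splitting a measure at a quantile -/

section Bathtub

variable {X : Type*} [MeasurableSpace X]

/-- The quantile of a function at a given mass. -/
lemma exists_quantile (ν : Measure X) [IsFiniteMeasure ν] {f : X → ℝ≥0∞} (hf : Measurable f)
    (t : ℝ≥0∞) :
    ∃ c, ν {x | c < f x} ≤ t ∧ (c ≠ 0 → t ≤ ν {x | c ≤ f x}) := by
  set S := {c | ν {x | c < f x} ≤ t} with hS
  have hup : ∀ c, sInf S < c → ν {x | c < f x} ≤ t := by
    intro c hc
    obtain ⟨c', hc', hlt⟩ := sInf_lt_iff.1 hc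
    exact (measure_mono fun x hx => lt_trans hlt hx).trans hc'
  refine ⟨sInf S, ?_, ?_⟩
  · rcases eq_or_ne (sInf S) ∞ with htop | htop
    · rw [htop]; simp
    · obtain ⟨u, hu, hlt, hlim⟩ := exists_seq_strictAnti_tendsto' (lt_top_iff_ne_top.2 htop)
      have : {x | sInf S < f x} = ⋃ i, {x | u i < f x} := by
        ext x
        simp only [Set.mem_ofPred_eq, Set.mem_iUnion]
        constructor
        · intro hx
          exact ((hlim.eventually (gt_mem_nhds hx)).exists)
        · rintro ⟨i, hi⟩
          exact (hlt i).1.trans hi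
      have hmono : Monotone fun i => {x | u i < f x} :=
        fun i j hij x hx => lt_of_le_of_lt (hu.antitone hij) hx
      rw [this, hmono.measure_iUnion]
      exact iSup_le fun i => hup _ (hlt i).1
  · intro h0
    obtain ⟨u, hu, hlt, hlim⟩ := exists_seq_strictMono_tendsto' (pos_iff_ne_zero.2 h0)
    have : {x | sInf S ≤ f x} = ⋂ i, {x | u i < f x} := by
      ext x
      simp only [Set.mem_ofPred_eq, Set.mem_iInter]
      exact ⟨fun hx i => (hlt i).2.trans_le hx, fun hx => le_of_tendsto' hlim fun i => (hx i).le⟩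
    have hanti : Antitone fun i => {x | u i < f x} :=
      fun i j hij x hx => lt_of_le_of_lt (hu.monotone hij) hx
    rw [this, hanti.measure_iInter
      (fun i => (measurableSet_lt measurable_const hf).nullMeasurableSet)
      ⟨0, measure_ne_top _ _⟩]
    refine le_iInf fun i => ?_
    by_contra! hcon
    exact absurd (sInf_le (show u i ∈ S from hcon.le)) (not_le.2 (hlt i).2)

/-- Split a finite measure into a part of mass at most `t`, where `f` is largest, and a part on
which `f` is bounded by a constant controlled by the first part. -/
lemma exists_bathtub (ν : Measure X) [IsFiniteMeasure ν] {f : X → ℝ≥0∞} (hf : Measurable f)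
    {p : ℝ} (hp : 0 < p) (t : ℝ≥0∞) :
    ∃ (ν₁ ν₂ : Measure X) (c : ℝ≥0∞), ν₁ + ν₂ = ν ∧ ν₂ Set.univ ≤ t ∧ (∀ᵐ x ∂ν₁, f x ≤ c) ∧
      c ^ p * t ≤ ∫⁻ x, f x ^ p ∂ν₂ := by
  obtain ⟨c, hc1, hc2⟩ := exists_quantile ν hf t
  have hm1 : MeasurableSet {x | c < f x} := measurableSet_lt measurable_const hf
  have hm2 : MeasurableSet {x | f x = c} := hf (measurableSet_singleton c)
  -- The level set {f = c} may have positive measure. Only the fraction a of it goes to ν₂, which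
  -- makes the mass of ν₂ exactly t when c ≠ 0. For c = 0 nothing is needed, as the last inequality
  -- is trivial.
  set a := (t - ν {x | c < f x}) / ν {x | f x = c} with ha
  set b := if c = 0 then 0 else a with hb
  have hab : c ≠ 0 → a ≤ 1 ∧ a * ν {x | f x = c} = t - ν {x | c < f x} := by
    intro h0
    have h1 : {x | c ≤ f x} = {x | c < f x} ∪ {x | f x = c} := by
      ext x
      simp only [Set.mem_ofPred_eq, Set.mem_union]
      rw [le_iff_lt_or_eq, eq_comm (a := c)]
    have h2 : t - ν {x | c < f x} ≤ ν {x | f x = c} := by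
      rw [tsub_le_iff_left]
      exact (hc2 h0).trans (h1 ▸ measure_union_le _ _)
    refine ⟨ENNReal.div_le_of_le_mul (by simpa using h2), ?_⟩
    rcases eq_or_ne (ν {x | f x = c}) 0 with hz | hz
    · rw [hz] at h2 ⊢
      simp only [mul_zero]
      exact (le_antisymm h2 zero_le).symm
    · exact ENNReal.div_mul_cancel hz (measure_ne_top _ _)
  have hb1 : b ≤ 1 := by
    rw [hb]; split_ifs with h
    · simp
    · exact (hab h).1
  set w : X → ℝ≥0∞ := {x | c < f x}.indicator 1 + {x | f x = c}.indicator (fun _ => b) with hw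
  have hwm : Measurable w := (measurable_one.indicator hm1).add (measurable_const.indicator hm2)
  have hw_gt : ∀ x, c < f x → w x = 1 := by
    intro x hx
    simp [hw, hx, hx.ne']
  have hw1 : ∀ x, w x ≤ 1 := by
    intro x
    rcases lt_trichotomy c (f x) with h | h | h
    · exact (hw_gt x h).le
    · simp [hw, ← h, hb1]
    · simp [hw, h.not_gt, h.ne]
  have hint : ∫⁻ x, w x ∂ν = ν {x | c < f x} + b * ν {x | f x = c} := by
    rw [hw]
    simp only [Pi.add_apply]
    rw [lintegral_add_left (measurable_one.indicator hm1), lintegral_indicator_one hm1,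
      lintegral_indicator_const hm2]
  refine ⟨ν.withDensity (1 - w), ν.withDensity w, c, ?_, ?_, ?_, ?_⟩
  · rw [← withDensity_add_right _ hwm]
    have : (1 - w + w : X → ℝ≥0∞) = 1 := by
      ext x; simp [tsub_add_cancel_of_le (hw1 x)]
    rw [this, withDensity_one]
  · rw [withDensity_apply _ MeasurableSet.univ, setLIntegral_univ, hint]
    by_cases h0 : c = 0
    · simpa [hb, h0] using hc1
    · rw [hb, if_neg h0, (hab h0).2, add_tsub_cancel_of_le hc1]
  · rw [ae_withDensity_iff (measurable_one.sub hwm)]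
    refine Eventually.of_forall fun x hx => ?_
    by_contra! hcon
    exact hx (by simp [hw_gt x hcon])
  · by_cases h0 : c = 0
    · simp [h0, hp]
    · have ht' : t = ∫⁻ x, w x ∂ν := by
        rw [hint, hb, if_neg h0, (hab h0).2, add_tsub_cancel_of_le hc1]
      rw [lintegral_withDensity_eq_lintegral_mul _ hwm (hf.pow_const p)]
      nth_rewrite 1 [ht']
      rw [← lintegral_const_mul _ hwm]
      refine lintegral_mono fun x => ?_
      simp only [Pi.mul_apply]
      rcases lt_or_ge (f x) c with h | h
      · simp [hw, h.not_gt, h.ne]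
      · rw [mul_comm]
        gcongr

end Bathtub

/-! ### Abstract Adams kernels: estimates at a single scale -/

/-- The properties of a kernel `K` with respect to a quasi-distance (with `V x y` of the order of
the measure of the ball around `x` through `y`) that give a sharp exponential inequality. -/
structure AdamsKernel {X : Type*} [MeasurableSpace X] (μ : Measure X) (p q A M R : ℝ)
    (K : X → X → ℝ≥0∞) (V : X → X → ℝ) : Prop where
  measurable_kernel : Measurable (Function.uncurry K)
  measurable_quasi : Measurable (Function.uncurry V)
  conj : p.HolderConjugate q
  pos : 0 < A
  nonneg : 0 ≤ M
  univ_le : μ Set.univ ≤ ENNReal.ofReal R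
  far : ∀ t, 0 < t → t ≤ R → ∀ x y, t ≤ V x y → K x y ≤ ENNReal.ofReal (M * t ^ (-(1 / q)))
  near_left : ∀ t, 0 < t → t ≤ R → ∀ x,
    ∫⁻ y in {y | V x y < t}, K x y ∂μ ≤ ENNReal.ofReal (M * t ^ (1 / p))
  near_right : ∀ t, 0 < t → t ≤ R → ∀ y,
    ∫⁻ x in {x | V x y < t}, K x y ∂μ ≤ ENNReal.ofReal (M * t ^ (1 / p))
  shell : ∀ s t, 0 < s → s ≤ t → t ≤ R → ∀ x,
    ∫⁻ y in {y | s ≤ V x y ∧ V x y < t}, K x y ^ q ∂μ ≤ ENNReal.ofReal (A * Real.log (t / s) + M)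

namespace AdamsKernel

variable {X : Type*} [MeasurableSpace X] {μ : Measure X} {p q A M R : ℝ}
  {K : X → X → ℝ≥0∞} {V : X → X → ℝ}

lemma measurable_left (h : AdamsKernel μ p q A M R K V) (x : X) : Measurable (K x) :=
  h.measurable_kernel.comp measurable_prodMk_left

lemma measurable_right (h : AdamsKernel μ p q A M R K V) (y : X) : Measurable fun x => K x y :=
  h.measurable_kernel.comp measurable_prodMk_right

lemma measurable_quasi_left (h : AdamsKernel μ p q A M R K V) (x : X) : Measurable (V x) :=
  h.measurable_quasi.comp measurable_prodMk_left

lemma measurable_quasi_right (h : AdamsKernel μ p q A M R K V) (y : X) :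
    Measurable fun x => V x y :=
  h.measurable_quasi.comp measurable_prodMk_right

/-- Because ν has mass at most t, the region V ≥ t contributes only M^q, by the pointwise bound on
K. The logarithm therefore stops at t instead of running up to R. -/
lemma lintegral_far_le (h : AdamsKernel μ p q A M R K V) {ν : Measure X} (hν : ν ≤ μ) {s t : ℝ}
    (hs : 0 < s) (hst : s ≤ t) (htR : t ≤ R) (hmass : ν Set.univ ≤ ENNReal.ofReal t) (x : X) :
    ∫⁻ y in {y | s ≤ V x y}, K x y ^ q ∂ν
      ≤ ENNReal.ofReal (A * Real.log (t / s) + (M + M ^ q)) := by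
  have hq := h.conj.symm.pos
  have ht := hs.trans_le hst
  have hM := h.nonneg
  have hlog : 0 ≤ Real.log (t / s) := Real.log_nonneg (by rwa [one_le_div hs])
  have hsub : {y | s ≤ V x y} ⊆ {y | s ≤ V x y ∧ V x y < t} ∪ {y | t ≤ V x y} := by
    intro y hy
    rcases lt_or_ge (V x y) t with h | h
    · exact Or.inl ⟨hy, h⟩
    · exact Or.inr h
  refine (lintegral_mono_set hsub).trans ((lintegral_union_le _ _ _).trans ?_)
  rw [← add_assoc, ENNReal.ofReal_add (add_nonneg (mul_nonneg h.pos.le hlog) hM)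
    (by positivity)]
  gcongr
  · refine le_trans (lintegral_mono' (Measure.restrict_mono_measure hν _) le_rfl)
      (h.shell s t hs hst htR x)
  · calc ∫⁻ y in {y | t ≤ V x y}, K x y ^ q ∂ν
        ≤ ∫⁻ y in {y | t ≤ V x y}, ENNReal.ofReal (M * t ^ (-(1 / q))) ^ q ∂ν := by
          refine setLIntegral_mono' (measurableSet_le measurable_const
            (h.measurable_quasi_left x)) fun y hy => ?_
          gcongr
          exact h.far t ht htR x y hy
      _ ≤ ENNReal.ofReal (M * t ^ (-(1 / q))) ^ q * ENNReal.ofReal t := by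
          rw [lintegral_const]
          gcongr
          exact (Measure.restrict_apply_le _ _).trans hmass
      _ = ENNReal.ofReal (M ^ q) := by
          rw [ENNReal.ofReal_rpow_of_nonneg (by positivity) hq.le,
            ← ENNReal.ofReal_mul (by positivity), Real.mul_rpow hM (by positivity),
            ← Real.rpow_mul ht.le, show -(1 / q) * q = -1 by field_simp, Real.rpow_neg_one,
            mul_assoc, inv_mul_cancel₀ ht.ne', mul_one]

/-- The estimate for functions bounded by `c`: the far part by Hölder's inequality, the near part
by the bound. -/
lemma lintegral_bounded_le (h : AdamsKernel μ p q A M R K V) {ν : Measure X} (hν : ν ≤ μ)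
    {s t : ℝ} (hs : 0 < s) (hst : s ≤ t) (htR : t ≤ R) (hmass : ν Set.univ ≤ ENNReal.ofReal t)
    {f : X → ℝ≥0∞} (hf : Measurable f) {c : ℝ≥0∞} (hc : ∀ᵐ y ∂ν, f y ≤ c) (x : X) :
    ∫⁻ y, K x y * f y ∂ν ≤ ENNReal.ofReal (A * Real.log (t / s) + (M + M ^ q)) ^ (1 / q)
      * (∫⁻ y, f y ^ p ∂ν) ^ (1 / p) + c * ENNReal.ofReal (M * s ^ (1 / p)) := by
  have hm : MeasurableSet {y | s ≤ V x y} :=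
    measurableSet_le measurable_const (h.measurable_quasi_left x)
  rw [← lintegral_add_compl _ hm]
  gcongr
  · refine (ENNReal.lintegral_mul_le_Lp_mul_Lq _ h.conj.symm
      (h.measurable_left x).aemeasurable hf.aemeasurable).trans ?_
    have := h.conj.pos
    have := h.conj.symm.pos
    gcongr
    · exact h.lintegral_far_le hν hs hst htR hmass x
    · exact Measure.restrict_le_self
  · have he : {y | s ≤ V x y}ᶜ = {y | V x y < s} := by ext; simp
    rw [he]
    calc ∫⁻ y in {y | V x y < s}, K x y * f y ∂ν ≤ ∫⁻ y in {y | V x y < s}, c * K x y ∂ν := by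
          refine lintegral_mono_ae ((ae_restrict_of_ae hc).mono fun y hy => ?_)
          rw [mul_comm]; gcongr
      _ = c * ∫⁻ y in {y | V x y < s}, K x y ∂ν := lintegral_const_mul _ (h.measurable_left x)
      _ ≤ c * ∫⁻ y in {y | V x y < s}, K x y ∂μ := by
          gcongr
      _ ≤ _ := by
          gcongr
          exact h.near_left s hs (hst.trans htR) x

/-- The integral of the kernel over a set of measure `s`. -/
lemma setLIntegral_le (h : AdamsKernel μ p q A M R K V) {s : ℝ} (hs : 0 < s) (hsR : s ≤ R)
    {E : Set X} (hE : μ E ≤ ENNReal.ofReal s) (y : X) :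
    ∫⁻ x in E, K x y ∂μ ≤ ENNReal.ofReal (2 * M * s ^ (1 / p)) := by
  have hm : MeasurableSet {x | s ≤ V x y} :=
    measurableSet_le measurable_const (h.measurable_quasi_right y)
  have hM := h.nonneg
  have hp := h.conj.pos
  have hq := h.conj.symm.pos
  rw [← lintegral_add_compl _ hm, two_mul, add_mul,
    ENNReal.ofReal_add (by positivity) (by positivity)]
  gcongr
  · calc ∫⁻ x in {x | s ≤ V x y}, K x y ∂(μ.restrict E)
        ≤ ∫⁻ x in {x | s ≤ V x y}, ENNReal.ofReal (M * s ^ (-(1 / q))) ∂(μ.restrict E) :=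
          setLIntegral_mono' hm fun x hx => h.far s hs hsR x y hx
      _ ≤ ENNReal.ofReal (M * s ^ (-(1 / q))) * ENNReal.ofReal s := by
          rw [lintegral_const]
          gcongr
          refine (Measure.restrict_apply_le _ _).trans ?_
          simpa using hE
      _ = ENNReal.ofReal (M * s ^ (1 / p)) := by
          rw [← ENNReal.ofReal_mul (by positivity), mul_assoc]
          congr 2
          have : 1 / p = -(1 / q) + 1 := by
            have := h.conj.inv_add_inv_eq_one
            simp only [one_div]; linarith
          rw [this, Real.rpow_add hs, Real.rpow_one]
  · have he : {x | s ≤ V x y}ᶜ = {x | V x y < s} := by ext; simp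
    rw [he]
    refine le_trans ?_ (h.near_right s hs hsR y)
    exact lintegral_mono' (Measure.restrict_mono_measure Measure.restrict_le_self _) le_rfl

/-- The estimate for small total mass, averaged over a set `E`. -/
lemma setLIntegral_small_le (h : AdamsKernel μ p q A M R K V) {ν : Measure X} [SFinite μ]
    [IsFiniteMeasure ν] {s : ℝ} (hs : 0 < s) (hsR : s ≤ R) (hmass : ν Set.univ ≤ ENNReal.ofReal s)
    {f : X → ℝ≥0∞} (hf : Measurable f) {E : Set X} (hE : μ E ≤ ENNReal.ofReal s) :
    ∫⁻ x in E, ∫⁻ y, K x y * f y ∂ν ∂μ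
      ≤ ENNReal.ofReal s * (ENNReal.ofReal (2 * M) * (∫⁻ y, f y ^ p ∂ν) ^ (1 / p)) := by
  have hM := h.nonneg
  have hp := h.conj.pos
  have hq := h.conj.symm.pos
  rw [lintegral_lintegral_swap ((h.measurable_kernel.mul (hf.comp measurable_snd)).aemeasurable)]
  calc ∫⁻ y, ∫⁻ x in E, K x y * f y ∂μ ∂ν
      ≤ ∫⁻ y, ENNReal.ofReal (2 * M * s ^ (1 / p)) * f y ∂ν := by
        refine lintegral_mono fun y => ?_
        dsimp only
        rw [lintegral_mul_const _ (h.measurable_right y)]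
        gcongr
        exact h.setLIntegral_le hs hsR hE y
    _ = ENNReal.ofReal (2 * M * s ^ (1 / p)) * ∫⁻ y, f y * 1 ∂ν := by
        rw [lintegral_const_mul _ hf]; simp
    _ ≤ ENNReal.ofReal (2 * M * s ^ (1 / p)) *
        ((∫⁻ y, f y ^ p ∂ν) ^ (1 / p) * (∫⁻ _, 1 ^ q ∂ν) ^ (1 / q)) := by
        gcongr
        exact ENNReal.lintegral_mul_le_Lp_mul_Lq ν h.conj hf.aemeasurable aemeasurable_const
    _ ≤ ENNReal.ofReal (2 * M * s ^ (1 / p)) *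
        ((∫⁻ y, f y ^ p ∂ν) ^ (1 / p) * ENNReal.ofReal (s ^ (1 / q))) := by
        gcongr
        rw [← ENNReal.ofReal_rpow_of_pos hs]
        gcongr
        simpa using hmass
    _ = _ := by
        have e : s = s ^ (1 / p) * s ^ (1 / q) := by
          rw [← Real.rpow_add hs]
          have := h.conj.inv_add_inv_eq_one
          rw [one_div, one_div, this, Real.rpow_one]
        conv_rhs => rw [e]
        rw [ENNReal.ofReal_mul (p := 2 * M) (by positivity),
          ENNReal.ofReal_mul (p := s ^ (1 / p)) (by positivity)]
        ring

end AdamsKernel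

/-! ### Averaging over level sets and the abstract exponential inequality -/

namespace AdamsKernel

variable {X : Type*} [MeasurableSpace X] {μ : Measure X} {p q A M R : ℝ}
  {K : X → X → ℝ≥0∞} {V : X → X → ℝ}

/-- Converts the truncation level c of the bathtub splitting into an L^p norm over the part where f
is large: the near contribution of the bounded part is paid for by the other part. -/
lemma mul_le_of_rpow_mul_le (hp : 0 < p) (hM : 0 ≤ M) {s : ℝ} (hs : 0 < s) {c I : ℝ≥0∞}
    (h : c ^ p * ENNReal.ofReal s ≤ I) :
    c * ENNReal.ofReal (M * s ^ (1 / p)) ≤ ENNReal.ofReal M * I ^ (1 / p) := by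
  calc c * ENNReal.ofReal (M * s ^ (1 / p))
      = ENNReal.ofReal M * (c ^ p * ENNReal.ofReal s) ^ (1 / p) := by
        rw [ENNReal.mul_rpow_of_nonneg _ _ (by positivity), ← ENNReal.rpow_mul,
          mul_one_div_cancel hp.ne', ENNReal.rpow_one, ENNReal.ofReal_mul hM,
          ENNReal.ofReal_rpow_of_pos hs]
        ring
    _ ≤ _ := by gcongr

/-- Split ν at mass e. The part where f is bounded is handled pointwise in x; the part of mass at
most e is handled by averaging over E, where Fubini moves the integration onto the kernel. The
constant 3M is M from the truncation level plus 2M from the average. -/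
lemma setLIntegral_le_of_mass (h : AdamsKernel μ p q A M R K V) [IsFiniteMeasure μ]
    {ν : Measure X} (hν : ν ≤ μ) {e t : ℝ} (he : 0 < e) (het : e ≤ t) (htR : t ≤ R)
    (hmass : ν Set.univ ≤ ENNReal.ofReal t) {f : X → ℝ≥0∞} (hf : Measurable f)
    {E : Set X} (hE : μ E = ENNReal.ofReal e) :
    ∫⁻ x in E, ∫⁻ y, K x y * f y ∂ν ∂μ ≤ ENNReal.ofReal e *
      ((ENNReal.ofReal (A * Real.log (t / e) + (M + M ^ q)) ^ (1 / q) + ENNReal.ofReal (3 * M))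
        * (∫⁻ y, f y ^ p ∂ν) ^ (1 / p)) := by
  have hM := h.nonneg
  have hp := h.conj.pos
  have hq := h.conj.symm.pos
  have : IsFiniteMeasure ν := isFiniteMeasure_of_le μ hν
  obtain ⟨ν₁, ν₂, c, hsum, hmass₂, hc, hI⟩ := exists_bathtub ν hf hp (ENNReal.ofReal e)
  have hν₁ : ν₁ ≤ ν := hsum ▸ Measure.le_add_right le_rfl
  have hν₂ : ν₂ ≤ ν := hsum ▸ Measure.le_add_left le_rfl
  have : IsFiniteMeasure ν₂ := isFiniteMeasure_of_le ν hν₂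
  have hmeas : Measurable fun x => ∫⁻ y, K x y * f y ∂ν₂ :=
    (h.measurable_kernel.mul (hf.comp measurable_snd)).lintegral_prod_right'
  set N := (∫⁻ y, f y ^ p ∂ν) ^ (1 / p) with hN
  have hN₁ : (∫⁻ y, f y ^ p ∂ν₁) ^ (1 / p) ≤ N := by rw [hN]; gcongr
  have hN₂ : (∫⁻ y, f y ^ p ∂ν₂) ^ (1 / p) ≤ N := by rw [hN]; gcongr
  calc ∫⁻ x in E, ∫⁻ y, K x y * f y ∂ν ∂μ
      ≤ ∫⁻ x in E, (ENNReal.ofReal (A * Real.log (t / e) + (M + M ^ q)) ^ (1 / q) * N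
          + ENNReal.ofReal M * N) + ∫⁻ y, K x y * f y ∂ν₂ ∂μ := by
        refine lintegral_mono fun x => ?_
        dsimp only
        rw [← hsum, lintegral_add_measure]
        gcongr
        refine (h.lintegral_bounded_le (hν₁.trans hν) he het htR
          ((hν₁ _).trans hmass) hf hc x).trans (add_le_add (by gcongr) ?_)
        exact (mul_le_of_rpow_mul_le hp hM he hI).trans (by gcongr)
    _ ≤ ENNReal.ofReal e * (ENNReal.ofReal (A * Real.log (t / e) + (M + M ^ q)) ^ (1 / q) * N
          + ENNReal.ofReal M * N) + ENNReal.ofReal e * (ENNReal.ofReal (2 * M) * N) := by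
        rw [lintegral_add_right _ hmeas, setLIntegral_const, hE, mul_comm]
        gcongr
        refine (h.setLIntegral_small_le he (het.trans htR) hmass₂ hf hE.le).trans ?_
        gcongr
    _ = _ := by
        rw [show 3 * M = M + 2 * M by ring, ENNReal.ofReal_add hM (by positivity)]
        ring

/-- The averaged estimate at two scales. -/
lemma exists_mass (h : AdamsKernel μ p q A M R K V) [IsFiniteMeasure μ]
    {f : X → ℝ≥0∞} (hf : Measurable f) (hf1 : ∫⁻ y, f y ^ p ∂μ ≤ 1) {t : ℝ} (ht : 0 < t)
    (htR : t ≤ R) : ∃ H : ℝ, 0 ≤ H ∧ H ≤ 1 ∧ ∀ (E : Set X) (e r : ℝ), 0 < e → e ≤ t →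
      μ E = ENNReal.ofReal e → (∀ x ∈ E, ENNReal.ofReal r ≤ ∫⁻ y, K x y * f y ∂μ) →
      r ≤ (A * Real.log (R / t) + (M + M ^ q)) ^ (1 / q) * (1 - H) ^ (1 / p) +
        ((A * Real.log (t / e) + (M + M ^ q)) ^ (1 / q) + 4 * M) * H ^ (1 / p) := by
  have hM := h.nonneg
  have hA := h.pos
  have hp := h.conj.pos
  have hq := h.conj.symm.pos
  -- This first splitting depends only on t, so one H serves all smaller sets E. The remainder ν₂,
  -- of mass at most t, is split again at the mass e of E inside `setLIntegral_le_of_mass`.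
  obtain ⟨ν₁, ν₂, c, hsum, hmass₂, hc, hI⟩ := exists_bathtub μ hf hp (ENNReal.ofReal t)
  have hν₁ : ν₁ ≤ μ := hsum ▸ Measure.le_add_right le_rfl
  have hν₂ : ν₂ ≤ μ := hsum ▸ Measure.le_add_left le_rfl
  have : IsFiniteMeasure ν₂ := isFiniteMeasure_of_le μ hν₂
  have hmeas : Measurable fun x => ∫⁻ y, K x y * f y ∂ν₂ :=
    (h.measurable_kernel.mul (hf.comp measurable_snd)).lintegral_prod_right'
  have hs : ∫⁻ y, f y ^ p ∂ν₁ + ∫⁻ y, f y ^ p ∂ν₂ ≤ 1 := by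
    rwa [← lintegral_add_measure, hsum]
  set H := (∫⁻ y, f y ^ p ∂ν₂).toReal with hH
  have hle2 : ∫⁻ y, f y ^ p ∂ν₂ ≤ 1 := le_add_self.trans hs
  have hH2 : ∫⁻ y, f y ^ p ∂ν₂ = ENNReal.ofReal H :=
    (ENNReal.ofReal_toReal (ne_top_of_le_ne_top ENNReal.one_ne_top hle2)).symm
  have hH1 : H ≤ 1 := ENNReal.toReal_le_of_le_ofReal zero_le_one (by simpa using hle2)
  have hH0 : 0 ≤ H := ENNReal.toReal_nonneg
  have hle1 : ∫⁻ y, f y ^ p ∂ν₁ ≤ ENNReal.ofReal (1 - H) := by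
    rw [ENNReal.ofReal_sub _ hH0, ← hH2, ENNReal.ofReal_one]
    exact ENNReal.le_sub_of_add_le_right (by rw [hH2]; exact ENNReal.ofReal_ne_top) hs
  refine ⟨H, hH0, hH1, fun E e r he het hE hr => ?_⟩
  have hl1 : 0 ≤ Real.log (R / t) := Real.log_nonneg (by rwa [one_le_div ht])
  have hl2 : 0 ≤ Real.log (t / e) := Real.log_nonneg (by rwa [one_le_div he])
  set a := A * Real.log (R / t) + (M + M ^ q) with ha
  set b := A * Real.log (t / e) + (M + M ^ q) with hb
  have ha0 : 0 ≤ a := by positivity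
  have hb0 : 0 ≤ b := by positivity
  have h1H : 0 ≤ 1 - H := by linarith
  have key : ENNReal.ofReal e * ENNReal.ofReal r ≤ ENNReal.ofReal e *
      ENNReal.ofReal (a ^ (1 / q) * (1 - H) ^ (1 / p) + (b ^ (1 / q) + 4 * M) * H ^ (1 / p)) := by
    calc ENNReal.ofReal e * ENNReal.ofReal r = ∫⁻ _ in E, ENNReal.ofReal r ∂μ := by
          rw [setLIntegral_const, hE, mul_comm]
      _ ≤ ∫⁻ x in E, ∫⁻ y, K x y * f y ∂μ ∂μ := by
          refine setLIntegral_mono (h.measurable_kernel.mul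
            (hf.comp measurable_snd)).lintegral_prod_right' hr
      _ ≤ ∫⁻ x in E, (ENNReal.ofReal a ^ (1 / q) * ENNReal.ofReal (1 - H) ^ (1 / p)
          + ENNReal.ofReal M * ENNReal.ofReal H ^ (1 / p)) + ∫⁻ y, K x y * f y ∂ν₂ ∂μ := by
          refine lintegral_mono fun x => ?_
          dsimp only
          conv_lhs => rw [← hsum, lintegral_add_measure]
          gcongr
          refine (h.lintegral_bounded_le hν₁ ht htR le_rfl ((hν₁ _).trans h.univ_le)
            hf hc x).trans (add_le_add (by gcongr) ?_)
          rw [← hH2]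
          exact mul_le_of_rpow_mul_le hp hM ht hI
      _ ≤ ENNReal.ofReal e * (ENNReal.ofReal a ^ (1 / q) * ENNReal.ofReal (1 - H) ^ (1 / p)
          + ENNReal.ofReal M * ENNReal.ofReal H ^ (1 / p)) + ENNReal.ofReal e *
          ((ENNReal.ofReal b ^ (1 / q) + ENNReal.ofReal (3 * M)) * ENNReal.ofReal H ^ (1 / p)) := by
          rw [lintegral_add_right _ hmeas, setLIntegral_const, hE, mul_comm, ← hH2]
          gcongr
          exact h.setLIntegral_le_of_mass hν₂ he het htR hmass₂ hf hE
      _ = _ := by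
          rw [ENNReal.ofReal_rpow_of_nonneg ha0 (by positivity),
            ENNReal.ofReal_rpow_of_nonneg hb0 (by positivity),
            ENNReal.ofReal_rpow_of_nonneg hH0 (by positivity),
            ENNReal.ofReal_rpow_of_nonneg h1H (by positivity),
            ENNReal.ofReal_add (by positivity) (by positivity),
            ENNReal.ofReal_mul (p := a ^ (1 / q)) (by positivity),
            ENNReal.ofReal_mul (q := H ^ (1 / p)) (by positivity), show 4 * M = M + 3 * M by ring, ENNReal.ofReal_add (by positivity)
            (by positivity), ENNReal.ofReal_add hM (by positivity)]
          ring
  have h2 := (ENNReal.mul_le_mul_iff_right (by simpa using he) ENNReal.ofReal_ne_top).1 key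
  exact (ENNReal.ofReal_le_ofReal_iff (by positivity)).1 h2

/-- The sharp exponential inequality of Adams type. -/
theorem exists_lintegral_exp_le (h : AdamsKernel μ p q A M R K V) [IsFiniteMeasure μ] :
    ∃ C : ℝ≥0∞, C ≠ ∞ ∧ ∀ f : X → ℝ≥0∞, Measurable f → ∫⁻ y, f y ^ p ∂μ ≤ 1 →
      ∫⁻ x, ENNReal.ofReal (Real.exp ((∫⁻ y, K x y * f y ∂μ).toReal ^ q / A)) ∂μ ≤ C := by
  have hM := h.nonneg
  have hA := h.pos
  have hp := h.conj.pos
  have hq := h.conj.symm.pos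
  -- Large enough to absorb the error terms of `exists_mass` after division by A^(1/q).
  set B := 1 + (M + M ^ q) / A + 4 * M / A ^ (1 / q) with hBdef
  have hB : 1 ≤ B := by
    have h1 : 0 ≤ (M + M ^ q) / A := by positivity
    have h2 : 0 ≤ 4 * M / A ^ (1 / q) := by positivity
    linarith
  obtain ⟨C, hC, hsum⟩ := AdamsGarsia.tsum_exp_le h.conj hB
  refine ⟨μ Set.univ + ENNReal.ofReal (Real.exp 1) * (ENNReal.ofReal R * C), ?_, ?_⟩
  · exact ENNReal.add_ne_top.2 ⟨measure_ne_top _ _,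
      ENNReal.mul_ne_top ENNReal.ofReal_ne_top (ENNReal.mul_ne_top ENNReal.ofReal_ne_top hC)⟩
  intro f hf hf1
  set u : X → ℝ≥0∞ := fun x => ∫⁻ y, K x y * f y ∂μ with hu
  have hum : Measurable u := (h.measurable_kernel.mul (hf.comp measurable_snd)).lintegral_prod_right'
  let E : ℕ → Set X := fun k => {x | ENNReal.ofReal ((A * k) ^ (1 / q)) < u x}
  have hEm : ∀ k, MeasurableSet (E k) := fun k => measurableSet_lt measurable_const hum
  have hEanti : ∀ k l, k ≤ l → E l ⊆ E k := by
    intro k l hkl x hx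
    refine lt_of_le_of_lt (ENNReal.ofReal_le_ofReal ?_) hx
    gcongr
  let P : Set ℕ := {k | μ (E k) ≠ 0}
  let e : ℕ → ℝ := fun k => (μ (E k)).toReal
  have heE : ∀ k, μ (E k) = ENNReal.ofReal (e k) := fun k =>
    (ENNReal.ofReal_toReal (measure_ne_top _ _)).symm
  have he0 : ∀ k ∈ P, 0 < e k := fun k hk => ENNReal.toReal_pos hk (measure_ne_top _ _)
  have hR : ∀ k ∈ P, 0 < R := by
    intro k hk
    by_contra! hcon
    have h1 := h.univ_le
    rw [ENNReal.ofReal_of_nonpos hcon] at h1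
    exact hk (le_antisymm ((measure_mono (Set.subset_univ _)).trans h1) zero_le)
  have heR : ∀ k ∈ P, e k ≤ R := fun k hk =>
    ENNReal.toReal_le_of_le_ofReal (hR k hk).le ((measure_mono (Set.subset_univ _)).trans h.univ_le)
  let s : ℕ → ℝ := fun k => Real.log (R / e k)
  have hex : ∀ k, ∃ H : ℝ, k ∈ P → 0 ≤ H ∧ H ≤ 1 ∧ ∀ (E : Set X) (e' r : ℝ), 0 < e' → e' ≤ e k →
      μ E = ENNReal.ofReal e' → (∀ x ∈ E, ENNReal.ofReal r ≤ ∫⁻ y, K x y * f y ∂μ) →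
      r ≤ (A * Real.log (R / e k) + (M + M ^ q)) ^ (1 / q) * (1 - H) ^ (1 / p) +
        ((A * Real.log (e k / e') + (M + M ^ q)) ^ (1 / q) + 4 * M) * H ^ (1 / p) := by
    intro k
    by_cases hk : k ∈ P
    · obtain ⟨H, hH⟩ := h.exists_mass hf hf1 (he0 k hk) (heR k hk)
      exact ⟨H, fun _ => hH⟩
    · exact ⟨0, fun hk' => absurd hk' hk⟩
  choose H hH using hex
  have hanti : ∀ k l, k ≤ l → e l ≤ e k := fun k l hkl =>
    ENNReal.toReal_mono (measure_ne_top _ _) (measure_mono (hEanti k l hkl))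
  have hs0 : ∀ k ∈ P, 0 ≤ s k := fun k hk =>
    Real.log_nonneg (by rw [one_le_div (he0 k hk)]; exact heR k hk)
  have hsmono : ∀ k ∈ P, ∀ l ∈ P, k ≤ l → s k ≤ s l := by
    intro k hk l hl hkl
    have := hR k hk
    have := he0 k hk
    have := he0 l hl
    apply Real.log_le_log (by positivity)
    gcongr
    exact hanti k l hkl
  have hbound := hsum P s H hs0 (fun k hk => ⟨(hH k hk).1, (hH k hk).2.1⟩) hsmono ?_
  · have hpt : ∀ x, ENNReal.ofReal (Real.exp ((u x).toReal ^ q / A)) ≤ 1 +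
        ∑' k : ℕ, (E k).indicator (fun _ => ENNReal.ofReal (Real.exp (k + 1))) x := by
      intro x
      set y := (u x).toReal ^ q / A with hy
      have hy0 : 0 ≤ y := by positivity
      rcases hy0.eq_or_lt with h0 | h0
      · rw [← h0]; simp
      · refine le_trans ?_ le_add_self
        -- With k + 1 = ⌈y⌉₊ one has k < y ≤ k + 1, so x lies in E k and e^y ≤ e^(k + 1). Points
        -- with u x = ∞ do not occur here, since `toReal` gives them y = 0.
        have hne : ⌈y⌉₊ ≠ 0 := (Nat.ceil_pos.2 h0).ne'
        obtain ⟨k, hk⟩ := Nat.exists_eq_succ_of_ne_zero hne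
        refine le_trans ?_ (ENNReal.le_tsum k)
        have hky : (k : ℝ) < y := Nat.lt_ceil.1 (by omega)
        have hyk : y ≤ k + 1 := by
          have := Nat.le_ceil y
          rw [hk] at this
          exact_mod_cast this
        have hmem : x ∈ E k := by
          change ENNReal.ofReal ((A * k) ^ (1 / q)) < u x
          have hutop : u x ≠ ∞ := by
            intro htop
            rw [hy, htop] at h0
            simp [hq.ne'] at h0
          rw [ENNReal.ofReal_lt_iff_lt_toReal (by positivity) hutop]
          calc (A * k) ^ (1 / q) < (A * y) ^ (1 / q) := by
                apply Real.rpow_lt_rpow (by positivity) _ (by positivity)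
                gcongr
            _ = (u x).toReal := by
                rw [hy, mul_div_cancel₀ _ hA.ne', ← Real.rpow_mul ENNReal.toReal_nonneg,
                  mul_one_div_cancel hq.ne', Real.rpow_one]
        rw [Set.indicator_of_mem hmem]
        gcongr
    refine (lintegral_mono hpt).trans ?_
    rw [lintegral_add_left measurable_const, lintegral_const, one_mul,
      lintegral_tsum fun k => (measurable_const.indicator (hEm k)).aemeasurable]
    gcongr
    -- By the choice of s, e^(k + 1) μ(E k) = e · R · e^(k - s k) whenever E k has positive measure.
    calc ∑' k : ℕ, ∫⁻ x, (E k).indicator (fun _ => ENNReal.ofReal (Real.exp (k + 1))) x ∂μ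
        = ∑' k : ℕ, ENNReal.ofReal (Real.exp 1) * (ENNReal.ofReal R *
          P.indicator (fun k => ENNReal.ofReal (Real.exp (k - s k))) k) := by
          congr 1
          ext k
          rw [lintegral_indicator_const (hEm k)]
          by_cases hk : k ∈ P
          · have hRk := hR k hk
            have hek := he0 k hk
            rw [Set.indicator_of_mem hk, heE, ← ENNReal.ofReal_mul (by positivity),
              ← ENNReal.ofReal_mul (by positivity), ← ENNReal.ofReal_mul (by positivity),
              Real.exp_add, Real.exp_sub, Real.exp_log (by positivity)]
            congr 1
            field_simp
          · rw [Set.indicator_of_notMem hk]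
            have : μ (E k) = 0 := by simpa [P] using hk
            simp [this]
      _ = ENNReal.ofReal (Real.exp 1) * (ENNReal.ofReal R *
          ∑' k, P.indicator (fun k => ENNReal.ofReal (Real.exp (k - s k))) k) := by
          rw [ENNReal.tsum_mul_left, ENNReal.tsum_mul_left]
      _ ≤ _ := by gcongr
  · intro k hk l hl hkl
    have hRk := hR k hk
    have hek := he0 k hk
    have hel := he0 l hl
    have h1H : 0 ≤ 1 - H k := by linarith [(hH k hk).2.1]
    have hHk := (hH k hk).1
    have h1 := (hH k hk).2.2 (E l) (e l) ((A * l) ^ (1 / q)) hel (hanti k l hkl) (heE l)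
      (fun x hx => le_of_lt hx)
    have hlog : Real.log (e k / e l) = s l - s k := by
      simp only [s]
      rw [← Real.log_div (by positivity) (by positivity)]
      congr 1
      field_simp
    rw [hlog] at h1
    have hd : 0 ≤ s l - s k := by linarith [hsmono k hk l hl hkl]
    have hsk := hs0 k hk
    have hfac : ∀ z, 0 ≤ z → (A * z + (M + M ^ q)) ^ (1 / q) ≤ A ^ (1 / q) * (z + B) ^ (1 / q) := by
      intro z hz
      rw [← Real.mul_rpow hA.le (by linarith)]
      apply Real.rpow_le_rpow (by positivity) _ (by positivity)
      have h4 : (M + M ^ q) / A ≤ B := by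
        have h2 : 0 ≤ 4 * M / A ^ (1 / q) := by positivity
        linarith
      have h5 : M + M ^ q ≤ B * A := (div_le_iff₀ hA).1 h4
      linarith
    have h4M : 4 * M ≤ A ^ (1 / q) * B := by
      have h4 : 4 * M / A ^ (1 / q) ≤ B := by
        have h2 : 0 ≤ (M + M ^ q) / A := by positivity
        linarith
      rw [mul_comm (A ^ (1 / q))]
      exact (div_le_iff₀ (by positivity)).1 h4
    have h2 : A ^ (1 / q) * (l : ℝ) ^ (1 / q) ≤ A ^ (1 / q) *
        ((s k + B) ^ (1 / q) * (1 - H k) ^ (1 / p)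
          + ((s l - s k + B) ^ (1 / q) + B) * H k ^ (1 / p)) := by
      rw [← Real.mul_rpow hA.le (Nat.cast_nonneg l)]
      refine h1.trans ?_
      calc _ ≤ A ^ (1 / q) * (s k + B) ^ (1 / q) * (1 - H k) ^ (1 / p) +
            (A ^ (1 / q) * (s l - s k + B) ^ (1 / q) + A ^ (1 / q) * B) * H k ^ (1 / p) := by
            gcongr
            · exact hfac _ hsk
            · exact hfac _ hd
        _ = _ := by ring
    exact le_of_mul_le_mul_left h2 (by positivity)

end AdamsKernel

/-! ### Polar coordinates and the distribution of the squared norm -/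

namespace CR

section Polar

variable {E : Type*} [NormedAddCommGroup E] [NormedSpace ℝ E] [FiniteDimensional ℝ E]
  [MeasurableSpace E] [BorelSpace E] [Nontrivial E] (μ : Measure E) [μ.IsAddHaarMeasure]

/-- Integration in polar coordinates. -/
lemma lintegral_polar {Φ : E → ℝ≥0∞} (hΦ : Measurable Φ) :
    ∫⁻ x, Φ x ∂μ = ∫⁻ η : Metric.sphere (0 : E) 1, (∫⁻ r in Set.Ioi (0 : ℝ),
      ENNReal.ofReal (r ^ (Module.finrank ℝ E - 1)) * Φ (r • (η : E))) ∂μ.toSphere := by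
  have hm : Measurable fun z : Metric.sphere (0 : E) 1 × Set.Ioi (0 : ℝ) =>
      Φ ((z.2 : ℝ) • (z.1 : E)) := by fun_prop
  calc ∫⁻ x, Φ x ∂μ = ∫⁻ x : ({(0 : E)}ᶜ : Set E), Φ x ∂(μ.comap (↑)) := by
        rw [lintegral_subtype_comap (measurableSet_singleton _).compl, restrict_compl_singleton]
    _ = ∫⁻ z, Φ ((z.2 : ℝ) • (z.1 : E))
        ∂μ.toSphere.prod (.volumeIoiPow (Module.finrank ℝ E - 1)) := by
        rw [← μ.measurePreserving_homeomorphUnitSphereProd.lintegral_comp_emb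
          (Homeomorph.measurableEmbedding _)]
        refine lintegral_congr fun x => ?_
        have hx : ‖(x : E)‖ ≠ 0 := norm_ne_zero_iff.2 x.2
        simp [smul_smul, hx]
    _ = ∫⁻ η, ∫⁻ r, Φ ((r : ℝ) • (η : E)) ∂(.volumeIoiPow (Module.finrank ℝ E - 1))
        ∂μ.toSphere := lintegral_prod _ hm.aemeasurable
    _ = _ := by
        refine lintegral_congr fun η => ?_
        rw [Measure.volumeIoiPow, lintegral_withDensity_eq_lintegral_mul _ (by fun_prop)
          (by fun_prop)]
        simp only [Pi.mul_apply]
        rw [lintegral_subtype_comap measurableSet_Ioi (fun r : ℝ =>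
          ENNReal.ofReal (r ^ (Module.finrank ℝ E - 1)) * Φ (r • (η : E)))]

end Polar

lemma lintegral_Ioo_pow (k : ℕ) :
    ∫⁻ r in Set.Ioo (0 : ℝ) 1, ENNReal.ofReal (r ^ k) = ENNReal.ofReal (1 / (k + 1)) := by
  rw [setLIntegral_congr Ioo_ae_eq_Ioc, ← ofReal_integral_eq_lintegral_ofReal,
    ← intervalIntegral.integral_of_le zero_le_one, integral_pow]
  · simp
  · exact (intervalIntegral.intervalIntegrable_pow k).1
  · filter_upwards [ae_restrict_mem measurableSet_Ioc] with r hr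
    exact pow_nonneg hr.1.le _

/-- Integration over the sphere as integration of a `0`-homogeneous function over the ball. -/
lemma lintegral_toSphere {E : Type*} [NormedAddCommGroup E] [NormedSpace ℝ E]
    [FiniteDimensional ℝ E] [MeasurableSpace E] [BorelSpace E] [Nontrivial E] (μ : Measure E)
    [μ.IsAddHaarMeasure] {H : E → ℝ≥0∞} (hH : Measurable H) :
    ∫⁻ x, (Metric.ball (0 : E) 1).indicator (fun x => H (‖x‖⁻¹ • x)) x ∂μ =
      ENNReal.ofReal (1 / Module.finrank ℝ E) *
        ∫⁻ η : Metric.sphere (0 : E) 1, H η ∂μ.toSphere := by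
  have hpos : 0 < Module.finrank ℝ E := Module.finrank_pos
  rw [lintegral_polar μ (Measurable.indicator (by fun_prop) measurableSet_ball),
    ← lintegral_const_mul _ (by fun_prop)]
  refine lintegral_congr fun η => ?_
  have hη : ‖(η : E)‖ = 1 := norm_eq_of_mem_sphere η
  have : ∀ r ∈ Set.Ioi (0 : ℝ), ENNReal.ofReal (r ^ (Module.finrank ℝ E - 1)) *
      (Metric.ball (0 : E) 1).indicator (fun x => H (‖x‖⁻¹ • x)) (r • (η : E)) =
      (Set.Ioo (0 : ℝ) 1).indicator
        (fun r => ENNReal.ofReal (r ^ (Module.finrank ℝ E - 1)) * H η) r := by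
    intro r hr
    have hr0 : 0 < r := hr
    have hn : ‖r • (η : E)‖ = r := by rw [norm_smul, hη, mul_one, Real.norm_of_nonneg hr0.le]
    by_cases h1 : r < 1
    · rw [Set.indicator_of_mem (by simpa [hn] using h1), Set.indicator_of_mem (show r ∈ Set.Ioo (0 : ℝ) 1 from ⟨hr0, h1⟩), hn,
        smul_smul, inv_mul_cancel₀ hr0.ne', one_smul]
    · rw [Set.indicator_of_notMem (by simpa [hn] using h1),
        Set.indicator_of_notMem (fun h => h1 h.2), mul_zero]
  rw [setLIntegral_congr_fun measurableSet_Ioi this, lintegral_indicator measurableSet_Ioo,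
    Measure.restrict_restrict measurableSet_Ioo, Set.inter_eq_left.2 Set.Ioo_subset_Ioi_self,
    lintegral_mul_const _ (by fun_prop), lintegral_Ioo_pow, Nat.cast_sub hpos]
  simp

/-- The density `s₊ ^ (n - 1)` of the squared norm on `ℂⁿ`. -/
noncomputable def halfPow (n : ℕ) (s : ℝ) : ℝ≥0∞ :=
  (Set.Ioi (0 : ℝ)).indicator (fun s => ENNReal.ofReal (s ^ (n - 1))) s

@[fun_prop]
lemma measurable_halfPow (n : ℕ) : Measurable (halfPow n) :=
  Measurable.indicator (by fun_prop) measurableSet_Ioi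

lemma halfPow_of_pos (n : ℕ) {s : ℝ} (hs : 0 < s) :
    halfPow n s = ENNReal.ofReal (s ^ (n - 1)) := Set.indicator_of_mem (Set.mem_Ioi.2 hs) _

lemma halfPow_of_nonpos (n : ℕ) {s : ℝ} (hs : s ≤ 0) : halfPow n s = 0 :=
  Set.indicator_of_notMem (by simpa using hs) _

lemma halfPow_mul (n : ℕ) {r : ℝ} (hr : 0 < r) (s : ℝ) :
    halfPow n (r * s) = ENNReal.ofReal (r ^ (n - 1)) * halfPow n s := by
  rcases lt_or_ge 0 s with hs | hs
  · rw [halfPow_of_pos n hs, halfPow_of_pos n (mul_pos hr hs), mul_pow,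
      ENNReal.ofReal_mul (by positivity)]
  · rw [halfPow_of_nonpos n hs, halfPow_of_nonpos n (mul_nonpos_of_nonneg_of_nonpos hr.le hs),
      mul_zero]

lemma lintegral_sq_sub (g : ℝ → ℝ≥0∞) :
    ∫⁻ s in Set.Ioi (0 : ℝ), g s = ∫⁻ r in Set.Ioi (0 : ℝ), ENNReal.ofReal (2 * r) * g (r ^ 2) := by
  have himg : (fun r : ℝ => r ^ 2) '' Set.Ioi 0 = Set.Ioi 0 := by
    ext s
    constructor
    · rintro ⟨r, hr, rfl⟩
      exact pow_pos (Set.mem_Ioi.1 hr) 2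
    · intro hs
      exact ⟨√s, Real.sqrt_pos.2 hs, Real.sq_sqrt (le_of_lt hs)⟩
  have hinj : Set.InjOn (fun r : ℝ => r ^ 2) (Set.Ioi 0) := fun a ha b hb hab =>
    (pow_left_inj₀ (le_of_lt ha) (le_of_lt hb) two_ne_zero).1 hab
  have := lintegral_image_eq_lintegral_abs_deriv_mul measurableSet_Ioi
    (f := fun r : ℝ => r ^ 2) (f' := fun r => 2 * r)
    (fun r _ => by simpa using (hasDerivAt_pow 2 r).hasDerivWithinAt) hinj g
  rw [himg] at this
  rw [this]
  refine setLIntegral_congr_fun measurableSet_Ioi fun r hr => ?_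
  rw [abs_of_pos (mul_pos two_pos hr)]

instance (m : ℕ) : Measure.IsAddHaarMeasure
    ((volume : Measure (Fin m → ℂ)).map (WithLp.toLp 2 : _ → EuclideanSpace ℂ (Fin m))) :=
  (PiLp.continuousLinearEquiv 2 ℂ (fun _ : Fin m => ℂ)).symm.isAddHaarMeasure_map _

lemma finrank_ambient (m : ℕ) : Module.finrank ℝ (EuclideanSpace ℂ (Fin m)) = 2 * m := by
  rw [finrank_real_of_complex, finrank_euclideanSpace_fin]

/-- The constant in the formula for the distribution of the squared norm on `ℂⁿ`. -/
def IsNormSqConst (n : ℕ) (c : ℝ) : Prop :=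
  0 < c ∧ ∀ f : ℝ → ℝ≥0∞, Measurable f → ∫⁻ z : Fin n → ℂ, f (∑ j, ‖z j‖ ^ 2) =
    ENNReal.ofReal c * ∫⁻ s, halfPow n s * f s

/-- Polar coordinates and the substitution s = r². The value of c is never needed: it enters the
integrals over the CR sphere and over Σ in the same way and cancels when they are compared. -/
lemma exists_isNormSqConst {n : ℕ} (hn : 1 ≤ n) : ∃ c : ℝ, IsNormSqConst n c := by
  have : NeZero n := ⟨by omega⟩
  set μ : Measure (EuclideanSpace ℂ (Fin n)) := (volume : Measure (Fin n → ℂ)).map (WithLp.toLp 2)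
    with hμ
  have : μ.IsAddHaarMeasure := inferInstanceAs (Measure.IsAddHaarMeasure
    ((volume : Measure (Fin n → ℂ)).map (WithLp.toLp 2 : _ → EuclideanSpace ℂ (Fin n))))
  refine ⟨(μ.toSphere Set.univ).toReal / 2, ?_, fun f hf => ?_⟩
  · have := ENNReal.toReal_pos (Measure.measure_univ_ne_zero.2 (Measure.toSphere_ne_zero μ)) (measure_ne_top _ _)
    positivity
  have h1 : ∫⁻ z : Fin n → ℂ, f (∑ j, ‖z j‖ ^ 2) = ∫⁻ x, f (‖x‖ ^ 2) ∂μ := by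
    rw [hμ, lintegral_map (by fun_prop) (by fun_prop)]
    refine lintegral_congr fun z => ?_
    rw [EuclideanSpace.norm_sq_eq]
  rw [h1, lintegral_polar μ (by fun_prop)]
  have h2 : ∀ η : Metric.sphere (0 : EuclideanSpace ℂ (Fin n)) 1,
      ∫⁻ r in Set.Ioi (0 : ℝ), ENNReal.ofReal
        (r ^ (Module.finrank ℝ (EuclideanSpace ℂ (Fin n)) - 1)) * f (‖r • (η : EuclideanSpace ℂ (Fin n))‖ ^ 2)
      = ENNReal.ofReal (1 / 2) * ∫⁻ s, halfPow n s * f s := by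
    intro η
    have hη : ‖(η : EuclideanSpace ℂ (Fin n))‖ = 1 := norm_eq_of_mem_sphere η
    have h3 : ∫⁻ s, halfPow n s * f s
        = ∫⁻ s in Set.Ioi 0, ENNReal.ofReal (s ^ (n - 1)) * f s := by
      rw [← lintegral_indicator measurableSet_Ioi]
      refine lintegral_congr fun s => ?_
      rw [halfPow, Set.indicator_mul_left]
    rw [h3, lintegral_sq_sub fun s => ENNReal.ofReal (s ^ (n - 1)) * f s, ← lintegral_const_mul _ (by fun_prop)]
    refine setLIntegral_congr_fun measurableSet_Ioi fun r hr => ?_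
    have hr0 : 0 < r := hr
    rw [norm_smul, hη, mul_one, Real.norm_of_nonneg hr0.le, finrank_ambient, ← mul_assoc,
      ← mul_assoc, ← ENNReal.ofReal_mul (by positivity), ← ENNReal.ofReal_mul (by positivity)]
    congr 2
    obtain ⟨k, rfl⟩ : ∃ k, n = k + 1 := ⟨n - 1, by omega⟩
    rw [show 2 * (k + 1) - 1 = 2 * k + 1 by omega, show k + 1 - 1 = k by omega]
    ring
  simp_rw [h2]
  rw [lintegral_const, div_eq_mul_one_div (μ.toSphere Set.univ).toReal, ENNReal.ofReal_mul ENNReal.toReal_nonneg,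
    ENNReal.ofReal_toReal (measure_ne_top _ _)]
  ring

end CR

/-! ### The distribution of ζ · η̄ on the sphere -/

namespace CR

instance (n : ℕ) : (ambientVolume n).IsAddHaarMeasure :=
  inferInstanceAs (Measure.IsAddHaarMeasure ((volume : Measure (Fin (n + 1) → ℂ)).map
    (WithLp.toLp 2 : _ → EuclideanSpace ℂ (Fin (n + 1)))))

/-- Uniqueness of Haar measure leaves a scalar factor, which is 1 because the unit ball is invariant
and has positive finite measure. -/
lemma measurePreserving_unitary (n : ℕ) (L : Ambient n ≃ₗᵢ[ℂ] Ambient n) :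
    MeasurePreserving L (ambientVolume n) (ambientVolume n) := by
  refine ⟨L.continuous.measurable, ?_⟩
  have h1 : ((ambientVolume n).map L).IsAddHaarMeasure :=
    L.toContinuousLinearEquiv.isAddHaarMeasure_map _
  have hc := Measure.isAddLeftInvariant_eq_smul ((ambientVolume n).map L) (ambientVolume n)
  set c := Measure.addHaarScalarFactor ((ambientVolume n).map L) (ambientVolume n)
  have hball : (ambientVolume n).map L (Metric.ball 0 1) = ambientVolume n (Metric.ball 0 1) := by
    rw [Measure.map_apply L.continuous.measurable measurableSet_ball]
    congr 1
    ext x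
    simp
  rw [hc, Measure.smul_apply, ENNReal.smul_def, smul_eq_mul] at hball
  have hc1 : c = 1 := by
    have h0 : ambientVolume n (Metric.ball 0 1) ≠ 0 := (Metric.measure_ball_pos _ _ one_pos).ne'
    have ht : ambientVolume n (Metric.ball 0 1) ≠ ∞ := measure_ball_lt_top.ne
    exact_mod_cast (ENNReal.mul_eq_right h0 ht).1 hball
  rw [hc, hc1, one_smul]

/-- Complete ζ to an orthonormal basis and take coordinates; this reduces `herm ζ` to a single
coordinate function. -/
lemma exists_unitary {n : ℕ} (ζ : Sphere n) :
    ∃ L : Ambient n ≃ₗᵢ[ℂ] Ambient n, ∀ η : Sphere n,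
      herm ζ η = (starRingEnd ℂ) (L (η : Ambient n) 0) := by
  have hcard : Module.finrank ℂ (Ambient n) = Fintype.card (Fin (n + 1)) := by simp
  obtain ⟨b, hb⟩ := Orthonormal.exists_orthonormalBasis_extension_of_card_eq (𝕜 := ℂ) hcard
    (v := fun _ => (ζ : Ambient n)) (s := {0}) (by
      rw [orthonormal_iff_ite]
      intro i j
      have : i = j := Subtype.ext (i.2.trans j.2.symm)
      have hζ : ‖(ζ : Ambient n)‖ = 1 := norm_eq_of_mem_sphere ζ
      simp [this, hζ])
  refine ⟨b.repr, fun η => ?_⟩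
  rw [b.repr_apply_apply, hb 0 rfl, inner_conj_symm]
  simp [herm, PiLp.inner_apply]

/-- The pushforward of the surface measure under `η ↦ ζ · η̄`. -/
lemma lintegral_herm {n : ℕ} {c : ℝ} (hc : IsNormSqConst n c)
    (hn : 1 ≤ n) {h : ℂ → ℝ≥0∞} (hh : Measurable h) (ζ : Sphere n) :
    ∫⁻ η, h (herm ζ η) ∂(surface n) =
      ENNReal.ofReal (2 * c) * ∫⁻ w, halfPow n (1 - ‖w‖ ^ 2) * h w := by
  obtain ⟨L, hL⟩ := exists_unitary ζ
  have hcoord : ∀ j, Measurable fun x : Ambient n => x j := fun j => by fun_prop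
  set H : Ambient n → ℝ≥0∞ := fun x => h ((starRingEnd ℂ) (x 0)) with hH
  have hHm : Measurable H := hh.comp (Complex.continuous_conj.measurable.comp (hcoord 0))
  have h1 : ∫⁻ η, h (herm ζ η) ∂(surface n) =
      ∫⁻ η : Sphere n, (H ∘ L) (η : Ambient n) ∂(ambientVolume n).toSphere :=
    lintegral_congr fun η => by rw [hL]; rfl
  have h2 := lintegral_toSphere (ambientVolume n) (hHm.comp L.continuous.measurable)
  rw [← h1, finrank_ambient] at h2
  have hmI : Measurable ((Metric.ball (0 : Ambient n) 1).indicator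
      (fun x => H (‖x‖⁻¹ • x))) := Measurable.indicator (by fun_prop) measurableSet_ball
  have h3 : ∫⁻ x, (Metric.ball (0 : Ambient n) 1).indicator (fun x => (H ∘ L) (‖x‖⁻¹ • x)) x
      ∂(ambientVolume n) = ∫⁻ x, (Metric.ball (0 : Ambient n) 1).indicator
      (fun x => H (‖x‖⁻¹ • x)) x ∂(ambientVolume n) := by
    rw [← (measurePreserving_unitary n L).lintegral_comp hmI]
    refine lintegral_congr fun x => ?_
    by_cases hx : x ∈ Metric.ball (0 : Ambient n) 1
    · rw [Set.indicator_of_mem hx, Set.indicator_of_mem (by simpa using hx)]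
      have hs : L (‖x‖⁻¹ • x) = ‖x‖⁻¹ • L x := by
        rw [← Complex.coe_smul, ← Complex.coe_smul, map_smul]
      simp [hs]
    · rw [Set.indicator_of_notMem hx, Set.indicator_of_notMem (by simpa using hx)]
  -- The 0-homogeneous extension to the ball, written in terms of the first coordinate x and the
  -- squared norm s of the other coordinates; ‖x‖² + s is the full squared norm.
  set Ψ : ℂ → ℝ → ℝ≥0∞ := fun x s =>
    (Set.Iio (1 : ℝ)).indicator (fun r => h ((√r)⁻¹ • (starRingEnd ℂ) x)) (‖x‖ ^ 2 + s) with hΨ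
  have hΨ' : Measurable fun z : ℂ × ℝ => (Set.Iio (1 : ℝ)).indicator
      (fun r => h ((√r)⁻¹ • (starRingEnd ℂ) z.1)) z.2 := by
    have : (fun z : ℂ × ℝ => (Set.Iio (1 : ℝ)).indicator
      (fun r => h ((√r)⁻¹ • (starRingEnd ℂ) z.1)) z.2) = {z : ℂ × ℝ | z.2 < 1}.indicator
      (fun z => h ((√z.2)⁻¹ • (starRingEnd ℂ) z.1)) := by
      ext z
      by_cases hz : z.2 < 1 <;> simp [Set.indicator, hz]
    rw [this]
    refine Measurable.indicator ?_ (measurableSet_lt measurable_snd measurable_const)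
    exact hh.comp (by fun_prop)
  have hΨm : Measurable (Function.uncurry Ψ) := by
    exact hΨ'.comp (show Measurable fun z : ℂ × ℝ => (z.1, ‖z.1‖ ^ 2 + z.2) by fun_prop)
  have h4 : ∫⁻ x, (Metric.ball (0 : Ambient n) 1).indicator
      (fun x => H (‖x‖⁻¹ • x)) x ∂(ambientVolume n) =
      ∫⁻ x : ℂ, ∫⁻ z : Fin n → ℂ, Ψ x (∑ j, ‖z j‖ ^ 2) := by
    rw [ambientVolume, lintegral_map hmI (by fun_prop),
      ← (volume_preserving_piFinSuccAbove (fun _ : Fin (n + 1) => ℂ) 0).symm.lintegral_comp_emb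
        (MeasurableEquiv.measurableEmbedding _)]
    rw [Measure.volume_eq_prod, lintegral_prod]
    · refine lintegral_congr fun x => lintegral_congr fun z => ?_
      set y : Ambient n := WithLp.toLp 2
        ((MeasurableEquiv.piFinSuccAbove (fun _ : Fin (n + 1) => ℂ) 0).symm (x, z)) with hy
      have hy0 : y 0 = x := by simp [hy, MeasurableEquiv.piFinSuccAbove]
      have hyn : ‖y‖ ^ 2 = ‖x‖ ^ 2 + ∑ j, ‖z j‖ ^ 2 := by
        rw [EuclideanSpace.norm_sq_eq, Fin.sum_univ_succ]
        simp [hy, MeasurableEquiv.piFinSuccAbove]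
      have hyn' : ‖y‖ = √(‖x‖ ^ 2 + ∑ j, ‖z j‖ ^ 2) := by
        rw [← hyn, Real.sqrt_sq (norm_nonneg _)]
      simp only [hΨ]
      by_cases h1 : ‖y‖ < 1
      · rw [Set.indicator_of_mem (by simpa using h1), Set.indicator_of_mem]
        · simp only [hH]
          rw [← hyn', PiLp.smul_apply, hy0, Complex.real_smul, Complex.real_smul, map_mul,
            Complex.conj_ofReal]
        · rw [Set.mem_Iio, ← hyn]
          nlinarith [norm_nonneg y]
      · rw [Set.indicator_of_notMem (by simpa using h1), Set.indicator_of_notMem]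
        rw [Set.mem_Iio, ← hyn]
        nlinarith [norm_nonneg y]
    · refine (hmI.comp ?_).aemeasurable
      fun_prop
  have h5 : ∫⁻ x : ℂ, ∫⁻ z : Fin n → ℂ, Ψ x (∑ j, ‖z j‖ ^ 2) =
      ENNReal.ofReal c * ∫⁻ x : ℂ, ∫⁻ s, halfPow n s * Ψ x s := by
    rw [← lintegral_const_mul _ (Measurable.lintegral_prod_right'
      (f := fun z : ℂ × ℝ => halfPow n z.2 * Ψ z.1 z.2) (by fun_prop))]
    exact lintegral_congr fun x => hc.2 _ (hΨm.comp measurable_prodMk_left)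
  -- Take r = ‖x‖² + s as the variable in place of s.
  have h6 : ∫⁻ x : ℂ, ∫⁻ s, halfPow n s * Ψ x s =
      ∫⁻ r in Set.Ioo (0 : ℝ) 1, ∫⁻ x : ℂ, halfPow n (r - ‖x‖ ^ 2)
        * h ((√r)⁻¹ • (starRingEnd ℂ) x) := by
    have : ∀ x : ℂ, ∫⁻ s, halfPow n s * Ψ x s = ∫⁻ r, halfPow n (r - ‖x‖ ^ 2) *
        (Set.Iio (1 : ℝ)).indicator (fun r => h ((√r)⁻¹ • (starRingEnd ℂ) x)) r := by
      intro x
      rw [← lintegral_add_left_eq_self (fun r => halfPow n (r - ‖x‖ ^ 2) *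
        (Set.Iio (1 : ℝ)).indicator (fun r => h ((√r)⁻¹ • (starRingEnd ℂ) x)) r) (‖x‖ ^ 2)]
      simp [hΨ]
    simp_rw [this]
    rw [lintegral_lintegral_swap, ← lintegral_indicator measurableSet_Ioo]
    · refine lintegral_congr fun r => ?_
      by_cases hr : r ∈ Set.Ioo (0 : ℝ) 1
      · rw [Set.indicator_of_mem hr]
        refine lintegral_congr fun x => ?_
        rw [Set.indicator_of_mem (Set.mem_Iio.2 hr.2)]
      · rw [Set.indicator_of_notMem hr]
        simp only [Set.mem_Ioo, not_and_or, not_lt] at hr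
        rcases hr with hr | hr
        · have : ∀ x : ℂ, halfPow n (r - ‖x‖ ^ 2) = 0 := fun x =>
            halfPow_of_nonpos n (by linarith [sq_nonneg ‖x‖])
          simp [this]
        · simp [Set.indicator, not_lt.2 hr]
    · refine Measurable.aemeasurable ?_
      exact Measurable.mul (by fun_prop) hΨ'
  -- Rescaling x by √r gives r^(n-1) from the density and r from the area element, after which the
  -- r-integral splits off.
  have h7 : ∀ r ∈ Set.Ioo (0 : ℝ) 1, ∫⁻ x : ℂ, halfPow n (r - ‖x‖ ^ 2)
      * h ((√r)⁻¹ • (starRingEnd ℂ) x) =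
      ENNReal.ofReal (r ^ n) * ∫⁻ w, halfPow n (1 - ‖w‖ ^ 2) * h w := by
    intro r hr
    have hr0 := hr.1
    have hsr : 0 < √r := Real.sqrt_pos.2 hr0
    have hmap := Measure.map_addHaar_smul (volume : Measure ℂ) (r := (√r)⁻¹) (by positivity)
    have hconj : MeasurePreserving (starRingEnd ℂ : ℂ → ℂ) := Complex.conjLIE.measurePreserving
    have hm0 : Measurable fun w : ℂ => halfPow n (1 - ‖w‖ ^ 2) * h w := by fun_prop
    have hm1 : Measurable fun w : ℂ => halfPow n (1 - ‖w‖ ^ 2) * h ((starRingEnd ℂ) w) :=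
      Measurable.mul (by fun_prop) (hh.comp Complex.continuous_conj.measurable)
    have e1 : ∫⁻ w, halfPow n (1 - ‖w‖ ^ 2) * h w =
        ∫⁻ w, halfPow n (1 - ‖w‖ ^ 2) * h ((starRingEnd ℂ) w) := by
      rw [← hconj.lintegral_comp hm0]
      simp
    have e2 : ∫⁻ x : ℂ, halfPow n (r - ‖x‖ ^ 2) * h ((√r)⁻¹ • (starRingEnd ℂ) x) =
        ∫⁻ x : ℂ, ENNReal.ofReal (r ^ (n - 1)) * (halfPow n (1 - ‖(√r)⁻¹ • x‖ ^ 2)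
          * h ((starRingEnd ℂ) ((√r)⁻¹ • x))) := by
      refine lintegral_congr fun x => ?_
      rw [← mul_assoc, ← halfPow_mul n hr0]
      congr 2
      · rw [norm_smul, mul_pow, norm_inv, Real.norm_of_nonneg hsr.le, inv_pow,
          Real.sq_sqrt hr0.le]
        field_simp
      · simp
    have e3 : ∫⁻ x : ℂ, halfPow n (1 - ‖(√r)⁻¹ • x‖ ^ 2) * h ((starRingEnd ℂ) ((√r)⁻¹ • x)) =
        ∫⁻ w, halfPow n (1 - ‖w‖ ^ 2) * h ((starRingEnd ℂ) w)
          ∂(volume.map fun x : ℂ => (√r)⁻¹ • x) :=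
      (lintegral_map hm1 (measurable_const_smul _)).symm
    rw [e2, lintegral_const_mul' _ _ ENNReal.ofReal_ne_top, e3, e1, hmap, lintegral_smul_measure,
      smul_eq_mul, ← mul_assoc, ← ENNReal.ofReal_mul (by positivity)]
    congr 2
    rw [Complex.finrank_real_complex, inv_pow, Real.sq_sqrt hr0.le, inv_inv, abs_of_pos hr0,
      ← pow_succ, Nat.sub_add_cancel hn]
  rw [h3, h4, h5, h6, setLIntegral_congr_fun measurableSet_Ioo h7,
    lintegral_mul_const _ (by fun_prop), lintegral_Ioo_pow] at h2
  have hk : (0 : ℝ) < n + 1 := by positivity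
  have h8 := congrArg (fun a => ENNReal.ofReal (2 * (n + 1)) * a) h2
  rw [← mul_assoc (ENNReal.ofReal (2 * (n + 1))) _ (∫⁻ η, h (herm ζ η) ∂(surface n)),
    ← ENNReal.ofReal_mul (by positivity), show 2 * ((n : ℝ) + 1) * (1 / ((2 * (n + 1) : ℕ) : ℝ)) = 1
      by push_cast; field_simp, ENNReal.ofReal_one, one_mul] at h8
  rw [← h8, mul_comm 2 c, show ENNReal.ofReal (c * 2) = ENNReal.ofReal c * ENNReal.ofReal 2 from
    ENNReal.ofReal_mul' two_pos.le, show ENNReal.ofReal 2 = ENNReal.ofReal (2 * (n + 1)) *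
    ENNReal.ofReal (1 / (n + 1)) by rw [← ENNReal.ofReal_mul (by positivity)]; congr 1; field_simp]
  ring

end CR

/-! ### The Cayley transform to the half plane, and the Heisenberg sphere -/

namespace CR

/-- The Cayley transform, an involution exchanging the unit disc and the right half plane. -/
noncomputable def cayley (w : ℂ) : ℂ := (1 - w) / (1 + w)

@[fun_prop]
lemma measurable_cayley : Measurable cayley := by
  unfold cayley; fun_prop

lemma one_add_ne_zero_of_re_pos {v : ℂ} (hv : 0 < v.re) : 1 + v ≠ 0 := by
  intro h
  have := congrArg Complex.re h
  simp at this
  linarith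

lemma cayley_cayley {v : ℂ} (hv : 1 + v ≠ 0) : cayley (cayley v) = v := by
  have h2 : 1 + (1 - v) / (1 + v) ≠ 0 := by
    have : 1 + (1 - v) / (1 + v) = 2 / (1 + v) := by field_simp; ring
    rw [this]; exact div_ne_zero two_ne_zero hv
  unfold cayley
  have h3 : (1 + v) + (1 - v) ≠ 0 := by ring_nf; norm_num
  field_simp
  ring

lemma one_sub_normSq_cayley {v : ℂ} (hv : 1 + v ≠ 0) :
    1 - ‖cayley v‖ ^ 2 = 4 / ‖1 + v‖ ^ 2 * v.re := by
  have h0 : ‖1 + v‖ ≠ 0 := norm_ne_zero_iff.2 hv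
  have h1 : ‖1 + v‖ ^ 2 = (1 + v.re) ^ 2 + v.im ^ 2 := by
    rw [← Complex.normSq_eq_norm_sq, Complex.normSq_apply]; simp; ring
  have h2 : ‖1 - v‖ ^ 2 = (1 - v.re) ^ 2 + v.im ^ 2 := by
    rw [← Complex.normSq_eq_norm_sq, Complex.normSq_apply]; simp; ring
  rw [cayley, norm_div, div_pow]
  field_simp
  rw [h1, h2]
  ring

/-- The real determinant of multiplication by a is the algebra norm of ℂ over ℝ. This gives the
Jacobian of a holomorphic map. -/
lemma det_smul_one (a : ℂ) : (a • (1 : ℂ →L[ℝ] ℂ)).det = ‖a‖ ^ 2 := by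
  have : (a • (1 : ℂ →L[ℝ] ℂ)).toLinearMap = Algebra.lmul ℝ ℂ a := by
    ext; simp
  rw [ContinuousLinearMap.det, this, ← Algebra.norm_apply, Algebra.norm_complex_apply,
    Complex.normSq_eq_norm_sq]

lemma cayley_image : cayley '' {v : ℂ | 0 < v.re} = Metric.ball 0 1 := by
  ext w
  rw [mem_ball_zero_iff]
  constructor
  · rintro ⟨v, hv, rfl⟩
    have hv0 := one_add_ne_zero_of_re_pos hv
    have h := one_sub_normSq_cayley hv0
    have : 0 < 4 / ‖1 + v‖ ^ 2 * v.re := by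
      have := norm_pos_iff.2 hv0
      have hv' : 0 < v.re := hv
      positivity
    nlinarith [norm_nonneg (cayley v)]
  · intro hw
    have hw0 : 1 + w ≠ 0 := by
      intro h
      have : w = -1 := by linear_combination h
      rw [this] at hw
      simp at hw
    refine ⟨cayley w, ?_, cayley_cayley hw0⟩
    have h0 := norm_pos_iff.2 hw0
    have : (cayley w).re = (1 - ‖w‖ ^ 2) / ‖1 + w‖ ^ 2 := by
      rw [cayley, Complex.div_re, ← Complex.normSq_eq_norm_sq, ← Complex.normSq_eq_norm_sq,
        Complex.normSq_apply w, Complex.normSq_apply (1 + w)]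
      simp
      ring
    rw [Set.mem_ofPred_eq, this]
    have : ‖w‖ ^ 2 < 1 := by nlinarith [norm_nonneg w]
    have : 0 < 1 - ‖w‖ ^ 2 := by linarith
    positivity

/-- The change of variables from the disc to the half plane. -/
lemma lintegral_disc_eq {n : ℕ} (hn : 1 ≤ n) (h : ℂ → ℝ≥0∞) :
    ∫⁻ w, halfPow n (1 - ‖w‖ ^ 2) * h w =
      ∫⁻ v : ℂ, halfPow n v.re * ENNReal.ofReal (4 ^ n * (‖1 + v‖ ^ (2 * n + 2))⁻¹)
        * h (cayley v) := by
  have hms : MeasurableSet {v : ℂ | 0 < v.re} :=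
    measurableSet_lt measurable_const Complex.measurable_re
  have hinj : Set.InjOn cayley {v : ℂ | 0 < v.re} := by
    intro a ha b hb hab
    rw [← cayley_cayley (one_add_ne_zero_of_re_pos ha), hab,
      cayley_cayley (one_add_ne_zero_of_re_pos hb)]
  have hder : ∀ v ∈ {v : ℂ | 0 < v.re}, HasFDerivWithinAt cayley
      ((-2 / (1 + v) ^ 2) • (1 : ℂ →L[ℝ] ℂ)) {v : ℂ | 0 < v.re} v := by
    intro v hv
    have hv0 := one_add_ne_zero_of_re_pos hv
    have hd : HasDerivAt cayley (-2 / (1 + v) ^ 2) v := by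
      have := ((hasDerivAt_id v).const_sub 1).div ((hasDerivAt_id v).const_add 1) hv0
      refine this.congr_deriv ?_
      simp only [id]
      ring
    exact hd.complexToReal_fderiv.hasFDerivWithinAt
  have h1 := lintegral_image_eq_lintegral_abs_det_fderiv_mul volume hms hder hinj
    (fun w => halfPow n (1 - ‖w‖ ^ 2) * h w)
  rw [cayley_image, ← lintegral_indicator measurableSet_ball,
    ← lintegral_indicator hms] at h1
  -- `halfPow` vanishes for nonpositive arguments, also when n = 1, so the density itself encodes
  -- the restriction to the disc and to the half plane.
  have hl : ∀ w, (Metric.ball (0 : ℂ) 1).indicator (fun w => halfPow n (1 - ‖w‖ ^ 2) * h w) w =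
      halfPow n (1 - ‖w‖ ^ 2) * h w := by
    intro w
    by_cases hw : ‖w‖ < 1
    · rw [Set.indicator_of_mem (by simpa using hw)]
    · rw [Set.indicator_of_notMem (by simpa using hw), halfPow_of_nonpos n (by nlinarith),
        zero_mul]
  simp_rw [hl] at h1
  rw [h1]
  refine lintegral_congr fun v => ?_
  by_cases hv : 0 < v.re
  · have hv0 := norm_pos_iff.2 (one_add_ne_zero_of_re_pos hv)
    rw [Set.indicator_of_mem (show v ∈ {v : ℂ | 0 < v.re} from hv), one_sub_normSq_cayley (one_add_ne_zero_of_re_pos hv),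
      halfPow_mul n (by positivity), det_smul_one, ← mul_assoc, ← mul_assoc,
      mul_comm (halfPow n v.re), ← ENNReal.ofReal_mul (by positivity)]
    congr 3
    obtain ⟨k, rfl⟩ : ∃ k, n = k + 1 := ⟨n - 1, by omega⟩
    rw [abs_of_nonneg (by positivity), norm_div, norm_pow, norm_neg, Nat.add_sub_cancel, div_pow,
      div_pow, Complex.norm_ofNat]
    field_simp
    ring
  · rw [Set.indicator_of_notMem (show v ∉ {v : ℂ | 0 < v.re} from hv), halfPow_of_nonpos n (not_lt.1 hv)]
    simp

/-- The point of the plane with polar coordinates `ρ, t`. -/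
noncomputable def polarPt (ρ t : ℝ) : ℂ := Complex.polarCoord.symm (ρ, t)

lemma polarPt_re (ρ t : ℝ) : (polarPt ρ t).re = ρ * Real.cos t := by
  simp [polarPt, -Complex.ofReal_cos]

lemma polarPt_im (ρ t : ℝ) : (polarPt ρ t).im = ρ * Real.sin t := by
  simp [polarPt, -Complex.ofReal_sin]

lemma norm_polarPt {ρ : ℝ} (hρ : 0 ≤ ρ) (t : ℝ) : ‖polarPt ρ t‖ = ρ := by
  rw [polarPt, Complex.norm_polarCoord_symm, abs_of_nonneg hρ]

@[fun_prop]
lemma measurable_polarPt : Measurable fun z : ℝ × ℝ => polarPt z.1 z.2 := by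
  have : (fun z : ℝ × ℝ => polarPt z.1 z.2) =
      fun z => (z.1 : ℂ) * (Real.cos z.2 + Real.sin z.2 * Complex.I) := by
    ext z
    simp [polarPt, Complex.polarCoord_symm_apply]
  rw [this]
  fun_prop

lemma lintegral_complex_polar {F : ℂ → ℝ≥0∞} (hF : Measurable F) :
    ∫⁻ v, F v = ∫⁻ ρ in Set.Ioi (0 : ℝ), ∫⁻ t in Set.Ioo (-Real.pi) Real.pi,
      ENNReal.ofReal ρ * F (polarPt ρ t) := by
  rw [← Complex.lintegral_comp_polarCoord_symm, polarCoord_target, Measure.volume_eq_prod,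
    ← Measure.prod_restrict, lintegral_prod]
  · rfl
  · have : Measurable fun z : ℝ × ℝ => ENNReal.ofReal z.1 * F (polarPt z.1 z.2) := by fun_prop
    exact this.aemeasurable

/-- The integral over the Heisenberg sphere of a function of the angle, up to normalization. -/
noncomputable def angular (n : ℕ) (a : ℝ → ℝ≥0∞) : ℝ≥0∞ :=
  ∫⁻ t in Set.Ioo (-Real.pi) Real.pi, halfPow n (Real.cos t) * a (Real.sin t)

lemma dist_nonneg {n : ℕ} (ζ η : Sphere n) : 0 ≤ dist ζ η := Real.sqrt_nonneg _

lemma one_sub_cayley {v : ℂ} (hv : 1 + v ≠ 0) : 1 - cayley v = 2 * v / (1 + v) := by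
  unfold cayley; field_simp; ring

lemma sqrt_rpow_homDim (n : ℕ) {x : ℝ} (hx : 0 ≤ x) :
    (√x) ^ (-(homDim n)) = (x ^ (n + 1))⁻¹ := by
  rw [Real.sqrt_eq_rpow, ← Real.rpow_mul hx, ← Real.rpow_natCast, ← Real.rpow_neg hx, homDim]
  congr 1
  push_cast; ring

variable {n : ℕ} {c : ℝ}

/-- The pushforward of `d(ζ, η)^{-Q} dη` to the half plane, in polar coordinates. -/
lemma lintegral_dist_rpow (hc : IsNormSqConst n c) (hn : 1 ≤ n) {k : ℂ → ℝ≥0∞} (hk : Measurable k)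
    (ζ : Sphere n) :
    ∫⁻ η, k (cayley (herm ζ η)) * ENNReal.ofReal (dist ζ η ^ (-(homDim n))) ∂(surface n) =
      ENNReal.ofReal (c / 2) * ∫⁻ ρ in Set.Ioi (0 : ℝ), ∫⁻ t in Set.Ioo (-Real.pi) Real.pi,
        halfPow n (Real.cos t) * ENNReal.ofReal (ρ⁻¹ * (‖1 + polarPt ρ t‖ ^ (n + 1))⁻¹)
          * k (polarPt ρ t) := by
  have hc0 := hc.1
  have h1 := lintegral_herm hc hn (h := fun w => k (cayley w) *
    ENNReal.ofReal ((√(2 * ‖1 - w‖)) ^ (-(homDim n)))) (by fun_prop) ζ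
  have h0 : ∫⁻ η, k (cayley (herm ζ η)) * ENNReal.ofReal (dist ζ η ^ (-(homDim n))) ∂(surface n)
    = ∫⁻ η, k (cayley (herm ζ η)) *
      ENNReal.ofReal ((√(2 * ‖1 - herm ζ η‖)) ^ (-(homDim n))) ∂(surface n) := rfl
  rw [h0, h1, lintegral_disc_eq hn, lintegral_complex_polar (by fun_prop)]
  have hc4 : ENNReal.ofReal (2 * c) = ENNReal.ofReal (c / 2) * ENNReal.ofReal 4 := by
    rw [← ENNReal.ofReal_mul (by positivity)]; congr 1; ring
  rw [hc4, mul_assoc, ← lintegral_const_mul' _ _ ENNReal.ofReal_ne_top]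
  congr 1
  refine setLIntegral_congr_fun measurableSet_Ioi fun ρ hρ => ?_
  have hρ0 : 0 < ρ := hρ
  rw [← lintegral_const_mul' _ _ ENNReal.ofReal_ne_top]
  refine lintegral_congr fun t => ?_
  rw [polarPt_re, halfPow_mul n hρ0]
  rcases lt_or_ge 0 (Real.cos t) with ht | ht
  · have hre : 0 < (polarPt ρ t).re := by rw [polarPt_re]; positivity
    have hne := one_add_ne_zero_of_re_pos hre
    have hn0 := norm_pos_iff.2 hne
    rw [cayley_cayley hne, sqrt_rpow_homDim n (by positivity), one_sub_cayley hne, norm_div,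
      norm_mul, norm_polarPt hρ0.le, Complex.norm_ofNat]
    -- The factors ρ and ρ^(n-1) come from the polar area element and the density; together with
    -- d^(-Q) = (4ρ/|1 + v|)^(-(n+1)) they leave exactly ρ⁻¹, the scale-invariant measure.
    have e : ENNReal.ofReal (ρ⁻¹ * (‖1 + polarPt ρ t‖ ^ (n + 1))⁻¹) =
        ENNReal.ofReal 4 * (ENNReal.ofReal ρ * (ENNReal.ofReal (ρ ^ (n - 1)) *
        (ENNReal.ofReal (4 ^ n * (‖1 + polarPt ρ t‖ ^ (2 * n + 2))⁻¹) *
        ENNReal.ofReal ((2 * (2 * ρ / ‖1 + polarPt ρ t‖)) ^ (n + 1))⁻¹))) := by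
      rw [← ENNReal.ofReal_mul (by positivity), ← ENNReal.ofReal_mul (by positivity),
        ← ENNReal.ofReal_mul (by positivity), ← ENNReal.ofReal_mul (by positivity)]
      congr 1
      obtain ⟨k, rfl⟩ : ∃ k, n = k + 1 := ⟨n - 1, by omega⟩
      rw [Nat.add_sub_cancel, show 2 * (2 * ρ / ‖1 + polarPt ρ t‖) = 4 * ρ / ‖1 + polarPt ρ t‖ by
        ring, div_pow, mul_pow]
      field_simp
      ring
    rw [e]
    ring
  · rw [halfPow_of_nonpos n ht]
    simp

/-- The integral over the Heisenberg sphere of a function of `t*`. -/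
lemma lintegral_heisSphere (hc : IsNormSqConst n c) (hn : 1 ≤ n) {a : ℝ → ℝ≥0∞} (ha : Measurable a) :
    ∫⁻ u, a u.2 ∂(heisSphereMeasure n) = ENNReal.ofReal (2 * c) * angular n a := by
  have hc0 := hc.1
  have hheis : Measurable (heisNorm : Heis n → ℝ) := by unfold heisNorm; fun_prop
  have hproj : Measurable (heisProj : Heis n → Heis n) := by
    unfold heisProj
    refine Measurable.prodMk (measurable_pi_lambda _ fun j => ?_) (by fun_prop)
    exact (by fun_prop : Measurable fun u : Heis n => u.1 j).div
      (Complex.measurable_ofReal.comp hheis)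
  have hset : MeasurableSet {u : Heis n | 0 < heisNorm u ∧ heisNorm u < 1} :=
    (measurableSet_lt measurable_const hheis).inter (measurableSet_lt hheis measurable_const)
  set F : ℝ × ℝ → ℝ≥0∞ := {z : ℝ × ℝ | 0 < z.1 ^ 2 + z.2 ^ 2 ∧ z.1 ^ 2 + z.2 ^ 2 < 1}.indicator
    (fun z => a (z.2 / √(z.1 ^ 2 + z.2 ^ 2))) with hF
  have hFset : MeasurableSet {z : ℝ × ℝ | 0 < z.1 ^ 2 + z.2 ^ 2 ∧ z.1 ^ 2 + z.2 ^ 2 < 1} :=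
    have hm : Measurable fun z : ℝ × ℝ => z.1 ^ 2 + z.2 ^ 2 := by fun_prop
    (measurableSet_lt measurable_const hm).inter (measurableSet_lt hm measurable_const)
  have hFm : Measurable F := Measurable.indicator (by fun_prop) hFset
  have h1 : ∫⁻ u, a u.2 ∂(heisSphereMeasure n) =
      ENNReal.ofReal (homDim n) * ∫⁻ u : Heis n, F (∑ j, ‖u.1 j‖ ^ 2, u.2) := by
    rw [heisSphereMeasure, lintegral_smul_measure, lintegral_map (by fun_prop) hproj,
      ← lintegral_indicator hset, smul_eq_mul]
    congr 1
    refine lintegral_congr fun u => ?_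
    set s := (∑ j, ‖u.1 j‖ ^ 2) ^ 2 + u.2 ^ 2 with hs
    have hs0 : 0 ≤ s := by positivity
    have hN : heisNorm u = s ^ (1 / 4 : ℝ) := rfl
    have hpos : 0 < heisNorm u ↔ 0 < s := by
      rw [hN]
      refine ⟨fun h => ?_, fun h => by positivity⟩
      rcases hs0.eq_or_lt with h0 | h0
      · rw [← h0, Real.zero_rpow (by norm_num)] at h
        exact absurd h (lt_irrefl _)
      · exact h0
    have hlt : heisNorm u < 1 ↔ s < 1 := by
      rw [hN]
      simpa using Real.rpow_lt_rpow_iff hs0 zero_le_one (by norm_num : (0 : ℝ) < 1 / 4)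
    have hsq : heisNorm u ^ 2 = √s := by
      rw [hN, Real.sqrt_eq_rpow, ← Real.rpow_natCast, ← Real.rpow_mul hs0]
      norm_num
    have hmem : u ∈ {u : Heis n | 0 < heisNorm u ∧ heisNorm u < 1} ↔
        ((∑ j, ‖u.1 j‖ ^ 2, u.2) : ℝ × ℝ) ∈
          {z : ℝ × ℝ | 0 < z.1 ^ 2 + z.2 ^ 2 ∧ z.1 ^ 2 + z.2 ^ 2 < 1} := and_congr hpos hlt
    by_cases hu : ((∑ j, ‖u.1 j‖ ^ 2, u.2) : ℝ × ℝ) ∈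
          {z : ℝ × ℝ | 0 < z.1 ^ 2 + z.2 ^ 2 ∧ z.1 ^ 2 + z.2 ^ 2 < 1}
    · rw [hF, Set.indicator_of_mem (hmem.2 hu), Set.indicator_of_mem hu]
      change a (u.2 / heisNorm u ^ 2) = _
      rw [hsq]
    · rw [hF, Set.indicator_of_notMem (mt hmem.1 hu), Set.indicator_of_notMem hu]
  have h2 : ∫⁻ u : Heis n, F (∑ j, ‖u.1 j‖ ^ 2, u.2) =
      ENNReal.ofReal c * ∫⁻ v : ℂ, halfPow n v.re * F (v.re, v.im) := by
    rw [Measure.volume_eq_prod, lintegral_prod_symm _ (by fun_prop)]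
    have h3 : ∀ y : ℝ, ∫⁻ x : Fin n → ℂ, F (∑ j, ‖x j‖ ^ 2, y) =
        ENNReal.ofReal c * ∫⁻ s, halfPow n s * F (s, y) := fun y =>
      hc.2 (fun s => F (s, y)) (by fun_prop)
    simp_rw [h3]
    rw [lintegral_const_mul' _ _ ENNReal.ofReal_ne_top]
    congr 1
    have := Complex.volume_preserving_equiv_real_prod.lintegral_comp
      (f := fun z : ℝ × ℝ => halfPow n z.1 * F z) (by fun_prop)
    simp only [Complex.measurableEquivRealProd_apply] at this
    rw [this, Measure.volume_eq_prod, lintegral_prod_symm _ (by fun_prop)]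
  have h3 : ∫⁻ v : ℂ, halfPow n v.re * F (v.re, v.im) =
      ENNReal.ofReal (1 / (n + 1)) * angular n a := by
    rw [lintegral_complex_polar (by fun_prop)]
    have h4 : ∀ ρ ∈ Set.Ioi (0 : ℝ), ∫⁻ t in Set.Ioo (-Real.pi) Real.pi, ENNReal.ofReal ρ *
        (halfPow n (polarPt ρ t).re * F ((polarPt ρ t).re, (polarPt ρ t).im)) =
        (Set.Ioo (0 : ℝ) 1).indicator (fun ρ => ENNReal.ofReal (ρ ^ n) * angular n a) ρ := by
      intro ρ hρ
      have hρ0 : 0 < ρ := hρ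
      have hsq : ∀ t, (ρ * Real.cos t) ^ 2 + (ρ * Real.sin t) ^ 2 = ρ ^ 2 := by
        intro t
        rw [mul_pow, mul_pow, ← mul_add, Real.cos_sq_add_sin_sq, mul_one]
      by_cases h1 : ρ < 1
      · rw [Set.indicator_of_mem (show ρ ∈ Set.Ioo (0 : ℝ) 1 from ⟨hρ0, h1⟩), angular,
          ← lintegral_const_mul' _ _ ENNReal.ofReal_ne_top]
        refine lintegral_congr fun t => ?_
        rw [hF, Set.indicator_of_mem, polarPt_re, polarPt_im, halfPow_mul n hρ0]
        · simp only
          rw [hsq, Real.sqrt_sq hρ0.le, mul_div_cancel_left₀ _ hρ0.ne', ← mul_assoc, ← mul_assoc,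
            ← ENNReal.ofReal_mul hρ0.le, ← pow_succ', Nat.sub_add_cancel hn, mul_assoc]
        · simp only [Set.mem_ofPred_eq, polarPt_re, polarPt_im, hsq]
          exact ⟨by positivity, by nlinarith⟩
      · rw [Set.indicator_of_notMem (fun h => h1 h.2)]
        have : ∀ t, F ((polarPt ρ t).re, (polarPt ρ t).im) = 0 := by
          intro t
          rw [hF, Set.indicator_of_notMem]
          simp only [Set.mem_ofPred_eq, polarPt_re, polarPt_im, hsq]
          rintro ⟨-, h⟩
          nlinarith
        simp [this]
    rw [setLIntegral_congr_fun measurableSet_Ioi h4, lintegral_indicator measurableSet_Ioo,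
      Measure.restrict_restrict measurableSet_Ioo, Set.inter_eq_left.2 Set.Ioo_subset_Ioi_self,
      lintegral_mul_const _ (by fun_prop), lintegral_Ioo_pow]
  -- The constants combine to Q · c/(n + 1) = 2c.
  rw [h1, h2, h3, ← mul_assoc, ← mul_assoc, ← ENNReal.ofReal_mul (by unfold homDim; positivity),
    ← ENNReal.ofReal_mul (by unfold homDim; positivity)]
  congr 2
  rw [homDim]
  field_simp

end CR

/-! ### Separation of radius and angle -/

namespace CR

variable {n : ℕ}

/-- The quasi-distance `|(1 - w) / (1 + w)|`, `w = ζ · η̄`, of the order of `d(ζ, η) ^ 2`. -/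
noncomputable def quasi (ζ η : Sphere n) : ℝ := ‖cayley (herm ζ η)‖

/-- The sine of the angle `θ(ζ · η̄)`. -/
noncomputable def sinAngle (ζ η : Sphere n) : ℝ :=
  (cayley (herm ζ η)).im / ‖cayley (herm ζ η)‖

lemma isFiniteMeasure_heisSphere (hn : 1 ≤ n) : IsFiniteMeasure (heisSphereMeasure n) := by
  obtain ⟨c, hc⟩ := exists_isNormSqConst hn
  refine ⟨?_⟩
  have h := lintegral_heisSphere hc hn (a := fun _ => 1) measurable_const
  rw [lintegral_one] at h
  rw [h]
  refine ENNReal.mul_lt_top ENNReal.ofReal_lt_top ?_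
  refine lt_of_le_of_lt (lintegral_mono (g := fun _ => 1) fun t => ?_) (by simp)
  rw [mul_one]
  rcases lt_or_ge 0 (Real.cos t) with ht | ht
  · rw [halfPow_of_pos n ht]
    exact ENNReal.ofReal_le_one.2 (pow_le_one₀ ht.le (Real.cos_le_one t))
  · rw [halfPow_of_nonpos n ht]; exact zero_le

/-- In `lintegral_dist_rpow` only the factor |1 + v|^(-(n+1)) couples radius and angle, and 1 ≤ |1 +
v| ≤ 1 + ρ on the half plane. The upper bound serves the inequality, the lower bound its sharpness.
Using |v| as the radial variable in place of d is what makes the separation possible. -/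
lemma lintegral_dist_separated (hn : 1 ≤ n) {a b : ℝ → ℝ≥0∞} (ha : Measurable a)
    (hb : Measurable b) (ζ : Sphere n) :
    (∫⁻ η, a (sinAngle ζ η) * b (quasi ζ η) * ENNReal.ofReal (dist ζ η ^ (-(homDim n)))
        ∂(surface n) ≤ ENNReal.ofReal (1 / 4) * (∫⁻ u, a u.2 ∂(heisSphereMeasure n)) *
          ∫⁻ ρ in Set.Ioi (0 : ℝ), ENNReal.ofReal ρ⁻¹ * b ρ) ∧
    (ENNReal.ofReal (1 / 4) * (∫⁻ u, a u.2 ∂(heisSphereMeasure n)) *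
          (∫⁻ ρ in Set.Ioi (0 : ℝ), ENNReal.ofReal (ρ⁻¹ * ((1 + ρ) ^ (n + 1))⁻¹) * b ρ) ≤
      ∫⁻ η, a (sinAngle ζ η) * b (quasi ζ η) * ENNReal.ofReal (dist ζ η ^ (-(homDim n)))
        ∂(surface n)) := by
  obtain ⟨c, hc⟩ := exists_isNormSqConst hn
  have hc0 := hc.1
  have hk : Measurable fun v : ℂ => a (v.im / ‖v‖) * b ‖v‖ := by fun_prop
  have h1 := lintegral_dist_rpow hc hn hk ζ
  have hcos : Measurable fun t : ℝ => halfPow n (Real.cos t) * a (Real.sin t) := by fun_prop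
  have hsep : ∀ w : ℝ → ℝ≥0∞, Measurable w → ENNReal.ofReal (1 / 4) * (∫⁻ u, a u.2 ∂(heisSphereMeasure n)) *
      (∫⁻ ρ in Set.Ioi (0 : ℝ), w ρ * b ρ) = ENNReal.ofReal (c / 2) *
      ∫⁻ ρ in Set.Ioi (0 : ℝ), ∫⁻ t in Set.Ioo (-Real.pi) Real.pi,
        (w ρ * b ρ) * (halfPow n (Real.cos t) * a (Real.sin t)) := by
    intro w hw
    rw [lintegral_heisSphere hc hn ha, ← mul_assoc, ← ENNReal.ofReal_mul (by positivity),
      show 1 / 4 * (2 * c) = c / 2 by ring, mul_assoc]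
    congr 1
    simp_rw [lintegral_const_mul _ hcos]
    have hwb : Measurable fun ρ => w ρ * b ρ := hw.mul hb
    rw [mul_comm, lintegral_mul_const _ hwb]
    rfl
  have hval : ∀ ρ, 0 < ρ → ∀ t, a ((polarPt ρ t).im / ‖polarPt ρ t‖) * b ‖polarPt ρ t‖ =
      a (Real.sin t) * b ρ := by
    intro ρ hρ t
    rw [norm_polarPt hρ.le, polarPt_im, mul_div_cancel_left₀ _ hρ.ne']
  constructor
  · refine (le_of_eq h1).trans ?_
    rw [hsep _ (by fun_prop)]
    gcongr ENNReal.ofReal (c / 2) * ?_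
    refine setLIntegral_mono' measurableSet_Ioi fun ρ hρ => lintegral_mono fun t => ?_
    have hρ0 : 0 < ρ := hρ
    dsimp only
    rw [hval ρ hρ0]
    rcases lt_or_ge 0 (Real.cos t) with ht | ht
    · have hle : ENNReal.ofReal (ρ⁻¹ * (‖1 + polarPt ρ t‖ ^ (n + 1))⁻¹) ≤ ENNReal.ofReal ρ⁻¹ := by
        apply ENNReal.ofReal_le_ofReal
        refine mul_le_of_le_one_right (by positivity) (inv_le_one_of_one_le₀ (one_le_pow₀ ?_))
        refine le_trans ?_ (Complex.re_le_norm _)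
        rw [Complex.add_re, polarPt_re, Complex.one_re]
        nlinarith
      calc _ ≤ halfPow n (Real.cos t) * ENNReal.ofReal ρ⁻¹ * (a (Real.sin t) * b ρ) := by gcongr
        _ = _ := by ring
    · rw [halfPow_of_nonpos n ht]; simp
  · refine le_trans ?_ (le_of_eq h1.symm)
    rw [hsep _ (by fun_prop)]
    gcongr ENNReal.ofReal (c / 2) * ?_
    refine setLIntegral_mono' measurableSet_Ioi fun ρ hρ => lintegral_mono fun t => ?_
    have hρ0 : 0 < ρ := hρ
    dsimp only
    rw [hval ρ hρ0]
    rcases lt_or_ge 0 (Real.cos t) with ht | ht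
    · have hpos : 0 < ‖1 + polarPt ρ t‖ := norm_pos_iff.2
        (one_add_ne_zero_of_re_pos (by rw [polarPt_re]; positivity))
      have hle : ENNReal.ofReal (ρ⁻¹ * ((1 + ρ) ^ (n + 1))⁻¹) ≤
          ENNReal.ofReal (ρ⁻¹ * (‖1 + polarPt ρ t‖ ^ (n + 1))⁻¹) := by
        have : ‖1 + polarPt ρ t‖ ≤ 1 + ρ := by
          refine (norm_add_le _ _).trans ?_
          rw [norm_one, norm_polarPt hρ0.le]
        gcongr
      calc _ = halfPow n (Real.cos t) * ENNReal.ofReal (ρ⁻¹ * ((1 + ρ) ^ (n + 1))⁻¹) *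
            (a (Real.sin t) * b ρ) := by ring
        _ ≤ _ := by gcongr
    · rw [halfPow_of_nonpos n ht]; simp

section Radial

lemma lintegral_inv_Ico {s t : ℝ} (hs : 0 < s) (hst : s ≤ t) :
    ∫⁻ ρ in Set.Ioi (0 : ℝ), ENNReal.ofReal ρ⁻¹ * (Set.Ico s t).indicator 1 ρ =
      ENNReal.ofReal (Real.log (t / s)) := by
  have h : ∀ ρ, ENNReal.ofReal ρ⁻¹ * (Set.Ico s t).indicator 1 ρ =
      (Set.Ico s t).indicator (fun ρ => ENNReal.ofReal ρ⁻¹) ρ := by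
    intro ρ
    by_cases hρ : ρ ∈ Set.Ico s t <;> simp [hρ]
  have hsub : Set.Ico s t ⊆ Set.Ioi 0 := fun x hx => lt_of_lt_of_le hs hx.1
  have hint : IntervalIntegrable (fun ρ : ℝ => ρ⁻¹) volume s t :=
    intervalIntegral.intervalIntegrable_inv
      (fun x hx => (hs.trans_le (by rw [Set.uIcc_of_le hst] at hx; exact hx.1)).ne')
      continuousOn_id
  simp_rw [h]
  rw [lintegral_indicator measurableSet_Ico, Measure.restrict_restrict measurableSet_Ico,
    Set.inter_eq_left.2 hsub, setLIntegral_congr Ico_ae_eq_Ioc,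
    ← ofReal_integral_eq_lintegral_ofReal hint.1, ← intervalIntegral.integral_of_le hst,
    integral_inv_of_pos hs (hs.trans_le hst)]
  filter_upwards [ae_restrict_mem measurableSet_Ioc] with ρ hρ
  exact inv_nonneg.2 (hs.trans hρ.1).le

lemma lintegral_rpow_Iio {t α : ℝ} (ht : 0 < t) (hα : 0 < α) :
    ∫⁻ ρ in Set.Ioi (0 : ℝ), ENNReal.ofReal ρ⁻¹ *
      (Set.Iio t).indicator (fun ρ => ENNReal.ofReal (ρ ^ α)) ρ = ENNReal.ofReal (t ^ α / α) := by
  have h : ∀ ρ ∈ Set.Ioi (0 : ℝ), ENNReal.ofReal ρ⁻¹ *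
      (Set.Iio t).indicator (fun ρ => ENNReal.ofReal (ρ ^ α)) ρ =
      (Set.Ioo 0 t).indicator (fun ρ => ENNReal.ofReal (ρ ^ (α - 1))) ρ := by
    intro ρ hρ
    have hρ0 : 0 < ρ := hρ
    by_cases h1 : ρ < t
    · rw [Set.indicator_of_mem (Set.mem_Iio.2 h1),
        Set.indicator_of_mem (show ρ ∈ Set.Ioo 0 t from ⟨hρ0, h1⟩),
        ← ENNReal.ofReal_mul (by positivity), Real.rpow_sub_one hρ0.ne', div_eq_inv_mul]
    · rw [Set.indicator_of_notMem (by simpa using h1),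
        Set.indicator_of_notMem (fun h => h1 h.2), mul_zero]
  have hint : IntervalIntegrable (fun ρ : ℝ => ρ ^ (α - 1)) volume 0 t :=
    intervalIntegral.intervalIntegrable_rpow' (by linarith)
  rw [setLIntegral_congr_fun measurableSet_Ioi h, lintegral_indicator measurableSet_Ioo,
    Measure.restrict_restrict measurableSet_Ioo, Set.inter_eq_left.2 Set.Ioo_subset_Ioi_self,
    setLIntegral_congr Ioo_ae_eq_Ioc, ← ofReal_integral_eq_lintegral_ofReal hint.1,
    ← intervalIntegral.integral_of_le ht.le, integral_rpow (Or.inl (by linarith))]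
  · simp [Real.zero_rpow hα.ne']
  · filter_upwards [ae_restrict_mem measurableSet_Ioc] with ρ hρ
    exact Real.rpow_nonneg hρ.1.le _

/-- Bernoulli's inequality gives (1 + ρ)^(-(n+1)) ≥ 1 - (n + 1)ρ, so the weight costs at most n + 1
on the unit interval and the logarithm keeps coefficient 1. -/
lemma le_lintegral_inv_Ico (n : ℕ) {s : ℝ} (hs : 0 < s) (hs1 : s ≤ 1) :
    ENNReal.ofReal (Real.log (1 / s)) ≤
      (∫⁻ ρ in Set.Ioi (0 : ℝ), ENNReal.ofReal (ρ⁻¹ * ((1 + ρ) ^ (n + 1))⁻¹) *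
        (Set.Ico s 1).indicator 1 ρ) + ENNReal.ofReal (n + 1) := by
  rw [← lintegral_inv_Ico hs hs1]
  have h2 := lintegral_rpow_Iio (t := 1) (α := 1) one_pos one_pos
  rw [Real.one_rpow, div_one, ENNReal.ofReal_one] at h2
  have hm : Measurable fun ρ : ℝ => ENNReal.ofReal (ρ⁻¹ * ((1 + ρ) ^ (n + 1))⁻¹) *
      (Set.Ico s 1).indicator 1 ρ :=
    Measurable.mul (by fun_prop) (measurable_one.indicator measurableSet_Ico)
  rw [← mul_one (ENNReal.ofReal (n + 1)), ← h2,
    ← lintegral_const_mul' _ _ ENNReal.ofReal_ne_top, ← lintegral_add_left hm]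
  refine setLIntegral_mono' measurableSet_Ioi fun ρ hρ => ?_
  have hρ0 : 0 < ρ := hρ
  by_cases h1 : ρ ∈ Set.Ico s 1
  · rw [Set.indicator_of_mem h1, Set.indicator_of_mem (Set.mem_Iio.2 h1.2), Pi.one_apply,
      mul_one, mul_one, Real.rpow_one, ← ENNReal.ofReal_mul (by positivity),
      ← ENNReal.ofReal_mul (by positivity), ← ENNReal.ofReal_add (by positivity) (by positivity)]
    apply ENNReal.ofReal_le_ofReal
    rw [inv_mul_cancel₀ hρ0.ne', mul_one]
    have h3 : 1 - (n + 1) * ρ ≤ ((1 + ρ) ^ (n + 1))⁻¹ := by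
      rw [← inv_pow]
      have h4 : 1 - ρ ≤ (1 + ρ)⁻¹ := by
        rw [le_inv_comm₀ (by linarith [h1.2]) (by positivity)]
        rw [le_inv_comm₀ (by positivity) (by linarith [h1.2]), ← one_div,
          le_div_iff₀ (by positivity)]
        nlinarith
      have h5 := one_add_mul_le_pow (a := -ρ) (by linarith [h1.2]) (n + 1)
      calc (1 : ℝ) - (n + 1) * ρ ≤ (1 - ρ) ^ (n + 1) := by
            refine le_trans (le_of_eq ?_) (h5.trans (le_of_eq ?_))
            · push_cast; ring
            · ring
        _ ≤ _ := pow_le_pow_left₀ (by linarith [h1.2]) h4 _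
    have h6 := mul_le_mul_of_nonneg_left h3 (inv_pos.2 hρ0).le
    have h7 : ρ⁻¹ * (1 - (n + 1) * ρ) = ρ⁻¹ - (n + 1) := by field_simp
    linarith
  · rw [Set.indicator_of_notMem h1]
    simp

end Radial

/-- `herm ζ` has an absolutely continuous distribution. Used with w = 1 to discard the diagonal, and
with w = -1 to discard the antipode, where `cayley` divides by zero. -/
lemma lintegral_herm_point (hn : 1 ≤ n) (ζ : Sphere n) (w : ℂ) :
    ∀ᵐ η ∂(surface n), herm ζ η ≠ w := by
  obtain ⟨c, hc⟩ := exists_isNormSqConst hn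
  have h := lintegral_herm hc hn (h := ({w} : Set ℂ).indicator 1)
    (measurable_one.indicator (measurableSet_singleton w)) ζ
  have hz : ∫⁻ z, halfPow n (1 - ‖z‖ ^ 2) * ({w} : Set ℂ).indicator 1 z = 0 := by
    have hm : Measurable fun z : ℂ => halfPow n (1 - ‖z‖ ^ 2) * ({w} : Set ℂ).indicator 1 z :=
      Measurable.mul (by fun_prop) (measurable_one.indicator (measurableSet_singleton w))
    rw [lintegral_eq_zero_iff hm]
    have : ∀ᵐ z : ℂ, z ≠ w := by simp [ae_iff]
    filter_upwards [this] with z hz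
    simp [hz]
  have hmeas : Measurable fun η : Sphere n => herm ζ η := by
    unfold herm
    refine Finset.measurable_sum _ fun j _ => Measurable.const_mul ?_ _
    exact Complex.continuous_conj.measurable.comp (by fun_prop)
  have hm : Measurable fun η : Sphere n => ({w} : Set ℂ).indicator (1 : ℂ → ℝ≥0∞) (herm ζ η) :=
    (measurable_one.indicator (measurableSet_singleton w)).comp hmeas
  rw [hz, mul_zero, lintegral_eq_zero_iff hm] at h
  filter_upwards [h] with η hη hw
  simp [hw] at hη

end CR

/-! ### Comparison of the quasi-distance with the distance -/

namespace CR

variable {n : ℕ}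

instance (n : ℕ) : IsFiniteMeasure (surface n) :=
  inferInstanceAs (IsFiniteMeasure (ambientVolume n).toSphere)

lemma herm_eq_inner (ζ η : Sphere n) : herm ζ η = inner ℂ (η : Ambient n) (ζ : Ambient n) := by
  simp [herm, PiLp.inner_apply]

@[fun_prop]
lemma continuous_herm : Continuous fun z : Sphere n × Sphere n => herm z.1 z.2 := by
  simp_rw [herm_eq_inner]
  fun_prop

lemma continuous_herm_left (ζ : Sphere n) : Continuous fun η => herm ζ η := by
  simp_rw [herm_eq_inner]
  fun_prop

lemma herm_swap (ζ η : Sphere n) : herm η ζ = (starRingEnd ℂ) (herm ζ η) := by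
  rw [herm_eq_inner, herm_eq_inner, inner_conj_symm]

lemma norm_herm_le (ζ η : Sphere n) : ‖herm ζ η‖ ≤ 1 := by
  rw [herm_eq_inner]
  refine (norm_inner_le_norm _ _).trans ?_
  rw [norm_eq_of_mem_sphere, norm_eq_of_mem_sphere, one_mul]

lemma herm_eq_one_iff {ζ η : Sphere n} : herm ζ η = 1 ↔ ζ = η := by
  rw [herm_eq_inner, inner_eq_one_iff_of_norm_eq_one (norm_eq_of_mem_sphere _)
    (norm_eq_of_mem_sphere _), eq_comm, Subtype.ext_iff]

lemma dist_comm (ζ η : Sphere n) : dist η ζ = dist ζ η := by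
  rw [dist, dist, herm_swap ζ η, ← Complex.norm_conj (1 - herm ζ η)]
  simp

lemma dist_sq (ζ η : Sphere n) : dist ζ η ^ 2 = 2 * ‖1 - herm ζ η‖ :=
  Real.sq_sqrt (by positivity)

lemma dist_le_two (ζ η : Sphere n) : dist ζ η ≤ 2 := by
  have h1 : ‖1 - herm ζ η‖ ≤ 2 := by
    refine (norm_sub_le _ _).trans ?_
    rw [norm_one]
    linarith [norm_herm_le ζ η]
  nlinarith [dist_sq ζ η, dist_nonneg ζ η]

lemma dist_pos {ζ η : Sphere n} (h : ζ ≠ η) : 0 < dist ζ η := by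
  refine Real.sqrt_pos.2 (mul_pos two_pos (norm_pos_iff.2 (sub_ne_zero.2 ?_)))
  exact fun h' => h (herm_eq_one_iff.1 h'.symm)

lemma quasi_nonneg (ζ η : Sphere n) : 0 ≤ quasi ζ η := norm_nonneg _

lemma quasi_comm (ζ η : Sphere n) : quasi η ζ = quasi ζ η := by
  rw [quasi, quasi, herm_swap ζ η, ← Complex.norm_conj (cayley (herm ζ η))]
  simp [cayley]

@[fun_prop]
lemma measurable_dist : Measurable fun z : Sphere n × Sphere n => dist z.1 z.2 := by
  unfold dist
  have := (continuous_herm (n := n)).measurable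
  fun_prop

@[fun_prop]
lemma measurable_quasi : Measurable fun z : Sphere n × Sphere n => quasi z.1 z.2 := by
  unfold quasi
  have := (continuous_herm (n := n)).measurable
  fun_prop

@[fun_prop]
lemma measurable_sinAngle : Measurable fun z : Sphere n × Sphere n => sinAngle z.1 z.2 := by
  unfold sinAngle
  have := (continuous_herm (n := n)).measurable
  fun_prop

lemma measurable_quasi_left (ζ : Sphere n) : Measurable fun η => quasi ζ η := by
  unfold quasi
  have := (continuous_herm_left ζ).measurable
  fun_prop

lemma measurable_dist_left (ζ : Sphere n) : Measurable fun η => dist ζ η := by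
  unfold dist
  have := (continuous_herm_left ζ).measurable
  fun_prop

lemma measurable_sinAngle_left (ζ : Sphere n) : Measurable fun η => sinAngle ζ η := by
  unfold sinAngle
  have := (continuous_herm_left ζ).measurable
  fun_prop

/-- Since |1 + w| ≤ 2. At the excluded antipode `quasi` takes the default value 0 although the
distance is 2. -/
lemma dist_sq_le_quasi {ζ η : Sphere n} (h : herm ζ η ≠ -1) : dist ζ η ^ 2 ≤ 4 * quasi ζ η := by
  have h0 : 1 + herm ζ η ≠ 0 := fun h' => h (by linear_combination h')
  have h1 := norm_pos_iff.2 h0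
  have h2 : ‖1 + herm ζ η‖ ≤ 2 := by
    refine (norm_add_le _ _).trans ?_
    rw [norm_one]
    linarith [norm_herm_le ζ η]
  rw [dist_sq, quasi, cayley, norm_div, mul_div_assoc', le_div_iff₀ h1]
  nlinarith [norm_nonneg (1 - herm ζ η)]

/-- From 2 ≤ |1 + w| + |1 - w|. A factor like 1 + `quasi` is unavoidable: `quasi` is unbounded near
the antipode while the distance is at most 2. -/
lemma quasi_le_dist_sq (ζ η : Sphere n) :
    4 * quasi ζ η ≤ dist ζ η ^ 2 * (1 + quasi ζ η) := by
  by_cases h : 1 + herm ζ η = 0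
  · have : quasi ζ η = 0 := by simp [quasi, cayley, h]
    rw [this]
    nlinarith [sq_nonneg (dist ζ η)]
  · have h1 := norm_pos_iff.2 h
    have h2 : 2 ≤ ‖1 + herm ζ η‖ + ‖1 - herm ζ η‖ := by
      have := norm_add_le (1 + herm ζ η) (1 - herm ζ η)
      rw [show (1 + herm ζ η) + (1 - herm ζ η) = 2 by ring, Complex.norm_ofNat] at this
      exact this
    rw [dist_sq, quasi, cayley, norm_div]
    have e : 1 + ‖1 - herm ζ η‖ / ‖1 + herm ζ η‖ =
        (‖1 + herm ζ η‖ + ‖1 - herm ζ η‖) / ‖1 + herm ζ η‖ := by field_simp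
    rw [e, mul_div_assoc', mul_div_assoc']
    gcongr ?_ / _
    nlinarith [norm_nonneg (1 - herm ζ η)]

lemma cayley_re_nonneg {w : ℂ} (hw : ‖w‖ ≤ 1) : 0 ≤ (cayley w).re := by
  have : (cayley w).re = (1 - ‖w‖ ^ 2) / ‖1 + w‖ ^ 2 := by
    rw [cayley, Complex.div_re, ← Complex.normSq_eq_norm_sq, ← Complex.normSq_eq_norm_sq,
      Complex.normSq_apply w, Complex.normSq_apply (1 + w)]
    simp
    ring
  rw [this]
  have : 0 ≤ 1 - ‖w‖ ^ 2 := by nlinarith [norm_nonneg w]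
  positivity

/-- On Re v ≥ 0 the argument is the arcsine of Im v/|v|. Both sides are 0 at w = ±1, so no exception
is needed. -/
lemma theta_eq_arcsin (ζ η : Sphere n) : theta (herm ζ η) = Real.arcsin (sinAngle ζ η) :=
  Complex.arg_of_re_nonneg (cayley_re_nonneg (norm_herm_le ζ η))

lemma ae_ne (hn : 1 ≤ n) (ζ : Sphere n) : ∀ᵐ η ∂(surface n), ζ ≠ η := by
  filter_upwards [lintegral_herm_point hn ζ 1] with η hη h
  exact hη (herm_eq_one_iff.2 h)

/-- The elementary inequality `(a + b) ^ q ≤ a ^ q + q b (a + b) ^ (q - 1)`. -/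
lemma add_rpow_le {a b q : ℝ} (ha : 0 ≤ a) (hb : 0 ≤ b) (hq : 1 ≤ q) :
    (a + b) ^ q ≤ a ^ q + q * b * (a + b) ^ (q - 1) := by
  rcases (add_nonneg ha hb).eq_or_lt with h0 | h0
  · rw [← h0, Real.zero_rpow (by linarith)]
    positivity
  · have h1 := one_add_mul_self_le_rpow_one_add (s := -(b / (a + b)))
      (by rw [neg_le_neg_iff, div_le_one h0]; linarith) hq
    have h2 : 1 + -(b / (a + b)) = a / (a + b) := by field_simp; ring
    rw [h2, Real.div_rpow ha h0.le, le_div_iff₀ (by positivity)] at h1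
    rw [Real.rpow_sub_one h0.ne']
    have h3 : (1 + q * -(b / (a + b))) * (a + b) ^ q
      = (a + b) ^ q - q * b * ((a + b) ^ q / (a + b)) := by field_simp; ring
    linarith

lemma homDim_pos (n : ℕ) : 0 < homDim n := by unfold homDim; positivity

lemma homDim_eq (n : ℕ) : homDim n = 2 * ((n + 1 : ℕ) : ℝ) := by unfold homDim; push_cast; ring

lemma rpow_dist_eq_sq (ζ η : Sphere n) (x : ℝ) : dist ζ η ^ x = (dist ζ η ^ 2) ^ (x / 2) := by
  rw [← Real.rpow_natCast, ← Real.rpow_mul (dist_nonneg ζ η)]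
  congr 1
  push_cast; ring

lemma dist_rpow_sub_le {α : ℝ} (hα : 0 < α) {ζ η : Sphere n} (hne : ζ ≠ η)
    (h : herm ζ η ≠ -1) : ENNReal.ofReal (dist ζ η ^ (α - homDim n)) ≤
      ENNReal.ofReal (4 ^ (α / 2)) * ENNReal.ofReal (quasi ζ η ^ (α / 2)) *
        ENNReal.ofReal (dist ζ η ^ (-(homDim n))) := by
  have hd := dist_pos hne
  have hq := quasi_nonneg ζ η
  rw [← ENNReal.ofReal_mul (by positivity), ← Real.mul_rpow (by norm_num) hq,
    ← ENNReal.ofReal_mul (by positivity), sub_eq_add_neg, Real.rpow_add hd, rpow_dist_eq_sq ζ η α]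
  have h1 := Real.rpow_le_rpow (by positivity) (dist_sq_le_quasi h) (by positivity : 0 ≤ α / 2)
  exact ENNReal.ofReal_le_ofReal (mul_le_mul_of_nonneg_right h1 (by positivity))

/-- The integral of `d(ζ, η) ^ (α - Q)` over a small ball. -/
lemma lintegral_near_le (hn : 1 ≤ n) {α : ℝ} (hα : 0 < α) : ∃ C : ℝ, 0 ≤ C ∧
    ∀ (ζ : Sphere n) (t : ℝ), 0 < t →
      ∫⁻ η in {η | quasi ζ η < t}, ENNReal.ofReal (dist ζ η ^ (α - homDim n)) ∂(surface n)
        ≤ ENNReal.ofReal (C * t ^ (α / 2)) := by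
  have := isFiniteMeasure_heisSphere hn
  obtain ⟨S, hS0, hS⟩ : ∃ S : ℝ, 0 ≤ S ∧ heisSphereMeasure n Set.univ = ENNReal.ofReal S :=
    ⟨_, ENNReal.toReal_nonneg, (ENNReal.ofReal_toReal (measure_ne_top _ _)).symm⟩
  refine ⟨1 / 4 * S * (4 ^ (α / 2) / (α / 2)), by positivity, fun ζ t ht => ?_⟩
  obtain ⟨b, hb⟩ : ∃ b : ℝ → ℝ≥0∞, b = fun ρ => ENNReal.ofReal (4 ^ (α / 2)) *
    (Set.Iio t).indicator (fun ρ => ENNReal.ofReal (ρ ^ (α / 2))) ρ := ⟨_, rfl⟩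
  have hbm : Measurable b := by
    rw [hb]
    exact (Measurable.indicator (by fun_prop) measurableSet_Iio).const_mul _
  have hset : MeasurableSet {η | quasi ζ η < t} :=
    measurableSet_lt (measurable_quasi_left ζ) measurable_const
  have h1 := (lintegral_dist_separated hn (a := fun _ => 1) measurable_const hbm ζ).1
  rw [lintegral_one, hS] at h1
  have h2 : ∫⁻ η in {η | quasi ζ η < t}, ENNReal.ofReal (dist ζ η ^ (α - homDim n)) ∂(surface n)
      ≤ ∫⁻ η, 1 * b (quasi ζ η) * ENNReal.ofReal (dist ζ η ^ (-(homDim n))) ∂(surface n) := by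
    rw [← lintegral_indicator hset]
    refine lintegral_mono_ae ?_
    filter_upwards [lintegral_herm_point hn ζ (-1), ae_ne hn ζ] with η h1 h2
    by_cases hη : quasi ζ η < t
    · rw [Set.indicator_of_mem (show η ∈ {η | quasi ζ η < t} from hη), hb, one_mul]
      beta_reduce
      rw [
        Set.indicator_of_mem (Set.mem_Iio.2 hη)]
      exact dist_rpow_sub_le hα h2 h1
    · rw [Set.indicator_of_notMem (show η ∉ {η | quasi ζ η < t} from hη)]
      exact zero_le
  have h3 : ∫⁻ ρ in Set.Ioi (0 : ℝ), ENNReal.ofReal ρ⁻¹ * b ρ =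
      ENNReal.ofReal (4 ^ (α / 2)) * ENNReal.ofReal (t ^ (α / 2) / (α / 2)) := by
    rw [← lintegral_rpow_Iio ht (by positivity), ← lintegral_const_mul' _ _ ENNReal.ofReal_ne_top]
    refine lintegral_congr fun ρ => ?_
    rw [hb, mul_left_comm]
  refine h2.trans (h1.trans (le_of_eq ?_))
  rw [h3, ← ENNReal.ofReal_mul (by positivity), ← ENNReal.ofReal_mul (by positivity),
    ← ENNReal.ofReal_mul (by positivity)]
  congr 1
  ring

end CR

/-! ### The majorant of G is an Adams kernel -/

namespace CR

variable {n : ℕ}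

/-- The size of the kernels `G` under consideration. -/
noncomputable def majorant (n : ℕ) (g : ℝ → ℝ) (d C ε : ℝ) (ζ η : Sphere n) : ℝ :=
  |g (sinAngle ζ η)| * dist ζ η ^ (d - homDim n) + C * dist ζ η ^ (d - homDim n + ε)

lemma measurable_majorant {g : ℝ → ℝ} (hg : Measurable g) (d C ε : ℝ) :
    Measurable fun z : Sphere n × Sphere n => majorant n g d C ε z.1 z.2 := by
  have h1 := measurable_dist (n := n)
  have h2 := measurable_sinAngle (n := n)
  unfold majorant
  fun_prop

lemma majorant_eq {g : ℝ → ℝ} {d C ε : ℝ} {ζ η : Sphere n} (h : ζ ≠ η) :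
    majorant n g d C ε ζ η =
      (|g (sinAngle ζ η)| + C * dist ζ η ^ ε) * dist ζ η ^ (d - homDim n) := by
  rw [majorant, Real.rpow_add (dist_pos h)]
  ring

lemma majorant_nonneg {g : ℝ → ℝ} {d C ε : ℝ} (hC : 0 ≤ C) (ζ η : Sphere n) :
    0 ≤ majorant n g d C ε ζ η := by
  have := dist_nonneg ζ η
  unfold majorant
  positivity

lemma dist_rpow_le {ε : ℝ} (hε : 0 < ε) (ζ η : Sphere n) : dist ζ η ^ ε ≤ 2 ^ ε :=
  Real.rpow_le_rpow (dist_nonneg ζ η) (dist_le_two ζ η) hε.le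

lemma majorant_le {g : ℝ → ℝ} {d C ε M : ℝ} (hC : 0 ≤ C) (hε : 0 < ε) (hM : ∀ x, |g x| ≤ M)
    {ζ η : Sphere n} (h : ζ ≠ η) :
    majorant n g d C ε ζ η ≤ (M + C * 2 ^ ε) * dist ζ η ^ (d - homDim n) := by
  have h1 := dist_nonneg ζ η
  have h2 := dist_rpow_le hε ζ η
  have h3 := hM (sinAngle ζ η)
  rw [majorant_eq h]
  gcongr

/-- The relations between the exponents. -/
lemma exponents {d p q : ℝ} (hd : 0 < d) (hdQ : d < homDim n) (hp : p = homDim n / d)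
    (hpq : 1 / p + 1 / q = 1) : p.HolderConjugate q ∧ 1 / p = d / homDim n ∧
      1 / q = (homDim n - d) / homDim n ∧ (d - homDim n) * q = -homDim n := by
  have hQ := homDim_pos n
  have h1 : 1 / p = d / homDim n := by rw [hp]; field_simp
  have h2 : 1 / q = (homDim n - d) / homDim n := by
    rw [h1] at hpq
    field_simp at hpq ⊢
    linarith
  have hq : q = homDim n / (homDim n - d) := by
    rw [← one_div_one_div q, h2, one_div_div]
  have hdQ' : 0 < homDim n - d := by linarith
  refine ⟨Real.holderConjugate_iff.2 ⟨?_, by simpa using hpq⟩, h1, h2, ?_⟩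
  · rw [hp, one_lt_div hd]
    exact hdQ
  · rw [hq]
    field_simp
    ring

/-- As dist² ≤ 4, the bound of `quasi_le_dist_sq` may be weakened from `quasi` to r, which keeps 1 +
r ≤ 1 + R bounded. -/
lemma dist_rpow_le_of_quasi_ge {d r R : ℝ} (hdQ : d < homDim n) (hr : 0 < r) (hrR : r ≤ R)
    {ζ η : Sphere n} (h : r ≤ quasi ζ η) :
    dist ζ η ^ (d - homDim n) ≤
      (4 / (1 + R)) ^ ((d - homDim n) / 2) * r ^ ((d - homDim n) / 2) := by
  have h1 := quasi_le_dist_sq ζ η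
  have h2 : dist ζ η ^ 2 ≤ 4 := by nlinarith [dist_nonneg ζ η, dist_le_two ζ η]
  have h3 : 4 * r ≤ dist ζ η ^ 2 * (1 + r) := by nlinarith
  have hR : 0 < 1 + R := by linarith
  have h4 : 4 / (1 + R) * r ≤ dist ζ η ^ 2 := by
    rw [div_mul_eq_mul_div, div_le_iff₀ hR]
    nlinarith [sq_nonneg (dist ζ η)]
  rw [rpow_dist_eq_sq, ← Real.mul_rpow (by positivity) hr.le]
  exact Real.rpow_le_rpow_of_nonpos (by positivity) h4 (by linarith)

lemma quasi_pow_le_iff {ζ η : Sphere n} {t : ℝ} (ht : 0 < t) :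
    t ≤ quasi ζ η ^ (n + 1) ↔ t ^ (1 / ((n + 1 : ℕ) : ℝ)) ≤ quasi ζ η := by
  have h0 : (0 : ℝ) < ((n + 1 : ℕ) : ℝ) := by positivity
  have e : t = (t ^ (1 / ((n + 1 : ℕ) : ℝ))) ^ (n + 1) := by
    rw [← Real.rpow_natCast, ← Real.rpow_mul ht.le, one_div_mul_cancel h0.ne', Real.rpow_one]
  conv_lhs => rw [e]
  exact pow_le_pow_iff_left₀ (by positivity) (quasi_nonneg ζ η) (by omega)

lemma rpow_root_rpow (n : ℕ) {t x : ℝ} (ht : 0 < t) :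
    (t ^ (1 / ((n + 1 : ℕ) : ℝ))) ^ (x / 2) = t ^ (x / homDim n) := by
  rw [← Real.rpow_mul ht.le, homDim_eq]
  congr 1
  have h0 : (0 : ℝ) < ((n + 1 : ℕ) : ℝ) := by positivity
  field_simp

lemma shell_main_le (hn : 1 ≤ n) {g : ℝ → ℝ} (hg : Measurable g) {q I : ℝ}
    (hI : ∫⁻ u, ENNReal.ofReal (|g u.2| ^ q) ∂(heisSphereMeasure n) = ENNReal.ofReal I)
    (hI0 : 0 ≤ I) {s t : ℝ} (hs : 0 < s) (hst : s ≤ t) (ζ : Sphere n) :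
    ∫⁻ η in {η | s ≤ quasi ζ η ∧ quasi ζ η < t},
      ENNReal.ofReal (|g (sinAngle ζ η)| ^ q) * ENNReal.ofReal (dist ζ η ^ (-(homDim n)))
        ∂(surface n) ≤ ENNReal.ofReal (1 / 4 * I * Real.log (t / s)) := by
  have hset : MeasurableSet {η | s ≤ quasi ζ η ∧ quasi ζ η < t} :=
    (measurableSet_le measurable_const (measurable_quasi_left ζ)).inter
      (measurableSet_lt (measurable_quasi_left ζ) measurable_const)
  have h1 := (lintegral_dist_separated hn (a := fun x => ENNReal.ofReal (|g x| ^ q))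
    (b := (Set.Ico s t).indicator 1) (by fun_prop)
    (measurable_one.indicator measurableSet_Ico) ζ).1
  rw [hI, lintegral_inv_Ico hs hst, ← ENNReal.ofReal_mul (by norm_num),
    ← ENNReal.ofReal_mul (by positivity)] at h1
  refine le_trans (le_of_eq ?_) h1
  rw [← lintegral_indicator hset]
  refine lintegral_congr fun η => ?_
  by_cases hη : s ≤ quasi ζ η ∧ quasi ζ η < t
  · rw [Set.indicator_of_mem (show η ∈ {η | s ≤ quasi ζ η ∧ quasi ζ η < t} from hη),
      Set.indicator_of_mem (show quasi ζ η ∈ Set.Ico s t from hη), Pi.one_apply, mul_one]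
  · rw [Set.indicator_of_notMem (show η ∉ {η | s ≤ quasi ζ η ∧ quasi ζ η < t} from hη),
      Set.indicator_of_notMem (show quasi ζ η ∉ Set.Ico s t from hη), mul_zero, zero_mul]

/-- The main term must keep coefficient 1, as it fixes the sharp constant. Hence `add_rpow_le`
instead of a convexity bound: the entire error carries a factor dist^ε and is integrable. -/
lemma majorant_rpow_le {g : ℝ → ℝ} {d C ε M q : ℝ} (hC : 0 ≤ C) (hε : 0 < ε)
    (hM : ∀ x, |g x| ≤ M) (hq : 1 ≤ q) (hdq : (d - homDim n) * q = -homDim n)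
    {ζ η : Sphere n} (h : ζ ≠ η) :
    majorant n g d C ε ζ η ^ q ≤ |g (sinAngle ζ η)| ^ q * dist ζ η ^ (-(homDim n)) +
      q * C * (M + C * 2 ^ ε) ^ (q - 1) * dist ζ η ^ (ε - homDim n) := by
  have hd := dist_pos h
  have h2 := dist_rpow_le hε ζ η
  have h3 := hM (sinAngle ζ η)
  have h4 := add_rpow_le (a := |g (sinAngle ζ η)|) (b := C * dist ζ η ^ ε) (q := q)
    (by positivity) (by positivity) hq
  have h5 : (|g (sinAngle ζ η)| + C * dist ζ η ^ ε) ^ (q - 1) ≤ (M + C * 2 ^ ε) ^ (q - 1) := by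
    apply Real.rpow_le_rpow (by positivity) _ (by linarith)
    gcongr
  rw [majorant_eq h, Real.mul_rpow (by positivity) (by positivity), ← Real.rpow_mul hd.le, hdq,
    show ε - homDim n = ε + -homDim n by ring, Real.rpow_add hd]
  have h6 : (|g (sinAngle ζ η)| + C * dist ζ η ^ ε) ^ q ≤ |g (sinAngle ζ η)| ^ q +
      q * (C * dist ζ η ^ ε) * (M + C * 2 ^ ε) ^ (q - 1) := by
    refine h4.trans ?_
    gcongr
  calc _ ≤ (|g (sinAngle ζ η)| ^ q + q * (C * dist ζ η ^ ε) * (M + C * 2 ^ ε) ^ (q - 1)) *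
        dist ζ η ^ (-homDim n) := by gcongr
    _ = _ := by ring

/-- The majorant satisfies the hypotheses of the abstract exponential inequality. -/
theorem exists_adamsKernel (hn : 1 ≤ n) {d p q : ℝ} (hd : 0 < d) (hdQ : d < homDim n)
    (hp : p = homDim n / d) (hpq : 1 / p + 1 / q = 1) {g : ℝ → ℝ} (hg : Measurable g) {M : ℝ}
    (hM : ∀ x, |g x| ≤ M) {C ε : ℝ} (hC : 0 ≤ C) (hε : 0 < ε) {I : ℝ} (hI0 : 0 < I)
    (hI : ∫⁻ u, ENNReal.ofReal (|g u.2| ^ q) ∂(heisSphereMeasure n) = ENNReal.ofReal I) :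
    ∃ M' R, 0 < R ∧ AdamsKernel (surface n) p q (I / (2 * homDim n)) M' R
      (fun ζ η => ENNReal.ofReal (majorant n g d C ε ζ η)) (fun ζ η => quasi ζ η ^ (n + 1)) := by
  obtain ⟨hconj, hp1, hq1, hdq⟩ := exponents hd hdQ hp hpq
  have hQ := homDim_pos n
  have hM0 : 0 ≤ M := (abs_nonneg _).trans (hM 0)
  have hq := hconj.symm.lt.le
  obtain ⟨Cd, hCd0, hCd⟩ := lintegral_near_le hn hd
  obtain ⟨Ce, hCe0, hCe⟩ := lintegral_near_le hn hε
  set R : ℝ := 1 + (surface n Set.univ).toReal with hR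
  have hR0 : 0 < R := by positivity
  -- The radius in terms of `quasi` that corresponds to the value t of V.
  set r : ℝ → ℝ := fun t => t ^ (1 / ((n + 1 : ℕ) : ℝ)) with hr
  have hr0 : ∀ t, 0 < t → 0 < r t := fun t ht => by positivity
  have hrmono : ∀ s t, 0 < s → s ≤ t → r s ≤ r t := fun s t hs hst =>
    Real.rpow_le_rpow hs.le hst (by positivity)
  set M₁ := M + C * 2 ^ ε with hM₁
  have hM₁0 : 0 ≤ M₁ := by positivity
  set c₁ := M₁ * (4 / (1 + r R)) ^ ((d - homDim n) / 2) with hc₁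
  have hrR := hr0 R hR0
  have hc₁0 : 0 ≤ c₁ := by positivity
  set c₃ := q * C * M₁ ^ (q - 1) with hc₃
  have hc₃0 : 0 ≤ c₃ := by positivity
  set c₂ := c₃ * (Ce * r R ^ (ε / 2)) with hc₂
  have hc₂0 : 0 ≤ c₂ := by positivity
  have hlt : ∀ t, 0 < t → ∀ ζ η : Sphere n, quasi ζ η ^ (n + 1) < t ↔ quasi ζ η < r t := by
    intro t ht ζ η
    rw [← not_le, quasi_pow_le_iff ht, not_le]
  have hnear : ∀ t, 0 < t → t ≤ R → ∀ ζ : Sphere n,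
      ∫⁻ η in {η | quasi ζ η ^ (n + 1) < t}, ENNReal.ofReal (M₁ * dist ζ η ^ (d - homDim n))
        ∂(surface n) ≤ ENNReal.ofReal ((c₁ + M₁ * Cd + c₂) * t ^ (1 / p)) := by
    intro t ht htR ζ
    simp_rw [hlt t ht, ENNReal.ofReal_mul hM₁0]
    rw [lintegral_const_mul' _ _ ENNReal.ofReal_ne_top]
    calc _ ≤ ENNReal.ofReal M₁ * ENNReal.ofReal (Cd * r t ^ (d / 2)) := by
          gcongr
          exact hCd ζ (r t) (hr0 t ht)
      _ ≤ _ := by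
          rw [← ENNReal.ofReal_mul hM₁0, hr, rpow_root_rpow n ht, hp1]
          apply ENNReal.ofReal_le_ofReal
          rw [← mul_assoc]
          gcongr
          linarith
  refine ⟨c₁ + M₁ * Cd + c₂, R, hR0, ⟨?_, ?_, hconj, by positivity, by positivity, ?_, ?_, ?_, ?_, ?_⟩⟩
  · exact (measurable_majorant hg d C ε).ennreal_ofReal
  · exact (measurable_quasi (n := n)).pow_const _
  · rw [← ENNReal.ofReal_toReal (measure_ne_top (surface n) Set.univ)]
    exact ENNReal.ofReal_le_ofReal (by linarith)
  · intro t ht htR ζ η h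
    have h1 := (quasi_pow_le_iff ht).1 h
    have hne : ζ ≠ η := by
      rintro rfl
      have h2 : quasi ζ ζ = 0 := by
        rw [quasi, herm_eq_one_iff.2 rfl]; simp [cayley]
      rw [h2] at h1
      exact absurd h1 (not_le.2 (hr0 t ht))
    apply ENNReal.ofReal_le_ofReal
    refine (majorant_le hC hε hM hne).trans ?_
    have h3 := dist_rpow_le_of_quasi_ge hdQ (hr0 t ht) (hrmono t R ht htR) h1
    have h4 : r t ^ ((d - homDim n) / 2) = t ^ (-(1 / q)) := by
      rw [hr, rpow_root_rpow n ht, hq1]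
      congr 1
      ring
    rw [h4] at h3
    calc M₁ * dist ζ η ^ (d - homDim n)
        ≤ M₁ * ((4 / (1 + r R)) ^ ((d - homDim n) / 2) * t ^ (-(1 / q))) := by gcongr
      _ = c₁ * t ^ (-(1 / q)) := by rw [hc₁]; ring
      _ ≤ _ := by
          gcongr
          nlinarith
  · intro t ht htR ζ
    refine le_trans (lintegral_mono_ae (ae_restrict_of_ae ?_)) (hnear t ht htR ζ)
    filter_upwards [ae_ne hn ζ] with η hη
    exact ENNReal.ofReal_le_ofReal (majorant_le hC hε hM hη)
  · intro t ht htR ζ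
    have h1 := hnear t ht htR ζ
    -- The majorant need not be symmetric, because exchanging its arguments reverses the angle; the
    -- multiple of dist^(d-Q) that dominates it is symmetric.
    simp_rw [fun η => quasi_comm ζ η]
    refine le_trans (lintegral_mono_ae (ae_restrict_of_ae ?_)) h1
    filter_upwards [ae_ne hn ζ] with η hη
    rw [← dist_comm]
    exact ENNReal.ofReal_le_ofReal (majorant_le hC hε hM hη.symm)
  · intro s t hs hst htR ζ
    have ht := hs.trans_le hst
    have hset : {η | s ≤ quasi ζ η ^ (n + 1) ∧ quasi ζ η ^ (n + 1) < t} =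
        {η | r s ≤ quasi ζ η ∧ quasi ζ η < r t} := by
      ext η
      simp only [Set.mem_ofPred_eq]
      rw [hlt t ht, quasi_pow_le_iff hs]
    rw [hset]
    have hlog : Real.log (r t / r s) = Real.log (t / s) / ((n + 1 : ℕ) : ℝ) := by
      rw [hr]
      simp only
      rw [← Real.div_rpow ht.le hs.le, Real.log_rpow (by positivity)]
      ring
    have hlog0 : 0 ≤ Real.log (t / s) := Real.log_nonneg (by rwa [one_le_div hs])
    have hmain := shell_main_le hn hg hI hI0.le (hr0 s hs) (hrmono s t hs hst) ζ
    have hmeas : Measurable fun η => ENNReal.ofReal (c₃ * dist ζ η ^ (ε - homDim n)) := by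
      have := measurable_dist_left ζ
      fun_prop
    have herr : ∫⁻ η in {η | r s ≤ quasi ζ η ∧ quasi ζ η < r t},
        ENNReal.ofReal (c₃ * dist ζ η ^ (ε - homDim n)) ∂(surface n) ≤ ENNReal.ofReal c₂ := by
      simp_rw [ENNReal.ofReal_mul hc₃0]
      rw [lintegral_const_mul' _ _ ENNReal.ofReal_ne_top, hc₂, ENNReal.ofReal_mul hc₃0]
      gcongr
      refine le_trans (lintegral_mono_set ?_) (hCe ζ (r R) hrR)
      exact fun η hη => lt_of_lt_of_le hη.2 (hrmono t R ht htR)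
    calc _ ≤ ∫⁻ η in {η | r s ≤ quasi ζ η ∧ quasi ζ η < r t},
          ENNReal.ofReal (|g (sinAngle ζ η)| ^ q) * ENNReal.ofReal (dist ζ η ^ (-(homDim n)))
            + ENNReal.ofReal (c₃ * dist ζ η ^ (ε - homDim n)) ∂(surface n) := by
          refine lintegral_mono_ae (ae_restrict_of_ae ?_)
          filter_upwards [ae_ne hn ζ] with η hη
          have hdp := dist_pos hη
          rw [ENNReal.ofReal_rpow_of_nonneg (majorant_nonneg hC ζ η) (by linarith),
            ← ENNReal.ofReal_mul (by positivity), ← ENNReal.ofReal_add (by positivity)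
            (by positivity)]
          exact ENNReal.ofReal_le_ofReal (majorant_rpow_le hC hε hM hq hdq hη)
      _ ≤ ENNReal.ofReal (1 / 4 * I * Real.log (r t / r s)) + ENNReal.ofReal c₂ := by
          rw [lintegral_add_right _ hmeas]
          exact add_le_add hmain herr
      _ ≤ _ := by
          rw [← ENNReal.ofReal_add (by rw [hlog]; positivity) hc₂0]
          apply ENNReal.ofReal_le_ofReal
          -- The sharp constant appears here: passing from `quasi` to V divides the logarithm by n +
          -- 1, and 4(n + 1) = 2Q.
          have e : 1 / 4 * I * Real.log (r t / r s) = I / (2 * homDim n) * Real.log (t / s) := by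
            rw [hlog, homDim_eq]
            have h0 : (0 : ℝ) < ((n + 1 : ℕ) : ℝ) := by positivity
            field_simp
            ring
          rw [e]
          have : 0 ≤ M₁ * Cd := by positivity
          linarith

end CR

/-! ### The operator T on L^p -/

namespace CR

variable {n : ℕ} {𝕜 : Type*} [RCLike 𝕜]

open Classical in
/-- The kernel `G`, modified to vanish on the diagonal. -/
noncomputable def offDiag (G : Sphere n → Sphere n → ℝ) (z : Sphere n × Sphere n) : ℝ :=
  if z.1 ≠ z.2 then G z.1 z.2 else 0

lemma measurable_offDiag {G : Sphere n → Sphere n → ℝ} (hG : Measurable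
    (fun x : {x : Sphere n × Sphere n // x.1 ≠ x.2} => G x.1.1 x.1.2)) :
    Measurable (offDiag G) := by
  classical
  have hs : MeasurableSet {z : Sphere n × Sphere n | z.1 ≠ z.2} :=
    (measurableSet_eq_fun measurable_fst measurable_snd).compl
  have h := Measurable.dite (s := {z : Sphere n × Sphere n | z.1 ≠ z.2})
    (f := fun x => G x.1.1 x.1.2) hG (g := fun _ => 0) measurable_const hs
  convert h using 1
  ext z
  by_cases hz : z.1 ≠ z.2
  · simp [offDiag, hz]
  · simp [offDiag, hz]

lemma ae_offDiag_mul (hn : 1 ≤ n) (G : Sphere n → Sphere n → ℝ) {F F' : Sphere n → 𝕜}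
    (h : F =ᵐ[surface n] F') (ζ : Sphere n) :
    (fun η => (G ζ η : 𝕜) * F η) =ᵐ[surface n] fun η => (offDiag G (ζ, η) : 𝕜) * F' η := by
  filter_upwards [h, ae_ne hn ζ] with η h1 h2
  simp [offDiag, h1, h2]

lemma stronglyMeasurable_offDiag_mul {G : Sphere n → Sphere n → ℝ} (hG : Measurable
    (fun x : {x : Sphere n × Sphere n // x.1 ≠ x.2} => G x.1.1 x.1.2)) {F : Sphere n → 𝕜}
    (hF : StronglyMeasurable F) :
    StronglyMeasurable fun z : Sphere n × Sphere n => (offDiag G z : 𝕜) * F z.2 :=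
  (RCLike.continuous_ofReal.measurable.comp (measurable_offDiag hG)).stronglyMeasurable.mul
    (hF.comp_measurable measurable_snd)

/-- Each slice of the diagonal is null, so G may be replaced by the jointly measurable `offDiag G`
and F by a measurable representative without changing any value of T G F. -/
lemma aestronglyMeasurable_T (hn : 1 ≤ n) {G : Sphere n → Sphere n → ℝ} (hG : Measurable
    (fun x : {x : Sphere n × Sphere n // x.1 ≠ x.2} => G x.1.1 x.1.2)) {F : Sphere n → 𝕜}
    (hF : AEStronglyMeasurable F (surface n)) : AEStronglyMeasurable (T G F) (surface n) := by
  have h1 : T G F = fun ζ => ∫ η, (offDiag G (ζ, η) : 𝕜) * hF.mk F η ∂(surface n) := by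
    ext ζ
    exact integral_congr_ae (ae_offDiag_mul hn G hF.ae_eq_mk ζ)
  rw [h1]
  exact (stronglyMeasurable_offDiag_mul hG
    hF.stronglyMeasurable_mk).integral_prod_right'.aestronglyMeasurable

lemma enorm_offDiag_mul_le {G K : Sphere n → Sphere n → ℝ}
    (hK : ∀ ζ η, ζ ≠ η → |G ζ η| ≤ K ζ η) (ζ η : Sphere n) (x : 𝕜) :
    ‖(offDiag G (ζ, η) : 𝕜) * x‖ₑ ≤ ENNReal.ofReal (K ζ η) * ‖x‖ₑ := by
  rw [enorm_mul]
  gcongr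
  by_cases h : ζ ≠ η
  · rw [offDiag, if_pos h, ← ofReal_norm, RCLike.norm_ofReal]
    exact ENNReal.ofReal_le_ofReal (hK ζ η h)
  · simp [offDiag, h]

/-- The potential of an `L^p` function is finite almost everywhere. -/
lemma ae_lintegral_lt_top {p q A M R : ℝ} {K : Sphere n → Sphere n → ℝ≥0∞}
    {V : Sphere n → Sphere n → ℝ} (hK : AdamsKernel (surface n) p q A M R K V) (hR : 0 < R)
    {f : Sphere n → ℝ≥0∞} (hf : Measurable f) (hf1 : ∫⁻ η, f η ∂(surface n) ≠ ∞) :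
    ∀ᵐ ζ ∂(surface n), ∫⁻ η, K ζ η * f η ∂(surface n) < ∞ := by
  have hm : Measurable fun z : Sphere n × Sphere n => K z.1 z.2 * f z.2 :=
    hK.measurable_kernel.mul (hf.comp measurable_snd)
  refine ae_lt_top hm.lintegral_prod_right' ?_
  rw [lintegral_lintegral_swap hm.aemeasurable]
  refine ne_top_of_le_ne_top ?_ (lintegral_mono (g := fun η =>
    ENNReal.ofReal (2 * M * R ^ (1 / p)) * f η) fun η => ?_)
  · rw [lintegral_const_mul _ hf]
    exact ENNReal.mul_ne_top ENNReal.ofReal_ne_top hf1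
  · rw [lintegral_mul_const _ (hK.measurable_right η)]
    have := hK.setLIntegral_le hR le_rfl (E := Set.univ) hK.univ_le η
    rw [setLIntegral_univ] at this
    exact mul_le_mul' this le_rfl

variable {p q A M R : ℝ} {G K : Sphere n → Sphere n → ℝ} {V : Sphere n → Sphere n → ℝ}

lemma ae_integrable_mul (hn : 1 ≤ n)
    (hK : AdamsKernel (surface n) p q A M R (fun ζ η => ENNReal.ofReal (K ζ η)) V)
    (hR : 0 < R) (hG : Measurable
      (fun x : {x : Sphere n × Sphere n // x.1 ≠ x.2} => G x.1.1 x.1.2))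
    (hGK : ∀ ζ η, ζ ≠ η → |G ζ η| ≤ K ζ η) {F : Sphere n → 𝕜}
    (hF : MemLp F (ENNReal.ofReal p) (surface n)) :
    ∀ᵐ ζ ∂(surface n), Integrable (fun η => (G ζ η : 𝕜) * F η) (surface n) := by
  have h1 : Integrable F (surface n) := hF.integrable (by
    rw [← ENNReal.ofReal_one]; exact ENNReal.ofReal_le_ofReal hK.conj.lt.le)
  have hsm := hF.1.stronglyMeasurable_mk
  have h2 : ∫⁻ η, ‖hF.1.mk F η‖ₑ ∂(surface n) ≠ ∞ :=
    ((integrable_congr hF.1.ae_eq_mk).1 h1).2.ne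
  filter_upwards [ae_lintegral_lt_top hK hR hsm.measurable.enorm h2] with ζ hζ
  rw [integrable_congr (ae_offDiag_mul hn G hF.1.ae_eq_mk ζ)]
  refine ⟨((stronglyMeasurable_offDiag_mul hG hsm).comp_measurable
    measurable_prodMk_left).aestronglyMeasurable, ?_⟩
  exact lt_of_le_of_lt (lintegral_mono fun η => enorm_offDiag_mul_le hGK ζ η _) hζ

/-- The exponential inequality for an integral operator whose kernel is dominated by an
`AdamsKernel`. -/
lemma exists_expIntegral_le (hn : 1 ≤ n)
    (hK : AdamsKernel (surface n) p q A M R (fun ζ η => ENNReal.ofReal (K ζ η)) V)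
    (hR : 0 < R) (hGK : ∀ ζ η, ζ ≠ η → |G ζ η| ≤ K ζ η) :
    ∃ C₀ : ℝ, 0 < C₀ ∧ ∀ F : Sphere n → 𝕜, MemLp F (ENNReal.ofReal p) (surface n) →
      expIntegral G p q A⁻¹ F ≤ ENNReal.ofReal C₀ := by
  obtain ⟨C, hC, hexp⟩ := hK.exists_lintegral_exp_le
  have hp := hK.conj.pos
  have hq := hK.conj.symm.pos
  have htop : C + surface n Set.univ ≠ ∞ := ENNReal.add_ne_top.2 ⟨hC, measure_ne_top _ _⟩
  refine ⟨(C + surface n Set.univ).toReal + 1, by positivity, fun F hF => ?_⟩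
  have hle : C + surface n Set.univ ≤
      ENNReal.ofReal ((C + surface n Set.univ).toReal + 1) := by
    rw [ENNReal.le_ofReal_iff_toReal_le htop (by positivity)]
    linarith
  refine le_trans ?_ hle
  rcases (ENNReal.toReal_nonneg (a := eLpNorm F (ENNReal.ofReal p) (surface n))).eq_or_lt
    with h0 | h0
  -- If the norm is 0, division by zero makes the quotient 0 and the integral is the total mass;
  -- this is why the total mass is added to the constant.
  · refine le_trans (le_of_eq ?_) le_add_self
    simp [expIntegral, lpNorm, ← h0, Real.zero_rpow hq.ne']
  · refine le_trans ?_ le_self_add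
    set N := (eLpNorm F (ENNReal.ofReal p) (surface n)).toReal with hN
    have hsm := hF.1.stronglyMeasurable_mk
    set F' := hF.1.mk F with hF'
    have h1 : Integrable F (surface n) := hF.integrable (by
      rw [← ENNReal.ofReal_one]; exact ENNReal.ofReal_le_ofReal hK.conj.lt.le)
    have h2 : ∫⁻ η, ‖F' η‖ₑ ∂(surface n) ≠ ∞ :=
      ((integrable_congr hF.1.ae_eq_mk).1 h1).2.ne
    have hfm : Measurable fun η => ENNReal.ofReal N⁻¹ * ‖F' η‖ₑ := hsm.measurable.enorm.const_mul _
    have hnorm : ∫⁻ η, (ENNReal.ofReal N⁻¹ * ‖F' η‖ₑ) ^ p ∂(surface n) ≤ 1 := by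
      have h3 : ∫⁻ η, ‖F' η‖ₑ ^ p ∂(surface n) = ENNReal.ofReal N ^ p := by
        rw [hN, ENNReal.ofReal_toReal hF.2.ne, eLpNorm_congr_ae hF.1.ae_eq_mk,
          eLpNorm_eq_lintegral_rpow_enorm_toReal (by simpa using hp) ENNReal.ofReal_ne_top,
          ENNReal.toReal_ofReal hp.le, ← ENNReal.rpow_mul, one_div_mul_cancel hp.ne',
          ENNReal.rpow_one]
      simp_rw [ENNReal.mul_rpow_of_nonneg _ _ hp.le]
      rw [lintegral_const_mul' _ _ (by simp [hp.le]), h3, ← ENNReal.mul_rpow_of_nonneg _ _ hp.le,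
        ← ENNReal.ofReal_mul (by positivity), inv_mul_cancel₀ h0.ne', ENNReal.ofReal_one,
        ENNReal.one_rpow]
    refine le_trans (lintegral_mono_ae ?_) (hexp _ hfm hnorm)
    filter_upwards [ae_lintegral_lt_top hK hR hsm.measurable.enorm h2] with ζ hζ
    apply ENNReal.ofReal_le_ofReal
    apply Real.exp_le_exp.2
    have h4 : ∫⁻ η, ENNReal.ofReal (K ζ η) * (ENNReal.ofReal N⁻¹ * ‖F' η‖ₑ) ∂(surface n) =
        ENNReal.ofReal N⁻¹ * ∫⁻ η, ENNReal.ofReal (K ζ η) * ‖F' η‖ₑ ∂(surface n) := by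
      rw [← lintegral_const_mul' _ _ ENNReal.ofReal_ne_top]
      exact lintegral_congr fun η => by ring
    have h5 : ‖T G F ζ‖ ≤ (∫⁻ η, ENNReal.ofReal (K ζ η) * ‖F' η‖ₑ ∂(surface n)).toReal := by
      rw [T, integral_congr_ae (ae_offDiag_mul hn G hF.1.ae_eq_mk ζ)]
      refine (norm_integral_le_lintegral_norm _).trans (ENNReal.toReal_mono hζ.ne ?_)
      refine lintegral_mono fun η => ?_
      rw [ofReal_norm]
      exact enorm_offDiag_mul_le hGK ζ η _
    rw [h4, ENNReal.toReal_mul, ENNReal.toReal_ofReal (by positivity), div_eq_inv_mul (_ ^ q)]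
    have hA := hK.pos
    have h6 : ‖T G F ζ‖ / lpNorm p F ≤
        N⁻¹ * (∫⁻ η, ENNReal.ofReal (K ζ η) * ‖F' η‖ₑ ∂(surface n)).toReal := by
      rw [div_eq_inv_mul]
      exact mul_le_mul_of_nonneg_left h5 (inv_nonneg.2 h0.le)
    have h7 : 0 ≤ ‖T G F ζ‖ / lpNorm p F := div_nonneg (norm_nonneg _) ENNReal.toReal_nonneg
    gcongr

end CR

/-! ### The angular function as a function of the sine -/

namespace CR

variable {n : ℕ}

/-- `Real.arcsin` takes all of ℝ into [-π/2, π/2], so g₀ ∘ arcsin is measurable and bounded on the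
whole line, whatever g₀ does outside the interval. -/
lemma measurable_comp_arcsin {g₀ : ℝ → ℝ}
    (hg : Measurable (fun x : Set.Icc (-(Real.pi / 2)) (Real.pi / 2) => g₀ x)) :
    Measurable fun x => g₀ (Real.arcsin x) :=
  hg.comp (Real.measurable_arcsin.subtype_mk (h := Real.arcsin_mem_Icc))

lemma sigmaIntegral_nonneg (n : ℕ) (g₀ : ℝ → ℝ) (q : ℝ) : 0 ≤ sigmaIntegral n g₀ q :=
  integral_nonneg fun _ => by positivity

lemma ofReal_sigmaIntegral (hn : 1 ≤ n) {g₀ : ℝ → ℝ} {q M : ℝ} (hq : 0 ≤ q)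
    (hg : Measurable fun x => g₀ (Real.arcsin x)) (hM : ∀ x, |g₀ (Real.arcsin x)| ≤ M) :
    ∫⁻ u, ENNReal.ofReal (|g₀ (Real.arcsin u.2)| ^ q) ∂(heisSphereMeasure n) =
      ENNReal.ofReal (sigmaIntegral n g₀ q) := by
  have := isFiniteMeasure_heisSphere hn
  have hm : Measurable fun u : Heis n => |g₀ (Real.arcsin u.2)| ^ q :=
    (((hg.comp measurable_snd).abs).pow_const q)
  refine (ofReal_integral_eq_lintegral_ofReal ?_ (ae_of_all _ fun _ => by positivity)).symm
  refine Integrable.of_bound hm.aestronglyMeasurable (M ^ q) (ae_of_all _ fun u => ?_)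
  rw [Real.norm_of_nonneg (by positivity)]
  exact Real.rpow_le_rpow (abs_nonneg _) (hM _) hq

lemma abs_le_majorant {g₀ : ℝ → ℝ} {G : Sphere n → Sphere n → ℝ} {d ε C : ℝ}
    (hG : ∀ ζ η : Sphere n, ζ ≠ η →
      |G ζ η - g₀ (theta (herm ζ η)) * dist ζ η ^ (d - homDim n)|
        ≤ C * dist ζ η ^ (d - homDim n + ε)) {ζ η : Sphere n} (h : ζ ≠ η) :
    |G ζ η| ≤ majorant n (fun x => g₀ (Real.arcsin x)) d |C| ε ζ η := by
  have h1 := hG ζ η h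
  have h0 := dist_nonneg ζ η
  rw [theta_eq_arcsin] at h1
  have h2 : C * dist ζ η ^ (d - homDim n + ε) ≤ |C| * dist ζ η ^ (d - homDim n + ε) := by
    gcongr
    exact le_abs_self C
  have h3 := abs_sub_abs_le_abs_sub (G ζ η)
    (g₀ (Real.arcsin (sinAngle ζ η)) * dist ζ η ^ (d - homDim n))
  rw [abs_mul, abs_of_nonneg (Real.rpow_nonneg h0 (d - homDim n))] at h3
  rw [majorant]
  linarith

end CR

/-! ### Stability of the kernel in its first variable, and volumes of small balls -/

namespace CR

variable {n : ℕ}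

/-- ‖ζ - η‖² = 2 Re(1 - ζ·η̄), and a real part is at most the modulus. -/
lemma norm_sub_sq_le (ζ η : Sphere n) : ‖(ζ : Ambient n) - η‖ ≤ dist ζ η := by
  have h1 := norm_sub_sq (𝕜 := ℂ) (ζ : Ambient n) η
  rw [norm_eq_of_mem_sphere, norm_eq_of_mem_sphere, ← herm_eq_inner] at h1
  have h2 := dist_sq η ζ
  have h3 : (1 - herm η ζ).re ≤ ‖1 - herm η ζ‖ := Complex.re_le_norm _
  rw [Complex.sub_re, Complex.one_re] at h3
  have h4 : RCLike.re (herm η ζ) = (herm η ζ).re := rfl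
  rw [h4] at h1
  rw [← dist_comm ζ η]
  exact le_of_sq_le_sq (by linarith) (dist_nonneg η ζ)

/-- The difference is the inner product of the increments η - ζ₀ and ζ - ζ₀, minus 1 - ζ·ζ̄₀. Each
increment is bounded by the distance, so the estimate is quadratic in distances, as the homogeneity
requires. -/
lemma norm_herm_sub_le (ζ₀ ζ η : Sphere n) :
    ‖herm ζ η - herm ζ₀ η‖ ≤ dist ζ₀ ζ * dist ζ₀ η + dist ζ₀ ζ ^ 2 / 2 := by
  have e : herm ζ η - herm ζ₀ η =
      inner ℂ ((η : Ambient n) - ζ₀) ((ζ : Ambient n) - ζ₀) - (1 - herm ζ ζ₀) := by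
    simp only [herm_eq_inner, inner_sub_left, inner_sub_right]
    have h : inner ℂ (ζ₀ : Ambient n) (ζ₀ : Ambient n) = 1 := by
      rw [inner_self_eq_norm_sq_to_K, norm_eq_of_mem_sphere]; simp
    rw [h]
    ring
  rw [e]
  refine (norm_sub_le _ _).trans ?_
  have h1 := dist_sq ζ ζ₀
  rw [dist_comm ζ₀ ζ] at h1
  have h2 := norm_inner_le_norm (𝕜 := ℂ) ((η : Ambient n) - ζ₀) ((ζ : Ambient n) - ζ₀)
  have h3 := norm_sub_sq_le η ζ₀
  have h4 := norm_sub_sq_le ζ ζ₀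
  rw [dist_comm] at h3 h4
  have h5 := mul_le_mul h3 h4 (norm_nonneg _) (dist_nonneg _ _)
  linarith

lemma abs_sin_sub_le {v v₀ : ℂ} (h : v₀ ≠ 0) :
    |v.im / ‖v‖ - v₀.im / ‖v₀‖| ≤ 2 * ‖v - v₀‖ / ‖v₀‖ := by
  have h0 := norm_pos_iff.2 h
  have hs : |v.im / ‖v‖| ≤ 1 := by
    rw [abs_div, abs_norm]
    exact div_le_one_of_le₀ (Complex.abs_im_le_norm v) (norm_nonneg v)
  have hv : v.im = v.im / ‖v‖ * ‖v‖ := by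
    rcases eq_or_ne v 0 with rfl | hv
    · simp
    · rw [div_mul_cancel₀ _ (norm_ne_zero_iff.2 hv)]
  set s := v.im / ‖v‖
  rw [show s - v₀.im / ‖v₀‖ = (s * ‖v₀‖ - v₀.im) / ‖v₀‖ by field_simp, abs_div, abs_norm]
  gcongr
  have e : s * ‖v₀‖ - v₀.im = (v - v₀).im - s * (‖v‖ - ‖v₀‖) := by
    rw [Complex.sub_im, hv]; ring
  have h1 := Complex.abs_im_le_norm (v - v₀)
  have h2 := abs_norm_sub_norm_le v v₀
  have h3 := abs_sub (v - v₀).im (s * (‖v‖ - ‖v₀‖))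
  rw [abs_mul] at h3
  rw [e]
  nlinarith [abs_nonneg (‖v‖ - ‖v₀‖)]

/-- If `ζ` is much closer to `ζ₀` than `η` is, then `ζ · η̄` is close to `ζ₀ · η̄`. -/
lemma herm_close {κ : ℝ} (hκ1 : κ ≤ 1) {ζ₀ ζ η : Sphere n}
    (h : dist ζ₀ ζ ≤ κ * dist ζ₀ η) :
    ‖herm ζ η - herm ζ₀ η‖ ≤ 3 * κ * ‖1 - herm ζ₀ η‖ := by
  have h1 := norm_herm_sub_le ζ₀ ζ η
  have h2 := dist_sq ζ₀ η
  have h3 := dist_nonneg ζ₀ ζ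
  have h4 := dist_nonneg ζ₀ η
  have h5 : dist ζ₀ ζ * dist ζ₀ ζ ≤ κ * dist ζ₀ η * dist ζ₀ η :=
    mul_le_mul h (by nlinarith) h3 (h3.trans h)
  nlinarith

lemma abs_dist_sq_sub_le {κ : ℝ} (hκ1 : κ ≤ 1) {ζ₀ ζ η : Sphere n}
    (h : dist ζ₀ ζ ≤ κ * dist ζ₀ η) :
    |dist ζ η ^ 2 - dist ζ₀ η ^ 2| ≤ 3 * κ * dist ζ₀ η ^ 2 := by
  have h1 := herm_close hκ1 h
  have h2 := abs_norm_sub_norm_le (1 - herm ζ η) (1 - herm ζ₀ η)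
  rw [sub_sub_sub_cancel_left, norm_sub_rev (herm ζ₀ η)] at h2
  rw [dist_sq, dist_sq, ← mul_sub, abs_mul, abs_two]
  linarith

/-- The condition `quasi ζ₀ η < 1` gives |1 + w₀| > 1 and, with κ ≤ 1/6, |1 + w| ≥ 1/2. Away from
the pole -1 the Cayley transform preserves the relative closeness of `herm_close`. This is why the
test functions live where `quasi` is below 1. -/
lemma abs_sinAngle_sub_le {κ : ℝ} (hκ1 : κ ≤ 1 / 6) {ζ₀ ζ η : Sphere n}
    (h : dist ζ₀ ζ ≤ κ * dist ζ₀ η) (h0 : 0 < quasi ζ₀ η) (h1 : quasi ζ₀ η < 1) :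
    |sinAngle ζ η - sinAngle ζ₀ η| ≤ 24 * κ := by
  set w := herm ζ η
  set w₀ := herm ζ₀ η
  have hc : ‖w - w₀‖ ≤ 3 * κ * ‖1 - w₀‖ := herm_close (by linarith) h
  have hv0 : cayley w₀ ≠ 0 := norm_pos_iff.1 h0
  have hw0 : 1 + w₀ ≠ 0 := fun h' => hv0 (by simp [cayley, h'])
  have hw0p := norm_pos_iff.2 hw0
  have hlt : ‖1 - w₀‖ < ‖1 + w₀‖ := by
    have : ‖1 - w₀‖ / ‖1 + w₀‖ < 1 := by rw [← norm_div]; exact h1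
    rwa [div_lt_one hw0p] at this
  have h2 : 2 ≤ ‖1 + w₀‖ + ‖1 - w₀‖ := by
    have := norm_add_le (1 + w₀) (1 - w₀)
    rw [show (1 + w₀) + (1 - w₀) = 2 by ring, Complex.norm_ofNat] at this
    exact this
  have h10 : 0 < ‖1 - w₀‖ := by
    refine norm_pos_iff.2 fun h' => hv0 ?_
    simp [cayley, h']
  have hκ0 : 0 ≤ κ := by
    by_contra hneg
    nlinarith [norm_nonneg (w - w₀)]
  have h3 : 1 / 2 ≤ ‖1 + w‖ := by
    have := norm_sub_norm_le (1 + w₀) (w₀ - w)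
    rw [show 1 + w₀ - (w₀ - w) = 1 + w by ring, norm_sub_rev] at this
    nlinarith
  have hw : 1 + w ≠ 0 := norm_pos_iff.1 (by linarith)
  have e : cayley w - cayley w₀ = 2 * (w₀ - w) / ((1 + w) * (1 + w₀)) := by
    rw [cayley, cayley]; field_simp; ring
  have h4 : ‖cayley w - cayley w₀‖ ≤ 12 * κ * ‖cayley w₀‖ := by
    rw [e, cayley, norm_div, norm_mul, norm_mul, norm_div, Complex.norm_ofNat, norm_sub_rev,
      mul_div_assoc', div_le_div_iff₀ (by positivity) hw0p]
    calc 2 * ‖w - w₀‖ * ‖1 + w₀‖ ≤ 2 * (3 * κ * ‖1 - w₀‖) * ‖1 + w₀‖ := by gcongr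
      _ = 12 * κ * ‖1 - w₀‖ * (1 / 2 * ‖1 + w₀‖) := by ring
      _ ≤ _ := by gcongr
  refine (abs_sin_sub_le hv0).trans ?_
  rw [div_le_iff₀ (norm_pos_iff.2 hv0)]
  change 2 * ‖cayley w - cayley w₀‖ ≤ 24 * κ * ‖cayley w₀‖
  linarith

lemma sinAngle_mem (ζ η : Sphere n) : sinAngle ζ η ∈ Set.Icc (-1 : ℝ) 1 := by
  rw [Set.mem_Icc, ← abs_le, sinAngle, abs_div, abs_norm]
  exact div_le_one_of_le₀ (Complex.abs_im_le_norm _) (norm_nonneg _)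

lemma exists_rpow_close (x : ℝ) {δ : ℝ} (hδ : 0 < δ) :
    ∃ r > 0, ∀ t : ℝ, |t - 1| ≤ r → |t ^ x - 1| ≤ δ := by
  have h : ContinuousAt (fun t : ℝ => t ^ x) 1 :=
    Real.continuousAt_rpow_const _ _ (Or.inl one_ne_zero)
  obtain ⟨r, hr, h'⟩ := Metric.continuousAt_iff.1 h δ hδ
  refine ⟨r / 2, by positivity, fun t ht => ?_⟩
  have := h' (x := t) (by rw [Real.dist_eq]; linarith)
  rw [Real.dist_eq, Real.one_rpow] at this
  exact this.le

/-- A homogeneous kernel hardly changes when its first variable moves over a distance much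
smaller than the distance of its arguments. -/
lemma exists_kernel_close {g : ℝ → ℝ} (hg : ContinuousOn g (Set.Icc (-1) 1)) {M : ℝ}
    (hM : ∀ x, |g x| ≤ M) (x y : ℝ) {δ : ℝ} (hδ : 0 < δ) : ∃ κ > 0, κ ≤ 1 ∧
      ∀ ζ₀ ζ η : Sphere n, 0 < quasi ζ₀ η → quasi ζ₀ η < 1 → dist ζ₀ ζ ≤ κ * dist ζ₀ η →
        ζ ≠ η ∧
        |g (sinAngle ζ η) * dist ζ η ^ x - g (sinAngle ζ₀ η) * dist ζ₀ η ^ x|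
          ≤ δ * dist ζ₀ η ^ x ∧ dist ζ η ^ y ≤ 2 * dist ζ₀ η ^ y := by
  have hM0 : 0 ≤ M := (abs_nonneg _).trans (hM 0)
  have huc := isCompact_Icc.uniformContinuousOn_of_continuous hg
  obtain ⟨r₁, hr₁, h₁⟩ := Metric.uniformContinuousOn_iff.1 huc (δ / 2) (by positivity)
  obtain ⟨r₂, hr₂, h₂⟩ := exists_rpow_close (x / 2) (δ := δ / (2 * (M + 1))) (by positivity)
  obtain ⟨r₃, hr₃, h₃⟩ := exists_rpow_close (y / 2) one_pos
  -- The angle moves by at most 24κ ≤ r₁/2, and the ratio of squared distances by at most 3κ.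
  refine ⟨min (1 / 6) (min (r₁ / 48) (min (r₂ / 3) (r₃ / 3))), by positivity,
    (min_le_left _ _).trans (by norm_num), ?_⟩
  set κ := min (1 / 6) (min (r₁ / 48) (min (r₂ / 3) (r₃ / 3))) with hκ
  have hκ0 : 0 < κ := by positivity
  have hk6 : κ ≤ 1 / 6 := min_le_left _ _
  have hk1 : κ ≤ r₁ / 48 := (min_le_right _ _).trans (min_le_left _ _)
  have hk2 : κ ≤ r₂ / 3 :=
    (min_le_right _ _).trans ((min_le_right _ _).trans (min_le_left _ _))
  have hk3 : κ ≤ r₃ / 3 :=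
    (min_le_right _ _).trans ((min_le_right _ _).trans (min_le_right _ _))
  intro ζ₀ ζ η hq0 hq1 hd
  have hne : ζ₀ ≠ η := by
    rintro rfl
    rw [quasi, herm_eq_one_iff.2 rfl] at hq0
    simp [cayley] at hq0
  have hD0 := dist_pos hne
  have hsq := abs_dist_sq_sub_le (by linarith) hd
  have hD2 : 0 < dist ζ₀ η ^ 2 := by positivity
  have ht : |dist ζ η ^ 2 / dist ζ₀ η ^ 2 - 1| ≤ 3 * κ := by
    rw [div_sub_one hD2.ne', abs_div, abs_of_pos hD2, div_le_iff₀ hD2]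
    exact hsq
  set t := dist ζ η ^ 2 / dist ζ₀ η ^ 2 with htdef
  have ht0 : 0 ≤ t := by positivity
  have hpow : ∀ z : ℝ, dist ζ η ^ z = t ^ (z / 2) * dist ζ₀ η ^ z := by
    intro z
    rw [rpow_dist_eq_sq ζ η, rpow_dist_eq_sq ζ₀ η, ← Real.mul_rpow ht0 hD2.le, htdef,
      div_mul_cancel₀ _ hD2.ne']
  refine ⟨?_, ?_, ?_⟩
  · rintro rfl
    have : dist ζ ζ ^ 2 = 0 := by rw [dist_sq, herm_eq_one_iff.2 rfl]; simp
    rw [htdef, this] at ht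
    norm_num at ht
    linarith
  · have hx := h₂ t (ht.trans (by linarith))
    have hs : |g (sinAngle ζ η) - g (sinAngle ζ₀ η)| ≤ δ / 2 := by
      have h5 := abs_sinAngle_sub_le hk6 hd hq0 hq1
      have := h₁ _ (sinAngle_mem ζ η) _ (sinAngle_mem ζ₀ η) (by
        rw [Real.dist_eq]; linarith)
      rw [Real.dist_eq] at this
      exact this.le
    rw [hpow x, ← mul_assoc, ← sub_mul, abs_mul, abs_of_nonneg (Real.rpow_nonneg hD0.le x)]
    gcongr
    have e : g (sinAngle ζ η) * t ^ (x / 2) - g (sinAngle ζ₀ η) =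
        g (sinAngle ζ η) * (t ^ (x / 2) - 1) + (g (sinAngle ζ η) - g (sinAngle ζ₀ η)) := by ring
    rw [e]
    refine (abs_add_le _ _).trans ?_
    rw [abs_mul]
    have h6 : |g (sinAngle ζ η)| * |t ^ (x / 2) - 1| ≤ (M + 1) * (δ / (2 * (M + 1))) :=
      mul_le_mul ((hM _).trans (by linarith)) hx (abs_nonneg _) (by linarith)
    have h7 : (M + 1) * (δ / (2 * (M + 1))) = δ / 2 := by field_simp
    linarith
  · have hy := h₃ t (ht.trans (by linarith))
    rw [hpow y]
    gcongr
    have := (abs_le.1 hy).2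
    linarith

/-- A lower bound for the measure of small balls. -/
lemma exists_le_surface_ball (hn : 1 ≤ n) (h0 : heisSphereMeasure n ≠ 0) : ∃ c : ℝ, 0 < c ∧
    ∀ (ζ : Sphere n) (t : ℝ), 0 < t → t ≤ 1 →
      ENNReal.ofReal (c * t ^ (n + 1)) ≤ surface n {η | quasi ζ η < t} := by
  have := isFiniteMeasure_heisSphere hn
  set S := (heisSphereMeasure n Set.univ).toReal with hS
  have hS0 : 0 < S := ENNReal.toReal_pos (by simpa using h0) (measure_ne_top _ _)
  refine ⟨1 / 4 * S * ((2 ^ (n + 1))⁻¹ / ((n + 1 : ℕ) : ℝ)), by positivity,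
    fun ζ t ht ht1 => ?_⟩
  have hset : MeasurableSet {η | quasi ζ η < t} :=
    measurableSet_lt (measurable_quasi_left ζ) measurable_const
  -- The weight `quasi`^(n+1) is at most dist^Q on the ball, so after multiplication by dist^(-Q)
  -- the integrand is at most the indicator of the ball.
  set b : ℝ → ℝ≥0∞ := (Set.Iio t).indicator
    (fun ρ => ENNReal.ofReal (ρ ^ (((n + 1 : ℕ) : ℝ)))) with hb
  have hbm : Measurable b := Measurable.indicator (by fun_prop) measurableSet_Iio
  have h1 := (lintegral_dist_separated hn (a := fun _ => 1) measurable_const hbm ζ).2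
  have h2 := lintegral_rpow_Iio (t := t) (α := ((n + 1 : ℕ) : ℝ)) ht (by positivity)
  rw [lintegral_one] at h1
  have h3 : ENNReal.ofReal ((2 ^ (n + 1))⁻¹ * (t ^ (((n + 1 : ℕ) : ℝ)) / ((n + 1 : ℕ) : ℝ))) ≤
      ∫⁻ ρ in Set.Ioi (0 : ℝ), ENNReal.ofReal (ρ⁻¹ * ((1 + ρ) ^ (n + 1))⁻¹) * b ρ := by
    rw [ENNReal.ofReal_mul (by positivity), ← h2, ← lintegral_const_mul' _ _ ENNReal.ofReal_ne_top]
    refine setLIntegral_mono_ae' measurableSet_Ioi (ae_of_all _ fun ρ hρ => ?_)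
    have hρ0 : 0 < ρ := hρ
    by_cases hρt : ρ ∈ Set.Iio t
    · rw [← mul_assoc, ← ENNReal.ofReal_mul (by positivity), mul_comm (_⁻¹) ρ⁻¹]
      gcongr
      linarith [show ρ < t from hρt]
    · simp [hb, hρt]
  have h4 : ∫⁻ η, 1 * b (quasi ζ η) * ENNReal.ofReal (dist ζ η ^ (-(homDim n))) ∂(surface n) ≤
      surface n {η | quasi ζ η < t} := by
    rw [← lintegral_indicator_one hset]
    refine lintegral_mono fun η => ?_
    by_cases hη : quasi ζ η < t
    · rw [Set.indicator_of_mem (show η ∈ {η | quasi ζ η < t} from hη), hb,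
        Set.indicator_of_mem (show quasi ζ η ∈ Set.Iio t from hη), one_mul,
        ← ENNReal.ofReal_mul (Real.rpow_nonneg (quasi_nonneg ζ η) _), Pi.one_apply]
      refine ENNReal.ofReal_le_one.2 ?_
      have hq := quasi_nonneg ζ η
      rcases hq.eq_or_lt with h0 | h0
      · rw [← h0, Real.zero_rpow (by positivity), zero_mul]
        exact zero_le_one
      · have h5 := quasi_le_dist_sq ζ η
        have h6 : quasi ζ η ≤ dist ζ η ^ 2 := by nlinarith [sq_nonneg (dist ζ η)]
        have h7 : 0 < dist ζ η ^ 2 := h0.trans_le h6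
        rw [rpow_dist_eq_sq, homDim_eq, show -(2 * ((n + 1 : ℕ) : ℝ)) / 2 = -((n + 1 : ℕ) : ℝ) by
          ring, Real.rpow_neg h7.le, ← div_eq_mul_inv]
        exact div_le_one_of_le₀ (Real.rpow_le_rpow hq h6 (by positivity)) (by positivity)
    · simp [hb, hη]
  refine le_trans (le_of_eq ?_) (le_trans (mul_le_mul_right h3 _) (h1.trans h4))
  rw [← ENNReal.ofReal_toReal (measure_ne_top (heisSphereMeasure n) Set.univ), ← hS,
    ← ENNReal.ofReal_mul (by positivity), ← ENNReal.ofReal_mul (by positivity),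
    Real.rpow_natCast]
  congr 1
  ring

end CR

/-! ### Test functions and their potentials -/

namespace CR

lemma sub_le_integral {α : Type*} [MeasurableSpace α] {μ : Measure α} {u v k : α → ℝ} {N E : ℝ}
    (hu : AEStronglyMeasurable u μ) (hv : AEStronglyMeasurable v μ) (hu0 : ∀ x, 0 ≤ u x)
    (hv0 : ∀ x, 0 ≤ v x) (hN : 0 ≤ N) (hE : 0 ≤ E)
    (hNu : ∫⁻ x, ENNReal.ofReal (u x) ∂μ = ENNReal.ofReal N)
    (hEv : ∫⁻ x, ENNReal.ofReal (v x) ∂μ ≤ ENNReal.ofReal E) (hk : Integrable k μ)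
    (h : ∀ᵐ x ∂μ, u x - v x ≤ k x) : N - E ≤ ∫ x, k x ∂μ := by
  have hui : Integrable u μ := ⟨hu, by
    rw [hasFiniteIntegral_iff_ofReal (ae_of_all _ hu0), hNu]; exact ENNReal.ofReal_lt_top⟩
  have hvi : Integrable v μ := ⟨hv, by
    rw [hasFiniteIntegral_iff_ofReal (ae_of_all _ hv0)]
    exact hEv.trans_lt ENNReal.ofReal_lt_top⟩
  have h1 : ∫ x, u x ∂μ = N := by
    rw [integral_eq_lintegral_of_nonneg_ae (ae_of_all _ hu0) hu, hNu, ENNReal.toReal_ofReal hN]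
  have h2 : ∫ x, v x ∂μ ≤ E := by
    rw [integral_eq_lintegral_of_nonneg_ae (ae_of_all _ hv0) hv]
    exact ENNReal.toReal_le_of_le_ofReal hE hEv
  have h3 := integral_mono_ae (hui.sub hvi) hk h
  have h4 : ∫ x, (u - v) x ∂μ = ∫ x, u x ∂μ - ∫ x, v x ∂μ := integral_sub hui hvi
  linarith

variable {n : ℕ}

/-- The region `ρ ≤ |(1 - w) / (1 + w)| < 1`, where `w = ζ₀ · η̄`. -/
def shell (ζ₀ : Sphere n) (ρ : ℝ) : Set (Sphere n) := {η | ρ ≤ quasi ζ₀ η ∧ quasi ζ₀ η < 1}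

lemma measurableSet_shell (ζ₀ : Sphere n) (ρ : ℝ) : MeasurableSet (shell ζ₀ ρ) :=
  (measurableSet_le measurable_const (measurable_quasi_left ζ₀)).inter
    (measurableSet_lt (measurable_quasi_left ζ₀) measurable_const)

/-- The integral of `|g| ^ q d ^ (-Q)` over a shell. -/
noncomputable def shellMass (g : ℝ → ℝ) (q : ℝ) (ζ₀ : Sphere n) (ρ : ℝ) : ℝ :=
  (∫⁻ η in shell ζ₀ ρ, ENNReal.ofReal (|g (sinAngle ζ₀ η)| ^ q * dist ζ₀ η ^ (-(homDim n)))
    ∂(surface n)).toReal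

lemma shellMass_nonneg (g : ℝ → ℝ) (q : ℝ) (ζ₀ : Sphere n) (ρ : ℝ) : 0 ≤ shellMass g q ζ₀ ρ :=
  ENNReal.toReal_nonneg

section Mass

variable {g : ℝ → ℝ} {q I ρ : ℝ}

lemma lintegral_shell_le (hn : 1 ≤ n) (hg : Measurable g)
    (hI : ∫⁻ u, ENNReal.ofReal (|g u.2| ^ q) ∂(heisSphereMeasure n) = ENNReal.ofReal I)
    (hI0 : 0 ≤ I) (hρ : 0 < ρ) (hρ1 : ρ ≤ 1) (ζ₀ : Sphere n) :
    ∫⁻ η in shell ζ₀ ρ, ENNReal.ofReal (|g (sinAngle ζ₀ η)| ^ q * dist ζ₀ η ^ (-(homDim n)))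
      ∂(surface n) ≤ ENNReal.ofReal (1 / 4 * I * Real.log (1 / ρ)) := by
  refine le_trans (le_of_eq ?_) (shell_main_le hn hg hI hI0 hρ hρ1 ζ₀)
  refine lintegral_congr fun η => ?_
  rw [ENNReal.ofReal_mul (by positivity)]

lemma ofReal_shellMass (hn : 1 ≤ n) (hg : Measurable g)
    (hI : ∫⁻ u, ENNReal.ofReal (|g u.2| ^ q) ∂(heisSphereMeasure n) = ENNReal.ofReal I)
    (hI0 : 0 ≤ I) (hρ : 0 < ρ) (hρ1 : ρ ≤ 1) (ζ₀ : Sphere n) :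
    ∫⁻ η in shell ζ₀ ρ, ENNReal.ofReal (|g (sinAngle ζ₀ η)| ^ q * dist ζ₀ η ^ (-(homDim n)))
      ∂(surface n) = ENNReal.ofReal (shellMass g q ζ₀ ρ) :=
  (ENNReal.ofReal_toReal (ne_top_of_le_ne_top ENNReal.ofReal_ne_top
    (lintegral_shell_le hn hg hI hI0 hρ hρ1 ζ₀))).symm

lemma le_shellMass (hn : 1 ≤ n) (hg : Measurable g)
    (hI : ∫⁻ u, ENNReal.ofReal (|g u.2| ^ q) ∂(heisSphereMeasure n) = ENNReal.ofReal I)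
    (hI0 : 0 ≤ I) (hρ : 0 < ρ) (hρ1 : ρ ≤ 1) (ζ₀ : Sphere n) :
    1 / 4 * I * (Real.log (1 / ρ) - (n + 1)) ≤ shellMass g q ζ₀ ρ := by
  have h1 := (lintegral_dist_separated hn (a := fun x => ENNReal.ofReal (|g x| ^ q))
    (b := (Set.Ico ρ 1).indicator 1) (by fun_prop)
    (measurable_one.indicator measurableSet_Ico) ζ₀).2
  have h2 := le_lintegral_inv_Ico n hρ hρ1
  rw [← tsub_le_iff_right, ← ENNReal.ofReal_sub _ (by positivity)] at h2
  have h3 := (mul_le_mul_right h2 _).trans h1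
  rw [hI, ← ENNReal.ofReal_mul (by norm_num), ← ENNReal.ofReal_mul (by positivity)] at h3
  rw [← ENNReal.ofReal_le_ofReal_iff (shellMass_nonneg g q ζ₀ ρ)]
  refine (h3.trans (le_of_eq ?_)).trans (ofReal_shellMass hn hg hI hI0 hρ hρ1 ζ₀).le
  rw [← lintegral_indicator (measurableSet_shell ζ₀ ρ)]
  refine lintegral_congr fun η => ?_
  by_cases hη : η ∈ shell ζ₀ ρ
  · rw [Set.indicator_of_mem hη, Set.indicator_of_mem (show quasi ζ₀ η ∈ Set.Ico ρ 1 from hη),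
      Pi.one_apply, mul_one, ENNReal.ofReal_mul (by positivity)]
  · rw [Set.indicator_of_notMem hη,
      Set.indicator_of_notMem (show quasi ζ₀ η ∉ Set.Ico ρ 1 from hη), mul_zero, zero_mul]

end Mass

/-- Functions that are almost extremal as `ρ → 0`. -/
noncomputable def testFun (g : ℝ → ℝ) (d q : ℝ) (ζ₀ : Sphere n) (ρ : ℝ) : Sphere n → ℝ :=
  (shell ζ₀ ρ).indicator fun η =>
    g (sinAngle ζ₀ η) * |g (sinAngle ζ₀ η)| ^ (q - 2) * dist ζ₀ η ^ (-d)

lemma measurable_testFun {g : ℝ → ℝ} (hg : Measurable g) (d q : ℝ) (ζ₀ : Sphere n) (ρ : ℝ) :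
    Measurable (testFun g d q ζ₀ ρ) := by
  have h1 := measurable_dist_left ζ₀
  have h2 := measurable_sinAngle_left ζ₀
  exact Measurable.indicator (by fun_prop) (measurableSet_shell ζ₀ ρ)

lemma abs_mul_abs_rpow (x : ℝ) {q : ℝ} (hq : 1 < q) : |x * |x| ^ (q - 2)| = |x| ^ (q - 1) := by
  rcases eq_or_ne x 0 with rfl | hx
  · rw [abs_zero, Real.zero_rpow (by linarith : q - 1 ≠ 0), zero_mul, abs_zero]
  · rw [abs_mul, abs_of_nonneg (Real.rpow_nonneg (abs_nonneg x) _),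
      show q - 1 = 1 + (q - 2) by ring, Real.rpow_add (abs_pos.2 hx), Real.rpow_one]

lemma mul_mul_abs_rpow (x : ℝ) {q : ℝ} (hq : 1 < q) : x * (x * |x| ^ (q - 2)) = |x| ^ q := by
  rcases eq_or_ne x 0 with rfl | hx
  · rw [abs_zero, Real.zero_rpow (by linarith : q ≠ 0), zero_mul]
  · have h : |x| ^ q = |x| ^ (2 : ℝ) * |x| ^ (q - 2) := by
      rw [← Real.rpow_add (abs_pos.2 hx)]; congr 1; ring
    rw [h, Real.rpow_two, sq_abs]
    ring

section Norm

variable {𝕜 : Type*} [RCLike 𝕜] {g : ℝ → ℝ} {d p q I ρ : ℝ}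

/-- Since (q - 1)p = q and dp = Q, the p-th power of the test function is exactly the integrand of
`shellMass`. This is the equality case of Hölder's inequality for the homogeneous kernel. -/
lemma eLpNorm_testFun (hn : 1 ≤ n) (hd : 0 < d) (hdQ : d < homDim n) (hp : p = homDim n / d)
    (hpq : 1 / p + 1 / q = 1) (hg : Measurable g)
    (hI : ∫⁻ u, ENNReal.ofReal (|g u.2| ^ q) ∂(heisSphereMeasure n) = ENNReal.ofReal I)
    (hI0 : 0 ≤ I) (hρ : 0 < ρ) (hρ1 : ρ ≤ 1) (ζ₀ : Sphere n) :
    eLpNorm (fun η => (testFun g d q ζ₀ ρ η : 𝕜)) (ENNReal.ofReal p) (surface n) =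
      ENNReal.ofReal (shellMass g q ζ₀ ρ ^ (1 / p)) := by
  obtain ⟨hconj, -, -, -⟩ := exponents hd hdQ hp hpq
  have hp0 := hconj.pos
  rw [eLpNorm_eq_lintegral_rpow_enorm_toReal (by simpa using hp0) ENNReal.ofReal_ne_top,
    ENNReal.toReal_ofReal hp0.le, ← ENNReal.ofReal_rpow_of_nonneg (shellMass_nonneg g q ζ₀ ρ)
    (by positivity), ← ofReal_shellMass hn hg hI hI0 hρ hρ1 ζ₀,
    ← lintegral_indicator (measurableSet_shell ζ₀ ρ)]
  congr 1
  refine lintegral_congr fun η => ?_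
  rw [← ofReal_norm, RCLike.norm_ofReal, ENNReal.ofReal_rpow_of_nonneg (abs_nonneg _) hp0.le]
  by_cases hη : η ∈ shell ζ₀ ρ
  · have hD := dist_nonneg ζ₀ η
    rw [testFun, Set.indicator_of_mem hη, Set.indicator_of_mem hη, abs_mul,
      abs_mul_abs_rpow _ hconj.symm.lt, abs_of_nonneg (Real.rpow_nonneg hD (-d)),
      Real.mul_rpow (by positivity) (by positivity), ← Real.rpow_mul (abs_nonneg _),
      ← Real.rpow_mul hD, hconj.symm.sub_one_mul_conj]
    congr 3
    rw [hp]
    field_simp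
  · rw [testFun, Set.indicator_of_notMem hη, Set.indicator_of_notMem hη, abs_zero,
      Real.zero_rpow hp0.ne', ENNReal.ofReal_zero]

lemma norm_T_ofReal (G : Sphere n → Sphere n → ℝ) (f : Sphere n → ℝ) (ζ : Sphere n) :
    ‖T G (fun η => (f η : 𝕜)) ζ‖ = |∫ η, G ζ η * f η ∂(surface n)| := by
  rw [T, ← RCLike.norm_ofReal (K := 𝕜), ← integral_ofReal]
  simp

end Norm

end CR

/-! ### Lower bounds for the potentials near ζ₀ -/

namespace CR

variable {n : ℕ}

/-- Pointwise form of the next result: k is G(ζ, η), B its homogeneous part, s₀ and D₀ the sine of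
the angle and the distance seen from ζ₀. Replacing k by the homogeneous kernel at ζ₀ costs a
δ-multiple of D₀^(-Q), logarithmic after integration, and an integrable term. -/
lemma kernel_mul_ge {g : ℝ → ℝ} {d q ε C M δ : ℝ} (hq : 1 < q) (hM : ∀ x, |g x| ≤ M) (hC : 0 ≤ C)
    {k s₀ D₀ B : ℝ} {b : ℝ} (hD₀ : 0 < D₀) (h1 : |k - B| ≤ C * b)
    (h2 : |B - g s₀ * D₀ ^ (d - homDim n)| ≤ δ * D₀ ^ (d - homDim n))
    (h3 : b ≤ 2 * D₀ ^ (d - homDim n + ε)) :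
    |g s₀| ^ q * D₀ ^ (-(homDim n)) - M ^ (q - 1) *
        (δ * D₀ ^ (-(homDim n)) + 2 * C * D₀ ^ (ε - homDim n)) ≤
      k * (g s₀ * |g s₀| ^ (q - 2) * D₀ ^ (-d)) := by
  have hM0 : 0 ≤ M := (abs_nonneg _).trans (hM 0)
  set x := d - homDim n with hx
  set φ := g s₀ * |g s₀| ^ (q - 2) with hφ
  have hφ1 : |φ| ≤ M ^ (q - 1) := by
    rw [hφ, abs_mul_abs_rpow _ hq]
    exact Real.rpow_le_rpow (abs_nonneg _) (hM _) (by linarith)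
  have hφ2 : g s₀ * φ = |g s₀| ^ q := mul_mul_abs_rpow _ hq
  have e1 : D₀ ^ (-(homDim n)) = D₀ ^ x * D₀ ^ (-d) := by
    rw [← Real.rpow_add hD₀]; congr 1; rw [hx]; ring
  have e2 : D₀ ^ (ε - homDim n) = D₀ ^ (x + ε) * D₀ ^ (-d) := by
    rw [← Real.rpow_add hD₀]; congr 1; rw [hx]; ring
  have h4 : |k - g s₀ * D₀ ^ x| ≤ δ * D₀ ^ x + 2 * C * D₀ ^ (x + ε) := by
    have := abs_sub_le k B (g s₀ * D₀ ^ x)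
    nlinarith
  have h5 : |(k - g s₀ * D₀ ^ x) * φ| ≤ (δ * D₀ ^ x + 2 * C * D₀ ^ (x + ε)) * M ^ (q - 1) := by
    rw [abs_mul]
    exact mul_le_mul h4 hφ1 (abs_nonneg _) ((abs_nonneg _).trans h4)
  have h6 := mul_le_mul_of_nonneg_right (neg_le_of_abs_le h5) (Real.rpow_nonneg hD₀.le (-d))
  rw [e1, e2, ← hφ2]
  nlinarith

/-- Near `ζ₀`, the potential of a test function is almost as large as its mass. -/
lemma exists_potential_ge (hn : 1 ≤ n) {d p q : ℝ} (hd : 0 < d) (hdQ : d < homDim n)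
    (hp : p = homDim n / d) (hpq : 1 / p + 1 / q = 1) {g : ℝ → ℝ} (hg : Measurable g)
    (hgc : ContinuousOn g (Set.Icc (-1) 1)) {M : ℝ} (hM : ∀ x, |g x| ≤ M) {C ε : ℝ} (hC : 0 ≤ C)
    (hε : 0 < ε) {I : ℝ} (hI0 : 0 < I)
    (hI : ∫⁻ u, ENNReal.ofReal (|g u.2| ^ q) ∂(heisSphereMeasure n) = ENNReal.ofReal I)
    {G : Sphere n → Sphere n → ℝ}
    (hGm : Measurable (fun x : {x : Sphere n × Sphere n // x.1 ≠ x.2} => G x.1.1 x.1.2))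
    (hG : ∀ ζ η : Sphere n, ζ ≠ η →
      |G ζ η - g (sinAngle ζ η) * dist ζ η ^ (d - homDim n)| ≤ C * dist ζ η ^ (d - homDim n + ε))
    (ζ₀ : Sphere n) {δ : ℝ} (hδ : 0 < δ) :
    ∃ κ B : ℝ, 0 < κ ∧ κ ≤ 1 ∧ ∀ ρ : ℝ, 0 < ρ → ρ ≤ 1 → ∀ᵐ ζ ∂(surface n), quasi ζ₀ ζ < κ * ρ →
      shellMass g q ζ₀ ρ - δ * Real.log (1 / ρ) - B ≤
        ∫ η, G ζ η * testFun g d q ζ₀ ρ η ∂(surface n) := by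
  have := isFiniteMeasure_heisSphere hn
  obtain ⟨hconj, -, -, -⟩ := exponents hd hdQ hp hpq
  have hq := hconj.symm.lt
  have hM0 : 0 ≤ M := (abs_nonneg _).trans (hM 0)
  obtain ⟨M', R, hR, hK⟩ := exists_adamsKernel hn hd hdQ hp hpq hg hM hC hε hI0 hI
  have hGK : ∀ ζ η : Sphere n, ζ ≠ η → |G ζ η| ≤ majorant n g d C ε ζ η := by
    intro ζ η h
    have h1 := hG ζ η h
    have h3 := abs_sub_abs_le_abs_sub (G ζ η) (g (sinAngle ζ η) * dist ζ η ^ (d - homDim n))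
    rw [abs_mul, abs_of_nonneg (Real.rpow_nonneg (dist_nonneg ζ η) (d - homDim n))] at h3
    rw [majorant]
    linarith
  obtain ⟨Ce, hCe0, hCe⟩ := lintegral_near_le hn hε
  set S := (heisSphereMeasure n Set.univ).toReal with hS
  have hS0 : 0 ≤ S := ENNReal.toReal_nonneg
  have hSI : ∫⁻ u, ENNReal.ofReal (|(fun _ : ℝ => (1 : ℝ)) u.2| ^ q) ∂(heisSphereMeasure n) =
      ENNReal.ofReal S := by
    simp [hS, ENNReal.ofReal_toReal (measure_ne_top (heisSphereMeasure n) Set.univ)]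
  set m := M ^ (q - 1) with hm
  have hm0 : 0 ≤ m := by positivity
  set δ' := δ / (m * S + 1) with hδ'
  have hδ'0 : 0 < δ' := by positivity
  obtain ⟨κ, hκ0, hκ1, hκ⟩ := exists_kernel_close (n := n) hgc hM (d - homDim n)
    (d - homDim n + ε) hδ'0
  -- If `quasi ζ₀ ζ` < κ²ρ/2 then dist ζ₀ ζ² ≤ 2κ²ρ, while dist ζ₀ η² ≥ 2ρ on the shell; this gives
  -- dist ζ₀ ζ ≤ κ · dist ζ₀ η.
  refine ⟨κ ^ 2 / 2, m * (2 * C * Ce), by positivity, by nlinarith, fun ρ hρ hρ1 => ?_⟩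
  have hL : 0 ≤ Real.log (1 / ρ) := Real.log_nonneg (by rwa [one_le_div hρ])
  have hmem : MemLp (testFun g d q ζ₀ ρ) (ENNReal.ofReal p) (surface n) := by
    refine ⟨(measurable_testFun hg d q ζ₀ ρ).aestronglyMeasurable, ?_⟩
    have := eLpNorm_testFun (𝕜 := ℝ) hn hd hdQ hp hpq hg hI hI0.le hρ hρ1 ζ₀
    simp only [RCLike.ofReal_real_eq_id, id] at this
    rw [this]
    exact ENNReal.ofReal_lt_top
  filter_upwards [ae_integrable_mul hn hK hR hGm hGK hmem, lintegral_herm_point hn ζ₀ (-1)]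
    with ζ hint hne hζ
  simp only [RCLike.ofReal_real_eq_id, id] at hint
  have hset := measurableSet_shell ζ₀ ρ
  have hT : ∫ η, G ζ η * testFun g d q ζ₀ ρ η ∂(surface n) =
      ∫ η in shell ζ₀ ρ, G ζ η * testFun g d q ζ₀ ρ η ∂(surface n) := by
    refine (setIntegral_eq_integral_of_forall_compl_eq_zero fun η hη => ?_).symm
    rw [testFun, Set.indicator_of_notMem hη, mul_zero]
  have h1 := measurable_dist_left ζ₀
  have h2 := measurable_sinAngle_left ζ₀
  have hmain := sub_le_integral (μ := (surface n).restrict (shell ζ₀ ρ))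
    (u := fun η => |g (sinAngle ζ₀ η)| ^ q * dist ζ₀ η ^ (-(homDim n)))
    (v := fun η => m * (δ' * dist ζ₀ η ^ (-(homDim n)) + 2 * C * dist ζ₀ η ^ (ε - homDim n)))
    (k := fun η => G ζ η * testFun g d q ζ₀ ρ η) (N := shellMass g q ζ₀ ρ)
    (E := m * (δ' * (1 / 4 * S * Real.log (1 / ρ)) + 2 * C * Ce))
    (by fun_prop) (by fun_prop) (fun η => ?_) (fun η => ?_) (shellMass_nonneg _ _ _ _)
    (by positivity) (ofReal_shellMass hn hg hI hI0.le hρ hρ1 ζ₀) ?_ hint.integrableOn ?_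
  · rw [hT]
    refine le_trans ?_ hmain
    have h3 : m * (δ' * (1 / 4 * S * Real.log (1 / ρ))) ≤ δ * Real.log (1 / ρ) := by
      have h4 : m * S * δ' ≤ δ := by
        rw [hδ', mul_div_assoc', div_le_iff₀ (by positivity)]
        nlinarith
      have h5 : 0 ≤ m * S * δ' := by positivity
      nlinarith
    linarith
  · have := dist_nonneg ζ₀ η
    positivity
  · have := dist_nonneg ζ₀ η
    positivity
  · have h3 := lintegral_shell_le (g := fun _ => 1) hn measurable_const hSI hS0 hρ hρ1 ζ₀
    simp only [abs_one, Real.one_rpow, one_mul] at h3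
    have h4 : ∫⁻ η in shell ζ₀ ρ, ENNReal.ofReal (dist ζ₀ η ^ (ε - homDim n)) ∂(surface n) ≤
        ENNReal.ofReal Ce := by
      have := hCe ζ₀ 1 one_pos
      rw [Real.one_rpow, mul_one] at this
      exact (lintegral_mono_set fun η hη => hη.2).trans this
    rw [ENNReal.ofReal_mul hm0, ENNReal.ofReal_add (by positivity) (by positivity),
      ENNReal.ofReal_mul hδ'0.le, ENNReal.ofReal_mul (p := 2 * C) (by positivity)]
    refine le_trans (le_of_eq ?_) (mul_le_mul_right
      (add_le_add (mul_le_mul_right h3 _) (mul_le_mul_right h4 _)) _)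
    rw [← lintegral_const_mul' _ _ ENNReal.ofReal_ne_top,
      ← lintegral_const_mul' _ _ ENNReal.ofReal_ne_top, ← lintegral_add_left (by fun_prop),
      ← lintegral_const_mul' _ _ ENNReal.ofReal_ne_top]
    refine lintegral_congr fun η => ?_
    have := dist_nonneg ζ₀ η
    rw [ENNReal.ofReal_mul hm0, ENNReal.ofReal_add (by positivity) (by positivity),
      ENNReal.ofReal_mul hδ'0.le, ENNReal.ofReal_mul (p := 2 * C) (by positivity)]
  · filter_upwards [ae_restrict_mem hset] with η hη
    have hq0 : 0 < quasi ζ₀ η := hρ.trans_le hη.1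
    have h5 := quasi_le_dist_sq ζ₀ η
    have h6 := dist_sq_le_quasi hne
    have h7 : dist ζ₀ ζ ≤ κ * dist ζ₀ η := by
      refine le_of_sq_le_sq ?_ (mul_nonneg hκ0.le (dist_nonneg _ _))
      rw [mul_pow]
      have h8 : 2 * ρ ≤ dist ζ₀ η ^ 2 := by nlinarith [sq_nonneg (dist ζ₀ η), hη.1, hη.2]
      nlinarith [sq_nonneg κ]
    obtain ⟨hne', ha, hb⟩ := hκ ζ₀ ζ η hq0 hη.2 h7
    have hD₀ : 0 < dist ζ₀ η := by
      refine dist_pos ?_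
      rintro rfl
      rw [quasi, herm_eq_one_iff.2 rfl] at hq0
      simp [cayley] at hq0
    rw [testFun, Set.indicator_of_mem hη]
    exact kernel_mul_ge hq hM hC hD₀ (hG ζ η hne') ha hb

end CR

/-! ### Blow-up above the sharp constant -/

namespace CR

variable {n : ℕ} {𝕜 : Type*} [RCLike 𝕜]

/-- On U the quotient is at least τN/N^(1/p) = τN^(1/q), whose q-th power is τ^q N; restricting the
integral to U gives the bound. -/
lemma expIntegral_ge_of_potential_ge {G : Sphere n → Sphere n → ℝ} {f : Sphere n → ℝ}
    {p q a τ N V : ℝ} (ha : 0 ≤ a) (hpq : p.HolderConjugate q) (hτ : 0 ≤ τ) (hN : 0 < N)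
    (hf : lpNorm p (fun η => (f η : 𝕜)) = N ^ (1 / p)) {U : Set (Sphere n)}
    (hU : MeasurableSet U) (hV : ENNReal.ofReal V ≤ surface n U)
    (h : ∀ᵐ ζ ∂(surface n), ζ ∈ U → τ * N ≤ ∫ η, G ζ η * f η ∂(surface n)) :
    ENNReal.ofReal (Real.exp (a * τ ^ q * N) * V) ≤
      expIntegral G p q a (fun η => (f η : 𝕜)) := by
  have hq := hpq.symm.pos
  rw [ENNReal.ofReal_mul (Real.exp_pos _).le]
  refine (mul_le_mul_right hV _).trans ?_
  rw [← setLIntegral_const]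
  refine le_trans ?_ (setLIntegral_le_lintegral U _)
  refine setLIntegral_mono_ae' hU ?_
  filter_upwards [h] with ζ hζ hζU
  apply ENNReal.ofReal_le_ofReal
  apply Real.exp_le_exp.2
  rw [mul_assoc, norm_T_ofReal, hf]
  refine mul_le_mul_of_nonneg_left ?_ ha
  have h1 : τ * N ≤ |∫ η, G ζ η * f η ∂(surface n)| := (hζ hζU).trans (le_abs_self _)
  have h2 : τ * N ^ (1 / q) ≤ |∫ η, G ζ η * f η ∂(surface n)| / N ^ (1 / p) := by
    rw [le_div_iff₀ (by positivity), mul_assoc, ← Real.rpow_add hN]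
    have h3 : 1 / q + 1 / p = 1 := by
      rw [one_div, one_div]; exact hpq.symm.inv_add_inv_eq_one
    rwa [h3, Real.rpow_one]
  have h4 : (τ * N ^ (1 / q)) ^ q = τ ^ q * N := by
    rw [Real.mul_rpow hτ (by positivity), ← Real.rpow_mul hN.le, one_div_mul_cancel hq.ne',
      Real.rpow_one]
  rw [← h4]
  exact Real.rpow_le_rpow (by positivity) h2 hq.le

/-- The exponential integrals of the test functions blow up for a supercritical exponent. -/
theorem exists_tendsto_expIntegral (hn : 1 ≤ n) {d p q : ℝ} (hd : 0 < d) (hdQ : d < homDim n)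
    (hp : p = homDim n / d) (hpq : 1 / p + 1 / q = 1) {g : ℝ → ℝ} (hg : Measurable g)
    (hgc : ContinuousOn g (Set.Icc (-1) 1)) {M : ℝ} (hM : ∀ x, |g x| ≤ M) {C ε : ℝ} (hC : 0 ≤ C)
    (hε : 0 < ε) {I : ℝ} (hI0 : 0 < I)
    (hI : ∫⁻ u, ENNReal.ofReal (|g u.2| ^ q) ∂(heisSphereMeasure n) = ENNReal.ofReal I)
    {G : Sphere n → Sphere n → ℝ}
    (hGm : Measurable (fun x : {x : Sphere n × Sphere n // x.1 ≠ x.2} => G x.1.1 x.1.2))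
    (hG : ∀ ζ η : Sphere n, ζ ≠ η →
      |G ζ η - g (sinAngle ζ η) * dist ζ η ^ (d - homDim n)| ≤ C * dist ζ η ^ (d - homDim n + ε))
    {a : ℝ} (ha : 2 * homDim n / I < a) :
    ∃ F : ℕ → Sphere n → 𝕜,
      (∀ m, MemLp (F m) (ENNReal.ofReal p) (surface n) ∧ lpNorm p (F m) ≠ 0) ∧
      Tendsto (fun m => expIntegral G p q a (F m)) atTop (𝓝 ⊤) := by
  obtain ⟨hconj, -, -, -⟩ := exponents hd hdQ hp hpq
  have hq := hconj.symm.pos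
  have hp0 := hconj.pos
  have hQ := homDim_pos n
  have ha0 : 0 < a := lt_trans (by positivity) ha
  let ζ₀ : Sphere n := ⟨EuclideanSpace.single 0 1, by simp⟩
  have hn0 : (0 : ℝ) < (n : ℝ) + 1 := by positivity
  have hK : (n : ℝ) + 1 < a * I / 4 := by
    rw [div_lt_iff₀ hI0] at ha
    unfold homDim at ha
    linarith
  have hK0 : 0 < a * I / 4 := by positivity
  set x := ((n : ℝ) + 1) / (a * I / 4) with hx
  have hx0 : 0 < x := by positivity
  have hx1 : x < 1 := (div_lt_one hK0).2 hK
  -- τ^q is the midpoint of x and 1, so τ < 1 leaves room for the error of the potential, while a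
  -- τ^q I/4 still exceeds n + 1, by γ.
  set τ := ((1 + x) / 2) ^ (1 / q) with hτ
  have hτ0 : 0 < τ := by positivity
  have hτ1 : τ < 1 := Real.rpow_lt_one (by positivity) (by linarith) (by positivity)
  have hτq : τ ^ q = (1 + x) / 2 := by
    rw [hτ, ← Real.rpow_mul (by positivity), one_div_mul_cancel hq.ne', Real.rpow_one]
  have hτ1' : 0 < 1 - τ := by linarith
  set γ := (a * I / 4 - (n + 1)) / 2 with hγ
  have hγ0 : 0 < γ := by linarith
  have hγe : a * τ ^ q * (I / 4) = γ + (n + 1) := by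
    have : x * (a * I / 4) = n + 1 := div_mul_cancel₀ _ hK0.ne'
    rw [hτq, hγ]
    linarith
  obtain ⟨κ, B, hκ0, hκ1, hB⟩ := exists_potential_ge hn hd hdQ hp hpq hg hgc hM hC hε hI0 hI hGm hG
    ζ₀ (δ := (1 - τ) * I / 8) (by positivity)
  have hS : heisSphereMeasure n ≠ 0 := by
    intro h
    rw [h, lintegral_zero_measure] at hI
    exact absurd hI.symm (ENNReal.ofReal_pos.2 hI0).ne'
  obtain ⟨c, hc0, hc⟩ := exists_le_surface_ball hn hS
  -- The first entry makes the shell mass positive. From the second on, (1 - τ) times the lower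
  -- bound for the mass covers δ log(1/ρ) + B, as δ is half of (1 - τ)I/4.
  set L₀ := max ((n : ℝ) + 2) (((1 - τ) * (I / 4) * (n + 1) + B) / ((1 - τ) * I / 8)) with hL₀
  set ρ : ℕ → ℝ := fun m => Real.exp (-(L₀ + m)) with hρ
  have hL : ∀ m : ℕ, Real.log (1 / ρ m) = L₀ + m := by
    intro m
    rw [hρ, one_div, Real.log_inv, Real.log_exp, neg_neg]
  have hL1 : ∀ m : ℕ, (n : ℝ) + 2 ≤ L₀ + m := fun m => by
    have : (n : ℝ) + 2 ≤ L₀ := le_max_left _ _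
    have : (0 : ℝ) ≤ m := by positivity
    linarith
  have hL2 : ∀ m : ℕ, (1 - τ) * (I / 4) * (n + 1) + B ≤ (1 - τ) * I / 8 * (L₀ + m) := fun m => by
    rw [← div_le_iff₀' (by positivity)]
    have h1 : ((1 - τ) * (I / 4) * (n + 1) + B) / ((1 - τ) * I / 8) ≤ L₀ := le_max_right _ _
    have : (0 : ℝ) ≤ m := by positivity
    linarith
  have hρ0 : ∀ m, 0 < ρ m := fun m => Real.exp_pos _
  have hρ1 : ∀ m, ρ m ≤ 1 := fun m => Real.exp_le_one_iff.2 (by linarith [hL1 m])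
  have hNge : ∀ m : ℕ, 1 / 4 * I * (L₀ + m - (n + 1)) ≤ shellMass g q ζ₀ (ρ m) := fun m => by
    rw [← hL m]
    exact le_shellMass hn hg hI hI0.le (hρ0 m) (hρ1 m) ζ₀
  have hN0 : ∀ m, 0 < shellMass g q ζ₀ (ρ m) := fun m => by
    refine lt_of_lt_of_le ?_ (hNge m)
    have : 0 < L₀ + m - (n + 1) := by linarith [hL1 m]
    positivity
  have hnorm := fun m => eLpNorm_testFun (𝕜 := 𝕜) hn hd hdQ hp hpq hg hI hI0.le (hρ0 m) (hρ1 m) ζ₀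
  have hlp : ∀ m, lpNorm p (fun η => (testFun g d q ζ₀ (ρ m) η : 𝕜)) =
      shellMass g q ζ₀ (ρ m) ^ (1 / p) := fun m => by
    rw [lpNorm, hnorm m, ENNReal.toReal_ofReal (Real.rpow_nonneg (hN0 m).le _)]
  refine ⟨fun m η => (testFun g d q ζ₀ (ρ m) η : 𝕜), fun m => ⟨⟨?_, ?_⟩, ?_⟩, ?_⟩
  · exact (RCLike.continuous_ofReal.measurable.comp
      (measurable_testFun hg d q ζ₀ (ρ m))).aestronglyMeasurable
  · rw [hnorm m]; exact ENNReal.ofReal_lt_top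
  · rw [hlp m]
    exact (Real.rpow_pos_of_pos (hN0 m) _).ne'
  · have hlow : ∀ m : ℕ, ENNReal.ofReal
        (c * κ ^ (n + 1) * Real.exp (-((γ + (n + 1)) * (n + 1))) * Real.exp (γ * (L₀ + m))) ≤
        expIntegral G p q a (fun η => (testFun g d q ζ₀ (ρ m) η : 𝕜)) := by
      intro m
      have hpot : ∀ᵐ ζ ∂(surface n), ζ ∈ {ζ | quasi ζ₀ ζ < κ * ρ m} →
          τ * shellMass g q ζ₀ (ρ m) ≤
            ∫ η, G ζ η * testFun g d q ζ₀ (ρ m) η ∂(surface n) := by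
        filter_upwards [hB (ρ m) (hρ0 m) (hρ1 m)] with ζ hζ hζU
        refine le_trans ?_ (hζ hζU)
        have h1 := mul_le_mul_of_nonneg_left (hNge m) hτ1'.le
        have h2 := hL2 m
        rw [hL m]
        linarith
      refine le_trans ?_ (expIntegral_ge_of_potential_ge ha0.le hconj hτ0.le (hN0 m) (hlp m)
        (measurableSet_lt (measurable_quasi_left ζ₀) measurable_const)
        (hc ζ₀ (κ * ρ m) (mul_pos hκ0 (hρ0 m)) (mul_le_one₀ hκ1 (hρ0 m).le (hρ1 m))) hpot)
      apply ENNReal.ofReal_le_ofReal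
      have h3 : (γ + (n + 1)) * (L₀ + m - (n + 1)) ≤ a * τ ^ q * shellMass g q ζ₀ (ρ m) := by
        rw [← hγe]
        have := mul_le_mul_of_nonneg_left (hNge m) (by positivity : 0 ≤ a * τ ^ q)
        linarith
      have h4 : ρ m ^ (n + 1) = Real.exp (-((n + 1) * (L₀ + m))) := by
        rw [hρ, ← Real.exp_nat_mul]
        congr 1
        push_cast
        ring
      have h5 := Real.exp_le_exp.2 h3
      -- The volume of the ball costs e^(-(n+1)(L₀ + m)), and the factor e^(γ(L₀ + m)) survives.
      calc _ = Real.exp ((γ + (n + 1)) * (L₀ + m - (n + 1))) * (c * (κ * ρ m) ^ (n + 1)) := by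
            rw [mul_pow, h4]
            have e : Real.exp ((γ + (n + 1)) * (L₀ + m - (n + 1))) =
                Real.exp (-((γ + (n + 1)) * (n + 1))) * Real.exp (γ * (L₀ + m)) *
                  Real.exp ((n + 1) * (L₀ + m)) := by
              rw [← Real.exp_add, ← Real.exp_add]
              congr 1
              ring
            rw [e, Real.exp_neg ((n + 1) * (L₀ + m))]
            field_simp
        _ ≤ _ := by
            have := hρ0 m
            gcongr
    refine tendsto_nhds_top_mono' (ENNReal.tendsto_ofReal_atTop.comp ?_) hlow
    refine Tendsto.const_mul_atTop (by positivity) (Real.tendsto_exp_atTop.comp ?_)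
    exact Tendsto.const_mul_atTop hγ0 (tendsto_atTop_add_const_left _ _ tendsto_natCast_atTop_atTop)

end CR

/-! ### The main theorem -/

theorem theorem18 {𝕜 : Type*} [RCLike 𝕜] (n : ℕ) (hn : 1 ≤ n)
    (d p p' : ℝ) (hd : 0 < d) (hdQ : d < CR.homDim n)
    (hp : p = CR.homDim n / d) (hpp' : 1 / p + 1 / p' = 1)
    -- the bounded measurable function `g₀` on `[-π/2, π/2]`, not almost everywhere zero
    (g₀ : ℝ → ℝ)
    (hg_meas : Measurable (fun x : Set.Icc (-(Real.pi / 2)) (Real.pi / 2) => g₀ x))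
    (hg_bdd : ∃ M : ℝ, ∀ x ∈ Set.Icc (-(Real.pi / 2)) (Real.pi / 2), |g₀ x| ≤ M)
    (hg_ne : CR.sigmaIntegral n g₀ p' ≠ 0)
    -- the kernel, measurable off the diagonal
    (G : CR.Sphere n → CR.Sphere n → ℝ)
    (hG_meas : Measurable
      (fun x : {x : CR.Sphere n × CR.Sphere n // x.1 ≠ x.2} => G x.1.1 x.1.2))
    (ε C : ℝ) (hε : 0 < ε)
    (hG : ∀ ζ η : CR.Sphere n, ζ ≠ η →
      |G ζ η - g₀ (CR.theta (CR.herm ζ η)) * CR.dist ζ η ^ (d - CR.homDim n)|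
        ≤ C * CR.dist ζ η ^ (d - CR.homDim n + ε)) :
    -- `T` is defined on `L^p`
    (∀ F : CR.Sphere n → 𝕜, MemLp F (ENNReal.ofReal p) (CR.surface n) →
      (∀ᵐ ζ ∂(CR.surface n), Integrable (fun η => (G ζ η : 𝕜) * F η) (CR.surface n)) ∧
      AEStronglyMeasurable (CR.T G F) (CR.surface n)) ∧
    -- the Adams inequality
    (∃ C₀ : ℝ, 0 < C₀ ∧
      ∀ F : CR.Sphere n → 𝕜, MemLp F (ENNReal.ofReal p) (CR.surface n) →
        CR.expIntegral G p p' (2 * CR.homDim n / CR.sigmaIntegral n g₀ p') F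
          ≤ ENNReal.ofReal C₀) ∧
    -- sharpness
    (∀ σ : ℝ≥0, 0 < σ → σ ≤ 1 →
      (∃ H : ℝ≥0, HolderOnWith H σ g₀ (Set.Icc (-(Real.pi / 2)) (Real.pi / 2))) →
      ∀ a : ℝ, 2 * CR.homDim n / CR.sigmaIntegral n g₀ p' < a →
        ∃ F : ℕ → CR.Sphere n → 𝕜,
          (∀ m, MemLp (F m) (ENNReal.ofReal p) (CR.surface n) ∧ CR.lpNorm p (F m) ≠ 0) ∧
          Tendsto (fun m => CR.expIntegral G p p' a (F m)) atTop (𝓝 ⊤)) := by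
  obtain ⟨M, hM⟩ := hg_bdd
  obtain ⟨hconj, -, -, -⟩ := CR.exponents hd hdQ hp hpp'
  have hg : Measurable fun x => g₀ (Real.arcsin x) := CR.measurable_comp_arcsin hg_meas
  have hgM : ∀ x, |g₀ (Real.arcsin x)| ≤ M := fun x => hM _ (Real.arcsin_mem_Icc x)
  have hI0 : 0 < CR.sigmaIntegral n g₀ p' :=
    lt_of_le_of_ne (CR.sigmaIntegral_nonneg n g₀ p') hg_ne.symm
  have hI := CR.ofReal_sigmaIntegral hn hconj.symm.pos.le hg hgM
  obtain ⟨M', R, hR, hK⟩ :=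
    CR.exists_adamsKernel hn hd hdQ hp hpp' hg hgM (abs_nonneg C) hε hI0 hI
  have hGK := fun ζ η (h : ζ ≠ η) => CR.abs_le_majorant hG h
  refine ⟨fun F hF => ⟨CR.ae_integrable_mul hn hK hR hG_meas hGK hF,
    CR.aestronglyMeasurable_T hn hG_meas hF.1⟩, ?_, fun σ hσ _ hH a ha => ?_⟩
  · have h := CR.exists_expIntegral_le (𝕜 := 𝕜) hn hK hR hGK
    rwa [inv_div] at h
  · obtain ⟨H, hH⟩ := hH
    have hgc : ContinuousOn (fun x => g₀ (Real.arcsin x)) (Set.Icc (-1) 1) :=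
      (hH.continuousOn hσ).comp Real.continuous_arcsin.continuousOn
        fun x _ => Real.arcsin_mem_Icc x
    refine CR.exists_tendsto_expIntegral hn hd hdQ hp hpp' hg hgc hgM (abs_nonneg C) hε hI0 hI
      hG_meas (fun ζ η h => ?_) ha
    have h1 := hG ζ η h
    rw [CR.theta_eq_arcsin] at h1
    refine h1.trans (mul_le_mul_of_nonneg_right (le_abs_self C) ?_)
    exact Real.rpow_nonneg (CR.dist_nonneg ζ η) _
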